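/- All graphs are finite and simple. A graph $G$ has the $\{0,1\}$-property if there is a map $w:E(G)\to\{0,1\}$ such that $\sum_{e\ni x}w(e)\neq\sum_{e\ni y}w(e)$ for all adjacent vertices $x,y$; such a $w$ is called proper, and the sum at $x$ is the weighted degree of $x$. A tree without the $\{0,1\}$-property is called bad. Define four kinds of trees simultaneously as the smallest isomorphism-closed classes satisfying the following rules: the class $\mathcal B$ and, for trees with a distinguished vertex $v$, the classes $\mathcal M$, $\mathcal P_s$, $\mathcal Q_s$ ($s\ge 0$). 1. $K_2\in\mathcal B$. 2. If $s\ge1$ and $(G,v)\in\mathcal P_s$, then the tree obtained from $G$ and $s$ disjoint copies of $K_2$ by adding a new vertex joined to $v$ and to one vertex of each copy of $K_2$ is in $\mathcal B$. 3. If $G_1,G_2\in\mathcal B$ and $a_ib_i$ is an edge of $G_i$ such that $a_i$ has degree $1$ and $b_i$ has degree $2$ in $G_i$ ($i=1,2$), then the tree obtained by gluing $G_1$ and $G_2$ along these edges ($a_1$ with $a_2$, $b_1$ with $b_2$) is in $\mathcal B$. 4. If adding to $G$ two new vertices $v_1,v_2$ and the edges $vv_1,v_1v_2$ gives a member of $\mathcal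 B$, then $(G,v)\in\mathcal M$. 5. Let $s\ge0$ and let $G$ be obtained from disjoint trees by adding a new vertex $v$ joined to one vertex of each of them, where a tree that belongs to one of the classes $\mathcal M,\mathcal P_t,\mathcal Q_t$ is joined at its distinguished vertex and a member of $\mathcal B$ at any vertex. * If two of the trees are in $\mathcal P_{s+1}$, $s$ are in $\mathcal B$ and the others (any number) in $\mathcal M$, then $(G,v)\in\mathcal Q_s$. * If $s$ of the trees are in $\mathcal B$ and the others (any number) in $\mathcal M$, then $(G,v)\in\mathcal P_s$. * If one tree is in $\mathcal Q_s$, one in $\mathcal P_{s+1}$, $s$ are in $\mathcal B$ and the others (any number) in $\mathcal M$, then $(G,v)\in\mathcal P_{s+1}$. **Theorem 4.** Every tree that is not a member of $\mathcal B$ has the $\{0,1\}$-property. Conversely, every member of $\mathcal B$ is a bad tree; so the bad trees are exactly the members of $\mathcal B$. Moreover, the auxiliary classes are characterised as follows, for a tree $T$ and a vertex $v$ of $T$. $(T,v)\in\mathcal M$ if and only if $T$ is a $G_v(-)$-tree, that is, both bipartition sets of $T$ have even size and there is no proper $\{0,1\}$-weighting of $T$ when the weighted degree of $v$ is increased by $1$.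 $(T,v)\in\mathcal P_s$ (respectively $\mathcal Q_s$) if and only if $T$ is a $G_v(s,s+1)$-tree (respectively a $G_v(s,s+3)$-tree), where $T$ is a $G_v(a,b)$-tree if it has an odd number of vertices, $v$ has weighted degree $a$ in every proper $\{0,1\}$-weighting, and $v$ has (increased) weighted degree $b$ in every $\{0,1\}$-weighting that is proper when the weighted degree of $v$ is increased by $1$. Finally, membership in $\mathcal B$ is decidable in polynomial time: there is one program for a unit-cost random access machine (with addition and truncated subtraction) that, given the adjacency matrix of an arbitrary graph on $n$ vertices, decides whether the graph is in $\mathcal B$ in a number of steps polynomial in $n$. -/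

import Mathlib

universe u

namespace ZeroOneTrees

/-! ### Edge-weightings with weights 0 and 1 -/

/-- The sum of the weights of the edges of `G` incident to `x`. -/
noncomputable def weightedDegree {V : Type u} [Fintype V] (G : SimpleGraph V)
    (w : Sym2 V → ℕ) (x : V) : ℕ :=
  open Classical in ∑ e ∈ G.incidenceFinset x, w e

/-- Every edge of `G` has weight 0 or 1; values of `w` outside the edge set are irrelevant. -/
def IsZeroOneWeighting {V : Type u} (G : SimpleGraph V) (w : Sym2 V → ℕ) : Prop :=
  ∀ e ∈ G.edgeSet, w e = 0 ∨ w e = 1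

/-- `w` is a neighbour sum-distinguishing `{0,1}`-edge-weighting of `G`. -/
def IsProper {V : Type u} [Fintype V] (G : SimpleGraph V) (w : Sym2 V → ℕ) : Prop :=
  IsZeroOneWeighting G w ∧
    ∀ x y, G.Adj x y → weightedDegree G w x ≠ weightedDegree G w y

/-- The `{0,1}`-property. -/
def HasZeroOneProperty {V : Type u} [Fintype V] (G : SimpleGraph V) : Prop :=
  ∃ w, IsProper G w

/-- The weighted degrees after the weighted degree of `v` has been increased by 1. -/
noncomputable def increasedDegree {V : Type u} [Fintype V] (G : SimpleGraph V) (v : V)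
    (w : Sym2 V → ℕ) (x : V) : ℕ :=
  open Classical in weightedDegree G w x + if x = v then 1 else 0

/-- `w` is a proper `{0,1}`-weighting of `G` when the weighted degree of `v` is increased by 1. -/
def IsProperIncreased {V : Type u} [Fintype V] (G : SimpleGraph V) (v : V)
    (w : Sym2 V → ℕ) : Prop :=
  IsZeroOneWeighting G w ∧
    ∀ x y, G.Adj x y → increasedDegree G v w x ≠ increasedDegree G v w y

/-- `G` is a bad tree: a tree without the `{0,1}`-property. -/
def IsBadTree {V : Type u} [Fintype V] (G : SimpleGraph V) : Prop :=
  G.IsTree ∧ ¬ HasZeroOneProperty G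

/-- `G` is a `G_v(-)`-tree. -/
def IsMinusTree {V : Type u} [Fintype V] (G : SimpleGraph V) (v : V) : Prop :=
  G.IsTree ∧
    (∃ X : Set V, (∀ x y, G.Adj x y → (x ∈ X ↔ y ∉ X)) ∧ Even X.ncard ∧ Even Xᶜ.ncard) ∧
    ¬ ∃ w, IsProperIncreased G v w

/-- `G` is a `G_v(a,b)`-tree. -/
def IsTwoValueTree {V : Type u} [Fintype V] (a b : ℕ) (G : SimpleGraph V) (v : V) : Prop :=
  G.IsTree ∧ Odd (Fintype.card V) ∧
    (∀ w, IsProper G w → weightedDegree G w v = a) ∧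
    (∀ w, IsProperIncreased G v w → increasedDegree G v w v = b)

/-! ### The recursive constructions -/

/-- The adjacency relation of `join`. -/
inductive JoinAdj {ι : Type u} {W : ι → Type u} (H : ∀ i, SimpleGraph (W i)) (r : ∀ i, W i) :
    Option (Σ i, W i) → Option (Σ i, W i) → Prop
  | inner (i : ι) (x y : W i) (h : (H i).Adj x y) : JoinAdj H r (some ⟨i, x⟩) (some ⟨i, y⟩)
  | down (i : ι) : JoinAdj H r none (some ⟨i, r i⟩)
  | up (i : ι) : JoinAdj H r (some ⟨i, r i⟩) none

/-- The graph obtained from the disjoint union of the graphs `H i` by adding a new vertex `none`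
and an edge from it to the vertex `r i` of each `H i`. -/
def join {ι : Type u} {W : ι → Type u} (H : ∀ i, SimpleGraph (W i)) (r : ∀ i, W i) :
    SimpleGraph (Option (Σ i, W i)) where
  Adj := JoinAdj H r
  symm := ⟨fun x y h => by
    cases h with
    | inner i x y h => exact .inner i y x h.symm
    | down i => exact .up i
    | up i => exact .down i⟩
  loopless := ⟨fun x h => by
    cases h with
    | inner i x y h => exact (H i).loopless.irrefl _ h⟩

/-- The disjoint union of `G` and `K` together with an edge from `v` to `k`. -/
def bridge {V W : Type u} (G : SimpleGraph V) (v : V) (K : SimpleGraph W) (k : W) :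
    SimpleGraph (V ⊕ W) :=
  (G ⊕g K) ⊔ SimpleGraph.edge (Sum.inl v) (Sum.inr k)

/-- `G` is the complete graph on two vertices. -/
def IsK2 {V : Type u} (G : SimpleGraph V) : Prop :=
  Nat.card V = 2 ∧ G = ⊤

/-- `G` is obtained from `G₁` and `G₂` by gluing together the edges `a₁b₁` and `a₂b₂`
(`a₁` with `a₂` and `b₁` with `b₂`): `G` is the union of copies of `G₁` and `G₂` that
have exactly this edge in common. -/
def IsGluing {V₁ V₂ V : Type u} (G₁ : SimpleGraph V₁) (a₁ b₁ : V₁) (G₂ : SimpleGraph V₂)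
    (a₂ b₂ : V₂) (G : SimpleGraph V) : Prop :=
  ∃ (f₁ : G₁ ↪g G) (f₂ : G₂ ↪g G),
    f₁ a₁ = f₂ a₂ ∧ f₁ b₁ = f₂ b₂ ∧
    Set.range f₁ ∪ Set.range f₂ = Set.univ ∧
    Set.range f₁ ∩ Set.range f₂ = {f₁ a₁, f₁ b₁} ∧
    ∀ x y, G.Adj x y →
      (x ∈ Set.range f₁ ∧ y ∈ Set.range f₁) ∨ (x ∈ Set.range f₂ ∧ y ∈ Set.range f₂)

/-- The four classes that are built simultaneously: bad trees, `G_v(-)`-trees,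
`G_v(s,s+1)`-trees and `G_v(s,s+3)`-trees. -/
inductive Kind
  | bad
  | minus
  | plusOne (s : ℕ)
  | plusThree (s : ℕ)

/-- The number of indices of a given kind. -/
noncomputable def count {ι : Type u} (c : ι → Kind) (k : Kind) : ℕ :=
  Nat.card {i // c i = k}

/-- `Built k G v`: the graph `G` with distinguished vertex `v` is generated by the recursion as a
member of the class `k`. For `k = bad` the distinguished vertex is arbitrary. -/
inductive Built : Kind → ∀ {V : Type u}, SimpleGraph V → V → Prop
  /-- All classes are closed under isomorphism. -/
  | iso {k : Kind} {V W : Type u} {G : SimpleGraph V} {H : SimpleGraph W} {v : V}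
      (h : Built k G v) (e : G ≃g H) : Built k H (e v)
  /-- `K_2` is bad. -/
  | K2 {V : Type u} {G : SimpleGraph V} (h : IsK2 G) (v : V) : Built .bad G v
  /-- A new vertex joined to the vertex `v` of a `G_v(s,s+1)`-tree, `s ≥ 1`, and to `s` further
  graphs `K_2`. -/
  | bad_join {s : ℕ} (hs : 1 ≤ s) {ι : Type u} [Finite ι] {W : ι → Type u}
      (H : ∀ i, SimpleGraph (W i)) (r : ∀ i, W i) (i₀ : ι)
      (h₀ : Built (.plusOne s) (H i₀) (r i₀)) (hK : ∀ i, i ≠ i₀ → IsK2 (H i))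
      (hcard : Nat.card {i // i ≠ i₀} = s) (x : Option (Σ i, W i)) :
      Built .bad (join H r) x
  /-- Two bad trees glued along pendant edges whose ends have degrees 1 and 2. -/
  | bad_glue {V₁ V₂ V : Type u} {G₁ : SimpleGraph V₁} {G₂ : SimpleGraph V₂} {G : SimpleGraph V}
      {x₁ a₁ b₁ : V₁} {x₂ a₂ b₂ : V₂}
      (h₁ : Built .bad G₁ x₁) (h₂ : Built .bad G₂ x₂)
      (hab₁ : G₁.Adj a₁ b₁) (hab₂ : G₂.Adj a₂ b₂)
      (ha₁ : (G₁.neighborSet a₁).ncard = 1) (hb₁ : (G₁.neighborSet b₁).ncard = 2)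
      (ha₂ : (G₂.neighborSet a₂).ncard = 1) (hb₂ : (G₂.neighborSet b₂).ncard = 2)
      (hG : IsGluing G₁ a₁ b₁ G₂ a₂ b₂ G) (x : V) : Built .bad G x
  /-- `G` is a `G_v(-)`-tree if adding two vertices `v₁, v₂` and the edges `vv₁, v₁v₂` gives a
  bad tree. -/
  | minus {V W : Type u} {G : SimpleGraph V} {v : V} {K : SimpleGraph W} {k : W}
      {x : V ⊕ W} (hK : IsK2 K) (h : Built .bad (bridge G v K k) x) : Built .minus G v
  /-- A new vertex joined to two `G_{v_i}(s+1,s+2)`-trees, `s` bad trees and any number of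
  `G_{v_i}(-)`-trees. -/
  | plusThree {s : ℕ} {ι : Type u} [Finite ι] {W : ι → Type u}
      (H : ∀ i, SimpleGraph (W i)) (r : ∀ i, W i) (c : ι → Kind)
      (h : ∀ i, Built (c i) (H i) (r i))
      (hc : ∀ i, c i = .plusOne (s + 1) ∨ c i = .bad ∨ c i = .minus)
      (h_one : count c (.plusOne (s + 1)) = 2) (h_bad : count c .bad = s) :
      Built (.plusThree s) (join H r) none
  /-- A new vertex joined to `s` bad trees and any number of `G_{v_i}(-)`-trees. -/
  | plusOne {s : ℕ} {ι : Type u} [Finite ι] {W : ι → Type u}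
      (H : ∀ i, SimpleGraph (W i)) (r : ∀ i, W i) (c : ι → Kind)
      (h : ∀ i, Built (c i) (H i) (r i))
      (hc : ∀ i, c i = .bad ∨ c i = .minus) (h_bad : count c .bad = s) :
      Built (.plusOne s) (join H r) none
  /-- A new vertex joined to a `G_{v_1}(s,s+3)`-tree, a `G_{v_2}(s+1,s+2)`-tree, `s` bad trees and
  any number of `G_{v_i}(-)`-trees. -/
  | plusOne' {s : ℕ} {ι : Type u} [Finite ι] {W : ι → Type u}
      (H : ∀ i, SimpleGraph (W i)) (r : ∀ i, W i) (c : ι → Kind)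
      (h : ∀ i, Built (c i) (H i) (r i))
      (hc : ∀ i, c i = .plusThree s ∨ c i = .plusOne (s + 1) ∨ c i = .bad ∨ c i = .minus)
      (h_three : count c (.plusThree s) = 1) (h_one : count c (.plusOne (s + 1)) = 1)
      (h_bad : count c .bad = s) :
      Built (.plusOne (s + 1)) (join H r) none

/-- Membership in the class `𝓑`. -/
def InB {V : Type u} (G : SimpleGraph V) : Prop :=
  ∃ v, Built .bad G v

/-! ### Polynomial time

A random access machine with unit cost. Its store consists of registers and of tables with two
indices, all holding natural numbers. The only arithmetic is addition and truncated subtraction,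
so that the bit length of a stored number grows by at most one per step. -/

/-- The store of the machine. -/
structure Store where
  /-- the registers -/
  reg : ℕ → ℕ
  /-- `tab t i j` is the entry `(i, j)` of table `t` -/
  tab : ℕ → ℕ → ℕ → ℕ

/-- Write `n` to register `r`. -/
def Store.setReg (σ : Store) (r n : ℕ) : Store :=
  ⟨Function.update σ.reg r n, σ.tab⟩

/-- Write `n` to entry `(i, j)` of table `t`. -/
def Store.setTab (σ : Store) (t i j n : ℕ) : Store :=
  ⟨σ.reg, fun t' i' j' => if t' = t ∧ i' = i ∧ j' = j then n else σ.tab t' i' j'⟩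

/-- Programs. All arguments of type `ℕ` are fixed by the program: names of registers, names of
tables, and the constant of `const`. -/
inductive Program
  | skip
  | const (r n : ℕ)
  | add (r a b : ℕ)
  | sub (r a b : ℕ)
  | load (r t a b : ℕ)
  | store (t a b r : ℕ)
  | seq (P Q : Program)
  | cond (r : ℕ) (P Q : Program)
  | loop (r : ℕ) (P : Program)

/-- `Runs P σ n τ`: started in `σ`, the program `P` halts in `τ` after exactly `n` steps. Each
elementary instruction and each test is one step. -/
inductive Runs : Program → Store → ℕ → Store → Prop
  | skip (σ : Store) : Runs .skip σ 1 σ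
  | const (r n : ℕ) (σ : Store) : Runs (.const r n) σ 1 (σ.setReg r n)
  | add (r a b : ℕ) (σ : Store) : Runs (.add r a b) σ 1 (σ.setReg r (σ.reg a + σ.reg b))
  | sub (r a b : ℕ) (σ : Store) : Runs (.sub r a b) σ 1 (σ.setReg r (σ.reg a - σ.reg b))
  | load (r t a b : ℕ) (σ : Store) :
      Runs (.load r t a b) σ 1 (σ.setReg r (σ.tab t (σ.reg a) (σ.reg b)))
  | store (t a b r : ℕ) (σ : Store) :
      Runs (.store t a b r) σ 1 (σ.setTab t (σ.reg a) (σ.reg b) (σ.reg r))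
  | seq {P Q : Program} {σ τ ρ : Store} {m n : ℕ} (hP : Runs P σ m τ) (hQ : Runs Q τ n ρ) :
      Runs (.seq P Q) σ (m + n) ρ
  | cond_pos {r : ℕ} {P Q : Program} {σ τ : Store} {n : ℕ} (h : σ.reg r ≠ 0)
      (hP : Runs P σ n τ) : Runs (.cond r P Q) σ (n + 1) τ
  | cond_zero {r : ℕ} {P Q : Program} {σ τ : Store} {n : ℕ} (h : σ.reg r = 0)
      (hQ : Runs Q σ n τ) : Runs (.cond r P Q) σ (n + 1) τ
  | loop_stop {r : ℕ} {P : Program} {σ : Store} (h : σ.reg r = 0) :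
      Runs (.loop r P) σ 1 σ
  | loop_step {r : ℕ} {P : Program} {σ τ ρ : Store} {m n : ℕ} (h : σ.reg r ≠ 0)
      (hP : Runs P σ m τ) (hL : Runs (.loop r P) τ n ρ) : Runs (.loop r P) σ (m + n + 1) ρ

/-- The initial store for a graph on `n` vertices: register 0 holds `n`, table 0 holds the
adjacency matrix, and everything else is zero. -/
noncomputable def inputStore {n : ℕ} (G : SimpleGraph (Fin n)) : Store where
  reg r := if r = 0 then n else 0
  tab t i j := open Classical in
    if t = 0 ∧ ∃ (hi : i < n) (hj : j < n), G.Adj ⟨i, hi⟩ ⟨j, hj⟩ then 1 else 0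

/-- A property of finite simple graphs is decidable in polynomial time: a single program halts on
every graph with `n` vertices within a number of steps that is polynomial in `n`, with the answer
(1 for yes, 0 for no) in register 1. -/
def DecidableInPolyTime (Q : ∀ {n : ℕ}, SimpleGraph (Fin n) → Prop) : Prop :=
  ∃ (P : Program) (p : Polynomial ℕ), ∀ (n : ℕ) (G : SimpleGraph (Fin n)),
    ∃ (m : ℕ) (τ : Store), Runs P (inputStore G) m τ ∧ m ≤ p.eval n ∧
      (Q G → τ.reg 1 = 1) ∧ (¬ Q G → τ.reg 1 = 0)

end ZeroOneTrees

/-! A `{0,1}`-weighting is recorded by its subgraph of edges of weight 1. To a rooted tree `(T, v)`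
attach two sets: `A`, the degrees of `v` in proper weightings, and `B`, the increased degrees of `v`
in weightings that are proper once `v` is increased by 1. Bad means `A = ∅`, the class M means `B =
∅`, and the classes P_s and Q_s mean `A = {s}` with `B = {s + 1}` and `B = {s + 3}` respectively.
These sets suffice for the recursion: if a new vertex is joined to branches, a weighting is a set
`S` of new edges of weight 1 together with independent weightings of the branches, and branch `i`
notices only whether `i ∈ S` (`attains_join_iff`).

In a tree, odd degrees on one bipartition class and even degrees on the other can be prescribed
whenever the handshake parity permits (`hasParityValues`). Hence `A` or `B` contains both parities,
or the two contain numbers of opposite parity (`Balanced`). So no branch has both sets inside `{t}`,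
and `t` is attained with increase `c` exactly when the number of `A i ⊆ {t}` is at most `t - c` and
the number of `B i ⊄ {t}` is at least `t - c` (`mem_joinValues_iff`).

Now count. Let `s` branches have empty `A` and let `N` branches have both sets nonempty. Without
increase, the value `s + u` with `u ≤ N` is lost only if at least `u + 1` branches have `A = {s +
u}` or at least `N + 1 - u` have `B = {s + u}`. Different lost values use different branches, so
losing `p` values on one side costs at least `p(p+1)/2 ≤ N`. Losing every value forces `N` to be 1
or 3; keeping a single value forces `N ≤ 6`. A finite check with the parity bound then leaves
precisely the shapes in the joining rules (`classify_empty`, `classify_singles`).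

Conversely, trees are generated by induction on `Kind.measure`. Membership in M becomes badness
after attaching a path with two edges (`isKind_minus_iff_bridge`). In a bad tree with at least four
vertices, take an edge `p r` whose side at `r` is smallest among those with at least three vertices;
the counting shows that the branches at `r` away from `p` are all K_2 and that the branch at `p` is
in P_s with `s ≥ 1` (`exists_bad_join`). Thus K_2 and this join generate all bad trees, and the
gluing rule only has to be sound.

For the algorithm, badness is decided by stripping leaves. For a remaining vertex and a prescribed
degree, the possible total contribution of the stripped branches is an interval or impossible, since
each branch offers 0, 1, both or neither; three tables store this. The graph is a tree exactly when
one vertex remains. -/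

namespace ZeroOneTrees

/-! ### Weightings as subgraphs -/

section Weightings

variable {V : Type u}

/-- The degrees in `K` when the degree of `v` is increased by `c`. -/
noncomputable def shiftedDegree (K : SimpleGraph V) (v : V) (c : ℕ) (x : V) : ℕ :=
  open Classical in (K.neighborSet x).ncard + if x = v then c else 0

/-- Some `{0,1}`-weighting of `G`, given by its subgraph of edges of weight 1, is proper when the
weighted degree of `v` is increased by `c`, and `v` then has weighted degree `t`. -/
def Attains (G : SimpleGraph V) (v : V) (c t : ℕ) : Prop :=
  ∃ K ≤ G, (∀ x y, G.Adj x y → shiftedDegree K v c x ≠ shiftedDegree K v c y) ∧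
    shiftedDegree K v c v = t

/-- The edges of weight 1. -/
def oneGraph (G : SimpleGraph V) (w : Sym2 V → ℕ) : SimpleGraph V where
  Adj x y := G.Adj x y ∧ w s(x, y) = 1
  symm := ⟨fun x y h => ⟨h.1.symm, by rw [Sym2.eq_swap]; exact h.2⟩⟩
  loopless := ⟨fun x h => G.loopless.irrefl _ h.1⟩

open Classical in
/-- The weighting with weight 1 on the edges of `K`. -/
noncomputable def indicatorWeight (K : SimpleGraph V) (e : Sym2 V) : ℕ :=
  if e ∈ K.edgeSet then 1 else 0

lemma oneGraph_le (G : SimpleGraph V) (w : Sym2 V → ℕ) : oneGraph G w ≤ G := fun _ _ h => h.1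

lemma oneGraph_indicatorWeight {G K : SimpleGraph V} (h : K ≤ G) :
    oneGraph G (indicatorWeight K) = K := by
  ext x y
  simp only [oneGraph, indicatorWeight, SimpleGraph.mem_edgeSet]
  constructor
  · rintro ⟨-, h⟩
    by_contra hK
    simp [hK] at h
  · intro hK
    exact ⟨h hK, by simp [hK]⟩

lemma isZeroOneWeighting_indicatorWeight (G K : SimpleGraph V) :
    IsZeroOneWeighting G (indicatorWeight K) := by
  intro e _
  unfold indicatorWeight
  split_ifs <;> simp

lemma weightedDegree_eq_ncard [Fintype V] {G : SimpleGraph V} {w : Sym2 V → ℕ}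
    (hw : IsZeroOneWeighting G w) (x : V) :
    weightedDegree G w x = ((oneGraph G w).neighborSet x).ncard := by
  classical
  unfold weightedDegree
  have h1 : ∀ e ∈ G.incidenceFinset x, w e = if w e = 1 then 1 else 0 := by
    intro e he
    have : e ∈ G.edgeSet := by
      simp only [SimpleGraph.mem_incidenceFinset] at he
      exact he.1
    rcases hw e this with h | h <;> simp [h]
  have h2 : ((oneGraph G w).neighborSet x).ncard =
      ((G.incidenceFinset x).filter fun e => w e = 1).card := by
    rw [← Set.ncard_coe_finset, ← Set.ncard_image_of_injective (f := fun y => s(x, y)) _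
      (fun a b h => Sym2.congr_right.1 h)]
    congr 1
    ext e
    simp only [Set.mem_image, SimpleGraph.mem_neighborSet, Finset.coe_filter,
      SimpleGraph.mem_incidenceFinset, Set.mem_ofPred_eq]
    constructor
    · rintro ⟨y, ⟨h, h'⟩, rfl⟩
      exact ⟨⟨h, Sym2.mem_mk_left _ _⟩, h'⟩
    · rintro ⟨⟨h, hx⟩, h'⟩
      obtain ⟨y, rfl⟩ := hx
      exact ⟨y, ⟨h, h'⟩, rfl⟩
  rw [h2, Finset.card_filter]
  convert Finset.sum_congr rfl h1

lemma shiftedDegree_zero (K : SimpleGraph V) (v x : V) :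
    shiftedDegree K v 0 x = (K.neighborSet x).ncard := by
  simp [shiftedDegree]

lemma shiftedDegree_self (K : SimpleGraph V) (v : V) (c : ℕ) :
    shiftedDegree K v c v = (K.neighborSet v).ncard + c := by
  simp [shiftedDegree]

lemma shiftedDegree_ne (K : SimpleGraph V) {v x : V} (c : ℕ) (h : x ≠ v) :
    shiftedDegree K v c x = (K.neighborSet x).ncard := by
  simp [shiftedDegree, h]

lemma weightedDegree_eq_shiftedDegree [Fintype V] {G : SimpleGraph V} {w : Sym2 V → ℕ}
    (hw : IsZeroOneWeighting G w) (v x : V) :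
    weightedDegree G w x = shiftedDegree (oneGraph G w) v 0 x := by
  rw [weightedDegree_eq_ncard hw, shiftedDegree_zero]

lemma increasedDegree_eq_shiftedDegree [Fintype V] {G : SimpleGraph V} {w : Sym2 V → ℕ}
    (hw : IsZeroOneWeighting G w) (v x : V) :
    increasedDegree G v w x = shiftedDegree (oneGraph G w) v 1 x := by
  unfold increasedDegree shiftedDegree
  rw [weightedDegree_eq_ncard hw]

/-- Values off the edge set influence no weighted degree, so passing to the graph of weight-1 edges
loses nothing; from here on only subgraphs are used. -/
lemma attains_zero_iff [Fintype V] {G : SimpleGraph V} {v : V} {t : ℕ} :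
    Attains G v 0 t ↔ ∃ w, IsProper G w ∧ weightedDegree G w v = t := by
  constructor
  · rintro ⟨K, hK, h, ht⟩
    have hw := isZeroOneWeighting_indicatorWeight G K
    refine ⟨indicatorWeight K, ⟨hw, fun x y hxy => ?_⟩, ?_⟩
    · simp only [weightedDegree_eq_shiftedDegree hw v, oneGraph_indicatorWeight hK]
      exact h x y hxy
    · simp only [weightedDegree_eq_shiftedDegree hw v, oneGraph_indicatorWeight hK, ht]
  · rintro ⟨w, ⟨hw, h⟩, ht⟩
    simp only [weightedDegree_eq_shiftedDegree hw v] at h ht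
    exact ⟨_, oneGraph_le G w, h, ht⟩

lemma attains_one_iff [Fintype V] {G : SimpleGraph V} {v : V} {t : ℕ} :
    Attains G v 1 t ↔ ∃ w, IsProperIncreased G v w ∧ increasedDegree G v w v = t := by
  constructor
  · rintro ⟨K, hK, h, ht⟩
    have hw := isZeroOneWeighting_indicatorWeight G K
    refine ⟨indicatorWeight K, ⟨hw, fun x y hxy => ?_⟩, ?_⟩
    · simp only [increasedDegree_eq_shiftedDegree hw v, oneGraph_indicatorWeight hK]
      exact h x y hxy
    · simp only [increasedDegree_eq_shiftedDegree hw v, oneGraph_indicatorWeight hK, ht]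
  · rintro ⟨w, ⟨hw, h⟩, ht⟩
    simp only [increasedDegree_eq_shiftedDegree hw v] at h ht
    exact ⟨_, oneGraph_le G w, h, ht⟩

lemma hasZeroOneProperty_iff [Fintype V] {G : SimpleGraph V} (v : V) :
    HasZeroOneProperty G ↔ ∃ t, Attains G v 0 t := by
  simp only [attains_zero_iff, HasZeroOneProperty]
  constructor
  · rintro ⟨w, hw⟩
    exact ⟨_, w, hw, rfl⟩
  · rintro ⟨_, w, hw, _⟩
    exact ⟨w, hw⟩

lemma exists_isProperIncreased_iff [Fintype V] {G : SimpleGraph V} (v : V) :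
    (∃ w, IsProperIncreased G v w) ↔ ∃ t, Attains G v 1 t := by
  simp only [attains_one_iff]
  constructor
  · rintro ⟨w, hw⟩
    exact ⟨_, w, hw, rfl⟩
  · rintro ⟨_, w, hw, _⟩
    exact ⟨w, hw⟩

/-- Whether a proper weighting exists does not depend on the vertex that is observed. -/
lemma exists_attains_zero_iff {G : SimpleGraph V} (v v' : V) :
    (∃ t, Attains G v 0 t) ↔ ∃ t, Attains G v' 0 t := by
  have : ∀ v v' : V, (∃ t, Attains G v 0 t) → ∃ t, Attains G v' 0 t := by
    rintro v v' ⟨_, K, hK, h, -⟩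
    simp only [shiftedDegree_zero] at h
    exact ⟨_, K, hK, by simpa only [shiftedDegree_zero] using h, rfl⟩
  exact ⟨this v v', this v' v⟩

variable {W : Type u}

lemma Attains.map_iso {G : SimpleGraph V} {H : SimpleGraph W} (e : G ≃g H) {v : V} {c t : ℕ}
    (h : Attains G v c t) : Attains H (e v) c t := by
  obtain ⟨K, hK, h, ht⟩ := h
  have key : ∀ x, shiftedDegree (K.comap e.symm) (e v) c (e x) = shiftedDegree K v c x := by
    intro x
    unfold shiftedDegree
    congr 1
    · rw [← Set.ncard_image_of_injective (K.neighborSet x) e.injective]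
      congr 1
      ext y
      simp only [SimpleGraph.mem_neighborSet, SimpleGraph.comap_adj, Set.mem_image]
      constructor
      · intro hy
        exact ⟨e.symm y, by simpa using hy, by simp⟩
      · rintro ⟨b, hb, rfl⟩
        simpa using hb
    · congr 1
      exact propext e.injective.eq_iff
  refine ⟨K.comap e.symm, ?_, ?_, ?_⟩
  · intro x y hxy
    exact e.symm.map_adj_iff.1 (hK hxy)
  · intro x y hxy
    obtain ⟨x, rfl⟩ := e.surjective x
    obtain ⟨y, rfl⟩ := e.surjective y
    rw [key, key]
    exact h x y (e.map_adj_iff.1 hxy)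
  · rw [key, ht]

lemma attains_iso_iff {G : SimpleGraph V} {H : SimpleGraph W} (e : G ≃g H) {v : V} {c t : ℕ} :
    Attains H (e v) c t ↔ Attains G v c t :=
  ⟨fun h => by simpa using h.map_iso e.symm, fun h => h.map_iso e⟩

end Weightings

/-! ### Acyclicity and connectedness -/

section Trees

/-- Asking only for reachable images lets `f` contract edges, as the retractions used for acyclicity
do. -/
lemma reachable_map_of_adj {V W : Type*} {G : SimpleGraph V} {H : SimpleGraph W} (f : V → W)
    (hf : ∀ x y, G.Adj x y → H.Reachable (f x) (f y)) {x y : V} (h : G.Reachable x y) :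
    H.Reachable (f x) (f y) := by
  obtain ⟨p⟩ := h
  induction p with
  | nil => exact .rfl
  | cons hxy _ ih => exact (hf _ _ hxy).trans ih

/-- If every edge of `G` survives in some acyclic quotient in which no other edge is mapped to it,
then `G` is acyclic. -/
lemma isAcyclic_of_retractions {V : Type*} {G : SimpleGraph V}
    (h : ∀ x y, G.Adj x y → ∃ (W : Type u) (H : SimpleGraph W) (f : V → W), H.IsAcyclic ∧
      H.Adj (f x) (f y) ∧ ∀ a b, G.Adj a b → f a = f b ∨
        (H.Adj (f a) (f b) ∧ (s(f a, f b) = s(f x, f y) → s(a, b) = s(x, y)))) :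
    G.IsAcyclic := by
  rw [SimpleGraph.isAcyclic_iff_forall_adj_isBridge]
  intro x y hxy
  obtain ⟨W, H, f, hH, hfxy, hf⟩ := h x y hxy
  have hb := SimpleGraph.isAcyclic_iff_forall_adj_isBridge.1 hH hfxy
  rw [SimpleGraph.isBridge_iff] at hb ⊢
  intro hr
  -- A walk from `x` to `y` that avoids the edge `xy` would project to one in `H` that avoids its
  -- image, but that image is a bridge.
  refine hb (reachable_map_of_adj f ?_ hr)
  intro a b hab
  simp only [SimpleGraph.deleteEdges_adj, Set.mem_singleton_iff] at hab
  rcases hf a b hab.1 with h | ⟨h, h'⟩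
  · rw [h]
  · apply SimpleGraph.Adj.reachable
    simp only [SimpleGraph.deleteEdges_adj, Set.mem_singleton_iff]
    exact ⟨h, fun h2 => hab.2 (h' h2)⟩

end Trees

/-! ### Joins -/

section Join

variable {ι : Type u} {W : ι → Type u} {H : ∀ i, SimpleGraph (W i)} {r : ∀ i, W i}

@[simp] lemma join_adj_none_some {i : ι} {x : W i} :
    (join H r).Adj none (some ⟨i, x⟩) ↔ x = r i := by
  constructor
  · intro h
    cases h
    rfl
  · rintro rfl
    exact .down i

@[simp] lemma join_adj_some_none {i : ι} {x : W i} :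
    (join H r).Adj (some ⟨i, x⟩) none ↔ x = r i := by
  rw [SimpleGraph.adj_comm, join_adj_none_some]

@[simp] lemma join_adj_some_some {i : ι} {x y : W i} :
    (join H r).Adj (some ⟨i, x⟩) (some ⟨i, y⟩) ↔ (H i).Adj x y := by
  constructor
  · intro h
    cases h
    assumption
  · exact .inner i x y

lemma eq_of_join_adj {i j : ι} {x : W i} {y : W j}
    (h : (join H r).Adj (some ⟨i, x⟩) (some ⟨j, y⟩)) : i = j := by
  cases h
  rfl

lemma some_mk_injective (i : ι) : Function.Injective fun x : W i => some (Sigma.mk i x) :=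
  (Option.some_injective _).comp sigma_mk_injective

/-- The indices of the new edges of a join that belong to `K`. -/
def rootIndices (r : ∀ i, W i) (K : SimpleGraph (Option (Σ i, W i))) : Set ι :=
  {i | K.Adj none (some ⟨i, r i⟩)}

/-- The restriction of `K` to a summand of the join. -/
def summand (K : SimpleGraph (Option (Σ i, W i))) (i : ι) : SimpleGraph (W i) :=
  K.comap fun x => some ⟨i, x⟩

lemma shiftedDegree_join_none {K : SimpleGraph (Option (Σ i, W i))} (hK : K ≤ join H r) (c : ℕ) :
    shiftedDegree K none c none = (rootIndices r K).ncard + c := by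
  rw [shiftedDegree_self]
  congr 1
  have hinj : Function.Injective fun i => some (Sigma.mk i (r i)) := fun i j h => by
    simp only [Option.some.injEq, Sigma.mk.injEq] at h
    exact h.1
  rw [← Set.ncard_image_of_injective (rootIndices r K) hinj]
  congr 1
  ext y
  simp only [SimpleGraph.mem_neighborSet, Set.mem_image, rootIndices, Set.mem_ofPred_eq]
  constructor
  · intro h
    match y, h with
    | none, h => exact absurd h (K.loopless.irrefl _)
    | some ⟨i, y⟩, h =>
      obtain rfl := join_adj_none_some.1 (hK h)
      exact ⟨i, h, rfl⟩
  · rintro ⟨i, hi, rfl⟩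
    exact hi

open Classical in
-- A new edge of weight 1 acts on its branch as an increase of the root by 1. This is why increases
-- by 0 and 1 suffice throughout.
lemma shiftedDegree_join_some [∀ i, Finite (W i)] {K : SimpleGraph (Option (Σ i, W i))}
    (hK : K ≤ join H r) (c : ℕ) (i : ι) (x : W i) :
    shiftedDegree K none c (some ⟨i, x⟩) =
      shiftedDegree (summand K i) (r i) (if i ∈ rootIndices r K then 1 else 0) x := by
  rw [shiftedDegree_ne _ _ (by simp)]
  unfold shiftedDegree
  have h1 : (K.neighborSet (some ⟨i, x⟩)) \ {none} =
      (fun y : W i => some (Sigma.mk i y)) '' (summand K i).neighborSet x := by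
    ext y
    simp only [Set.mem_sdiff, SimpleGraph.mem_neighborSet, Set.mem_singleton_iff, Set.mem_image,
      summand, SimpleGraph.comap_adj]
    constructor
    · rintro ⟨h, hy⟩
      match y, hy, h with
      | some ⟨j, y⟩, _, h =>
        obtain rfl := eq_of_join_adj (hK h)
        exact ⟨y, h, rfl⟩
    · rintro ⟨y, h, rfl⟩
      exact ⟨h, by simp⟩
  have h2 : (if x = r i then (if i ∈ rootIndices r K then 1 else 0) else 0) =
      if none ∈ K.neighborSet (some ⟨i, x⟩) then 1 else 0 := by
    by_cases hx : x = r i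
    · subst hx
      simp only [rootIndices, Set.mem_ofPred_eq, SimpleGraph.mem_neighborSet, if_true,
        SimpleGraph.adj_comm K none]
    · have : none ∉ K.neighborSet (some ⟨i, x⟩) := fun h => hx (join_adj_some_none.1 (hK h))
      simp [hx, this]
  rw [h2, ← Set.ncard_image_of_injective _ (some_mk_injective i), ← h1]
  split_ifs with h
  · have hfin : (K.neighborSet (some ⟨i, x⟩)).Finite := by
      refine Set.Finite.subset (s := insert none ((fun y : W i => some (Sigma.mk i y)) ''
        (summand K i).neighborSet x)) (Set.Finite.insert _ (Set.toFinite _)) ?_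
      rw [← h1]
      intro y hy
      by_cases hy' : y = none
      · exact Or.inl hy'
      · exact Or.inr ⟨hy, hy'⟩
    rw [Set.ncard_sdiff_singleton_add_one h hfin]
  · rw [Set.sdiff_singleton_eq_self h, add_zero]

/-- The subgraph of a join given by subgraphs of the summands and a set of new edges. -/
def partialJoin (K : ∀ i, SimpleGraph (W i)) (r : ∀ i, W i) (S : Set ι) :
    SimpleGraph (Option (Σ i, W i)) where
  Adj a b := (join K r).Adj a b ∧
    ∀ i x, a = none ∧ b = some ⟨i, x⟩ ∨ b = none ∧ a = some ⟨i, x⟩ → i ∈ S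
  symm := ⟨fun _ _ h => ⟨h.1.symm, fun i x h' => h.2 i x h'.symm⟩⟩
  loopless := ⟨fun a h => (join K r).loopless.irrefl a h.1⟩

lemma join_mono {K : ∀ i, SimpleGraph (W i)} (h : ∀ i, K i ≤ H i) : join K r ≤ join H r := by
  intro a b hab
  cases hab with
  | inner i x y h' => exact .inner i x y (h i h')
  | down i => exact .down i
  | up i => exact .up i

open Classical in
-- Once the set `S` of new edges of weight 1 is fixed, the branches can be weighted independently;
-- the only constraint across a new edge is that the root of the branch avoids `t`.
theorem attains_join_iff [∀ i, Finite (W i)] {c t : ℕ} :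
    Attains (join H r) none c t ↔ ∃ S : Set ι, S.ncard + c = t ∧
      ∀ i, ∃ x, x ≠ t ∧ Attains (H i) (r i) (if i ∈ S then 1 else 0) x := by
  constructor
  · rintro ⟨K, hK, h, ht⟩
    refine ⟨rootIndices r K, by rw [← ht, shiftedDegree_join_none hK], fun i => ?_⟩
    refine ⟨_, ?_, summand K i, ?_, ?_, rfl⟩
    · rw [← ht, ← shiftedDegree_join_some hK c]
      exact h _ _ (.up i)
    · intro x y hxy
      exact join_adj_some_some.1 (hK hxy)
    · intro x y hxy
      rw [← shiftedDegree_join_some hK c, ← shiftedDegree_join_some hK c]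
      exact h _ _ (.inner i x y hxy)
  · rintro ⟨S, hS, h⟩
    choose x hxt K hK h hx using h
    have hle : partialJoin K r S ≤ join H r := fun a b hab => join_mono hK hab.1
    have hroot : rootIndices r (partialJoin K r S) = S := by
      ext i
      simp only [rootIndices, partialJoin, Set.mem_ofPred_eq, join_adj_none_some, true_and]
      constructor
      · intro h
        exact h i (r i) (by simp)
      · intro hi j x hj
        simp only [Option.some.injEq, Sigma.mk.injEq, reduceCtorEq, false_and, or_false] at hj
        exact hj.1 ▸ hi
    have hsum : ∀ i, summand (partialJoin K r S) i = K i := by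
      intro i
      ext x y
      simp [summand, partialJoin]
    have hnone : shiftedDegree (partialJoin K r S) none c none = t := by
      rw [shiftedDegree_join_none hle, hroot, hS]
    have hsome : ∀ i x, shiftedDegree (partialJoin K r S) none c (some ⟨i, x⟩) =
        shiftedDegree (K i) (r i) (if i ∈ S then 1 else 0) x := by
      intro i x
      rw [shiftedDegree_join_some hle, hroot, hsum]
    refine ⟨partialJoin K r S, hle, ?_, hnone⟩
    intro a b hab
    cases hab with
    | inner i x y h' =>
      rw [hsome, hsome]
      exact h i x y h'
    | down i =>
      rw [hsome, hnone, hx]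
      exact (hxt i).symm
    | up i =>
      rw [hsome, hnone, hx]
      exact hxt i

lemma join_connected (h : ∀ i, (H i).Connected) : (join H r).Connected := by
  have key : ∀ a, (join H r).Reachable none a := by
    rintro (_ | ⟨i, x⟩)
    · exact .rfl
    · have h1 : (join H r).Adj none (some ⟨i, r i⟩) := .down i
      refine h1.reachable.trans ?_
      exact reachable_map_of_adj (H := join H r) (fun x => some (Sigma.mk i x))
        (fun x y hxy => SimpleGraph.Adj.reachable (join_adj_some_some.2 hxy))
        ((h i).preconnected (r i) x)
  exact ⟨fun a b => (key a).symm.trans (key b)⟩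

lemma isAcyclic_top_bool : (⊤ : SimpleGraph (ULift.{u} Bool)).IsAcyclic :=
  SimpleGraph.IsAcyclic.of_card_le_two (by simp)

open Classical in
-- An edge inside branch `i` survives when everything outside the branch collapses to `r i`; the new
-- edge to branch `i` survives when that branch becomes one point and the rest another.
lemma join_isAcyclic (h : ∀ i, (H i).IsAcyclic) : (join H r).IsAcyclic := by
  apply isAcyclic_of_retractions
  have hnew : ∀ i, ∃ f : Option (Σ i, W i) → ULift.{u} Bool,
      f none ≠ f (some ⟨i, r i⟩) ∧ ∀ a b, (join H r).Adj a b → f a = f b ∨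
        s(a, b) = s(none, some ⟨i, r i⟩) := by
    intro i
    refine ⟨fun a => match a with
      | none => ⟨false⟩
      | some ⟨j, _⟩ => ⟨decide (j = i)⟩, by simp, ?_⟩
    intro a b hab
    cases hab with
    | inner j x y h' => left; rfl
    | down j =>
      by_cases hj : j = i
      · subst hj; right; rfl
      · left; simp [hj]
    | up j =>
      by_cases hj : j = i
      · subst hj; right; exact Sym2.eq_swap
      · left; simp [hj]
  intro a b hab
  cases hab with
  | inner i x y h' =>
    let f : Option (Σ i, W i) → W i := fun a => match a with
      | none => r i
      | some ⟨j, x⟩ => if hj : j = i then hj ▸ x else r i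
    have hf : ∀ x, f (some ⟨i, x⟩) = x := fun x => by simp [f]
    have hf' : ∀ j x, j ≠ i → f (some ⟨j, x⟩) = r i := fun j x hj => by simp [f, hj]
    have hf0 : f none = r i := rfl
    refine ⟨W i, H i, f, h i, by rw [hf, hf]; exact h', ?_⟩
    clear h'
    intro a b hab
    cases hab with
    | inner j x' y' h' =>
      by_cases hj : j = i
      · subst hj
        right
        simp only [hf]
        refine ⟨h', fun h2 => ?_⟩
        have := congrArg (Sym2.map fun x => some (Sigma.mk j x)) h2
        simpa using this
      · left
        rw [hf' _ _ hj, hf' _ _ hj]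
    | down j =>
      left
      by_cases hj : j = i
      · subst hj; rw [hf, hf0]
      · rw [hf' _ _ hj, hf0]
    | up j =>
      left
      by_cases hj : j = i
      · subst hj; rw [hf, hf0]
      · rw [hf' _ _ hj, hf0]
  | down i =>
    obtain ⟨f, hf, hf'⟩ := hnew i
    refine ⟨_, ⊤, f, isAcyclic_top_bool, hf, fun a b hab => ?_⟩
    by_cases he : f a = f b
    · exact Or.inl he
    · exact Or.inr ⟨he, fun _ => (hf' a b hab).resolve_left he⟩
  | up i =>
    obtain ⟨f, hf, hf'⟩ := hnew i
    refine ⟨_, ⊤, f, isAcyclic_top_bool, hf.symm, fun a b hab => ?_⟩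
    by_cases he : f a = f b
    · exact Or.inl he
    · refine Or.inr ⟨he, fun _ => ?_⟩
      rw [(hf' a b hab).resolve_left he, Sym2.eq_swap]

lemma join_isTree (h : ∀ i, (H i).IsTree) : (join H r).IsTree :=
  ⟨join_connected fun i => (h i).connected, join_isAcyclic fun i => (h i).isAcyclic⟩

end Join

/-! ### Decomposition of a tree at a vertex -/

section Decomposition

variable {V : Type u}

/-- `G` with all edges at `p` removed. -/
def avoid (G : SimpleGraph V) (p : V) : SimpleGraph V where
  Adj x y := G.Adj x y ∧ x ≠ p ∧ y ≠ p
  symm := ⟨fun _ _ h => ⟨h.1.symm, h.2.2, h.2.1⟩⟩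
  loopless := ⟨fun x h => G.loopless.irrefl x h.1⟩

/-- The vertices that can be reached from `c` without passing through `p`. -/
def side (G : SimpleGraph V) (p c : V) : Set V := {x | (avoid G p).Reachable c x}

variable {G : SimpleGraph V}

lemma mem_side_self (p c : V) : c ∈ side G p c := SimpleGraph.Reachable.rfl

lemma side_step {p c x y : V} (hx : x ∈ side G p c) (hxp : x ≠ p) (hyp : y ≠ p)
    (hxy : G.Adj x y) : y ∈ side G p c :=
  SimpleGraph.Reachable.trans hx (SimpleGraph.Adj.reachable ⟨hxy, hxp, hyp⟩)

lemma not_mem_side {p c : V} (hc : c ≠ p) : p ∉ side G p c := by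
  rintro ⟨w⟩
  cases w.reverse with
  | nil => exact hc rfl
  | cons h _ => exact h.2.1 rfl

/-- Two branches with a common vertex would connect `c'` to `c` away from `p`; preceded by the edge
`pc'`, this bypasses the bridge `pc`. -/
lemma side_unique (hG : G.IsAcyclic) {p c c' x : V} (hc : G.Adj p c) (hc' : G.Adj p c')
    (hx : x ∈ side G p c) (hx' : x ∈ side G p c') : c = c' := by
  by_contra hne
  have hb := SimpleGraph.isAcyclic_iff_forall_adj_isBridge.1 hG hc
  rw [SimpleGraph.isBridge_iff] at hb
  apply hb
  have h1 : (avoid G p).Reachable c' c := SimpleGraph.Reachable.trans hx' hx.symm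
  have hle : avoid G p ≤ G.deleteEdges {s(p, c)} := by
    intro x y hxy
    simp only [SimpleGraph.deleteEdges_adj, Set.mem_singleton_iff]
    refine ⟨hxy.1, fun h => ?_⟩
    rcases Sym2.eq_iff.1 h with h | h
    · exact hxy.2.1 h.1
    · exact hxy.2.2 h.2
  refine SimpleGraph.Reachable.trans (SimpleGraph.Adj.reachable ?_) (h1.mono hle)
  simp only [SimpleGraph.deleteEdges_adj, Set.mem_singleton_iff]
  refine ⟨hc', fun h => ?_⟩
  rcases Sym2.eq_iff.1 h with h | h
  · exact hne h.2.symm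
  · exact hc.ne h.1

lemma exists_side (hG : G.Connected) (p x : V) (hx : x ≠ p) :
    ∃ c, G.Adj p c ∧ x ∈ side G p c := by
  obtain ⟨w⟩ := hG.preconnected x p
  induction w with
  | nil => exact absurd rfl hx
  | @cons x y p hxy w ih =>
    by_cases hy : y = p
    · subst hy
      exact ⟨x, hxy.symm, mem_side_self _ _⟩
    · obtain ⟨c, hc, hyc⟩ := ih hy
      exact ⟨c, hc, side_step hyc hy hx hxy.symm⟩

lemma side_induce_connected {p c : V} : (G.induce (side G p c)).Connected := by
  have key : ∀ x (hx : x ∈ side G p c),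
      (G.induce (side G p c)).Reachable ⟨c, mem_side_self _ _⟩ ⟨x, hx⟩ := by
    intro x hx
    obtain ⟨w⟩ := SimpleGraph.Reachable.symm hx
    induction w with
    | nil => exact .rfl
    | cons hxy w ih =>
      refine (ih w.reverse.reachable).trans (SimpleGraph.Adj.reachable ?_)
      exact hxy.1.symm
  have : Nonempty (side G p c) := ⟨⟨c, mem_side_self _ _⟩⟩
  exact ⟨fun a b => (key a.1 a.2).symm.trans (key b.1 b.2)⟩

lemma side_induce_isTree (hG : G.IsAcyclic) {p c : V} : (G.induce (side G p c)).IsTree :=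
  ⟨side_induce_connected, hG.induce _⟩

/-- The summand of the decomposition of `G` at `p` that contains the neighbour `c`. -/
abbrev sideGraph (G : SimpleGraph V) (p : V) (c : G.neighborSet p) :
    SimpleGraph (side G p c.1) := G.induce (side G p c.1)

/-- The vertex of the summand that is adjacent to `p`. -/
abbrev sideRoot (G : SimpleGraph V) (p : V) (c : G.neighborSet p) : side G p c.1 :=
  ⟨c.1, mem_side_self _ _⟩

/-- A tree is the join of its branches at a vertex. -/
noncomputable def sideIso (hG : G.IsTree) (p : V) :
    join (sideGraph G p) (sideRoot G p) ≃g G where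
  toEquiv := Equiv.ofBijective
    (fun a => match a with
      | none => p
      | some ⟨_, x⟩ => x.1)
    (by
      constructor
      · rintro (_ | ⟨⟨c, hc⟩, x⟩) (_ | ⟨⟨c', hc'⟩, x'⟩) h
        · rfl
        · have h : p = x'.1 := h
          exact absurd x'.2 (by rw [← h]; exact not_mem_side hc'.ne')
        · have h : x.1 = p := h
          exact absurd x.2 (by rw [h]; exact not_mem_side hc.ne')
        · obtain ⟨x, hx⟩ := x
          obtain ⟨x', hx'⟩ := x'
          simp only at h
          subst h
          obtain rfl := side_unique hG.isAcyclic hc hc' hx hx'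
          rfl
      · intro x
        by_cases hx : x = p
        · exact ⟨none, hx.symm⟩
        · obtain ⟨c, hc, hxc⟩ := exists_side hG.connected p x hx
          exact ⟨some ⟨⟨c, hc⟩, ⟨x, hxc⟩⟩, rfl⟩)
  map_rel_iff' := by
    rintro (_ | ⟨⟨c, hc⟩, ⟨x, hx⟩⟩) (_ | ⟨⟨c', hc'⟩, ⟨x', hx'⟩⟩)
    · simp
    · simp only [join_adj_none_some, Subtype.mk.injEq]
      constructor
      · intro h
        exact (side_unique hG.isAcyclic h hc' (mem_side_self _ _) hx').symm ▸ rfl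
      · rintro rfl
        exact hc'
    · simp only [join_adj_some_none, Subtype.mk.injEq]
      constructor
      · intro h
        exact (side_unique hG.isAcyclic h.symm hc (mem_side_self _ _) hx).symm ▸ rfl
      · rintro rfl
        exact SimpleGraph.Adj.symm hc
    · constructor
      · intro h
        have h1 : x ≠ p := fun h => not_mem_side hc.ne' (h ▸ hx)
        have h2 : x' ≠ p := fun h => not_mem_side hc'.ne' (h ▸ hx')
        obtain rfl := side_unique hG.isAcyclic hc hc' (side_step hx h1 h2 h) hx'
        exact join_adj_some_some.2 h
      · intro h
        obtain h' := eq_of_join_adj h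
        simp only [Subtype.mk.injEq] at h'
        subst h'
        exact join_adj_some_some.1 h

@[simp] lemma sideIso_none (hG : G.IsTree) (p : V) : sideIso hG p none = p := rfl

end Decomposition

/-! ### The combinatorics of the values of a join -/

section Values

/-- `A` contains an even and an odd number. -/
def Spread (A : Set ℕ) : Prop := (∃ a ∈ A, Even a) ∧ ∃ a ∈ A, Odd a

/-- What parity arguments give for the sets of values of a rooted tree. -/
def Balanced (A B : Set ℕ) : Prop :=
  Spread A ∨ Spread B ∨ ∃ a ∈ A, ∃ b ∈ B, Odd (a + b)

lemma Spread.not_subset_singleton {A : Set ℕ} (h : Spread A) (t : ℕ) : ¬ A ⊆ {t} := by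
  obtain ⟨⟨a, ha, hae⟩, b, hb, hbo⟩ := h
  intro hs
  rw [hs ha] at hae
  rw [hs hb] at hbo
  exact (Nat.not_even_iff_odd.2 hbo) hae

lemma Spread.ne_empty {A : Set ℕ} (h : Spread A) : A ≠ ∅ := by
  rintro rfl
  exact h.not_subset_singleton 0 (Set.empty_subset _)

lemma Spread.ne_singleton {A : Set ℕ} (h : Spread A) (t : ℕ) : A ≠ {t} := by
  rintro rfl
  exact h.not_subset_singleton t subset_rfl

/-- `A ⊆ {t}` forces weight 1 on the new edge and `B ⊆ {t}` forces weight 0. Parity guarantees that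
a branch never makes both demands. -/
lemma Balanced.not_subset {A B : Set ℕ} (h : Balanced A B) {t : ℕ} (hA : A ⊆ {t})
    (hB : B ⊆ {t}) : False := by
  rcases h with h | h | ⟨a, ha, b, hb, hab⟩
  · exact h.not_subset_singleton t hA
  · exact h.not_subset_singleton t hB
  · rw [hA ha, hB hb] at hab
    exact (Nat.not_even_iff_odd.2 hab) ⟨t, rfl⟩

lemma Balanced.left_spread {A B : Set ℕ} (h : Balanced A B) (hB : B = ∅) : Spread A := by
  rcases h with h | h | ⟨a, ha, b, hb, hab⟩
  · exact h
  · exact absurd hB h.ne_empty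
  · simp [hB] at hb

lemma Balanced.right_spread {A B : Set ℕ} (h : Balanced A B) (hA : A = ∅) : Spread B := by
  rcases h with h | h | ⟨a, ha, b, hb, hab⟩
  · exact absurd hA h.ne_empty
  · exact h
  · simp [hA] at ha

lemma Balanced.odd_add {A B : Set ℕ} (h : Balanced A B) {a b : ℕ} (hA : A = {a})
    (hB : B = {b}) : Odd (a + b) := by
  rcases h with h | h | ⟨a', ha, b', hb, hab⟩
  · exact absurd hA (h.ne_singleton _)
  · exact absurd hB (h.ne_singleton _)
  · rw [hA] at ha
    rw [hB] at hb
    rwa [ha, hb] at hab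

variable {ι : Type u} [Fintype ι]

open Classical in
/-- The number of empty members of a family of sets. -/
noncomputable def numEmpty (A : ι → Set ℕ) : ℕ := (Finset.univ.filter fun i => A i = ∅).card

open Classical in
/-- The number of members of a family of sets that are equal to `{t}`. -/
noncomputable def numSingle (A : ι → Set ℕ) (t : ℕ) : ℕ :=
  (Finset.univ.filter fun i => A i = {t}).card

open Classical in
/-- The values at the root of a join, in terms of the values of the branches. -/
def joinValues (A B : ι → Set ℕ) (c : ℕ) : Set ℕ :=
  {t | ∃ S : Set ι, S.ncard + c = t ∧ ∀ i, ∃ x, x ≠ t ∧ x ∈ if i ∈ S then B i else A i}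

variable {A B : ι → Set ℕ}

lemma exists_ne_mem_iff {A : Set ℕ} {t : ℕ} : (∃ x, x ≠ t ∧ x ∈ A) ↔ ¬ A ⊆ {t} := by
  rw [Set.not_subset]
  constructor
  · rintro ⟨x, h, h'⟩; exact ⟨x, h', h⟩
  · rintro ⟨x, h, h'⟩; exact ⟨x, h', h⟩

open Classical in
lemma card_subset_singleton (A : ι → Set ℕ) (t : ℕ) :
    (Finset.univ.filter fun i => A i ⊆ {t}).card = numEmpty A + numSingle A t := by
  unfold numEmpty numSingle
  rw [← Finset.card_union_of_disjoint, ← Finset.filter_or]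
  · simp only [Set.subset_singleton_iff_eq]
  · rw [Finset.disjoint_filter]
    intro i _ h h'
    rw [h] at h'
    exact (Set.singleton_ne_empty t) h'.symm

open Classical in
-- The set `S` must contain all branches with `A i ⊆ {t}` and no branch with `B i ⊆ {t}`. Balance
-- makes these demands compatible, so every cardinality between the two extremes is available.
lemma mem_joinValues_iff (h : ∀ i, Balanced (A i) (B i)) {c t : ℕ} :
    t ∈ joinValues A B c ↔ numEmpty A + numSingle A t + c ≤ t ∧
      t + numEmpty B + numSingle B t ≤ Fintype.card ι + c := by
  have hcompl : (Finset.univ.filter fun i => ¬ B i ⊆ {t}).card + numEmpty B + numSingle B t =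
      Fintype.card ι := by
    rw [add_assoc, ← card_subset_singleton, add_comm, Finset.card_filter_add_card_filter_not,
      Finset.card_univ]
  rw [← card_subset_singleton]
  unfold joinValues
  simp only [Set.mem_ofPred_eq, exists_ne_mem_iff]
  constructor
  · rintro ⟨S, hS, hi⟩
    rw [Set.ncard_eq_toFinset_card'] at hS
    have h1 : (Finset.univ.filter fun i => A i ⊆ {t}) ⊆ S.toFinset := by
      intro i hiA
      simp only [Finset.mem_filter, Finset.mem_univ, true_and] at hiA
      by_contra hiS
      rw [Set.mem_toFinset] at hiS
      have := hi i
      rw [if_neg hiS] at this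
      exact this hiA
    have h2 : S.toFinset ⊆ Finset.univ.filter fun i => ¬ B i ⊆ {t} := by
      intro i hiS
      rw [Set.mem_toFinset] at hiS
      have := hi i
      rw [if_pos hiS] at this
      simpa using this
    have := Finset.card_le_card h1
    have := Finset.card_le_card h2
    omega
  · rintro ⟨h1, h2⟩
    have hsub : (Finset.univ.filter fun i => A i ⊆ {t}) ⊆
        Finset.univ.filter fun i => ¬ B i ⊆ {t} := by
      intro i
      simp only [Finset.mem_filter, Finset.mem_univ, true_and]
      exact fun hA hB => (h i).not_subset hA hB
    obtain ⟨S, hS1, hS2, hS⟩ := Finset.exists_subsuperset_card_eq (n := t - c) hsub (by omega)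
      (by omega)
    refine ⟨S, by rw [Set.ncard_coe_finset]; omega, fun i => ?_⟩
    simp only [Finset.mem_coe]
    split_ifs with hi
    · simpa using hS2 hi
    · intro hA
      exact hi (hS1 (by simpa using hA))

lemma sum_numSingle (A : ι → Set ℕ) (F : Finset ℕ) [∀ i, Decidable (∃ t ∈ F, A i = {t})] :
    ∑ t ∈ F, numSingle A t = ∑ i, (if ∃ t ∈ F, A i = {t} then 1 else 0) := by
  classical
  unfold numSingle
  simp only [Finset.card_filter]
  rw [Finset.sum_comm]
  refine Finset.sum_congr rfl fun i _ => ?_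
  split_ifs with h
  · obtain ⟨t, ht, hi⟩ := h
    rw [Finset.sum_eq_single_of_mem t ht]
    · simp [hi]
    · intro t' _ hne
      rw [if_neg]
      rw [hi]
      intro h
      exact hne (Set.singleton_injective h).symm
  · refine Finset.sum_eq_zero fun t ht => ?_
    rw [if_neg]
    exact fun hi => h ⟨t, ht, hi⟩

open Classical in
lemma numEmpty_eq_sum (A : ι → Set ℕ) : numEmpty A = ∑ i, (if A i = ∅ then 1 else 0) := by
  rw [numEmpty, Finset.card_filter]

open Classical in
/-- Mutually exclusive conditions hold for at most `card ι` indices in total. -/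
lemma sum_indicators_le {p q r s : ι → Prop} (hpq : ∀ i, p i → ¬ q i) (hpr : ∀ i, p i → ¬ r i)
    (hps : ∀ i, p i → ¬ s i) (hqr : ∀ i, q i → ¬ r i) (hqs : ∀ i, q i → ¬ s i)
    (hrs : ∀ i, r i → ¬ s i) :
    ((∑ i, (if p i then 1 else 0)) + (∑ i, (if q i then 1 else 0)) +
      ((∑ i, (if r i then 1 else 0)) + (∑ i, (if s i then 1 else 0))) ≤ Fintype.card ι) ∧
    (Fintype.card ι ≤ (∑ i, (if p i then 1 else 0)) + (∑ i, (if q i then 1 else 0)) +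
      ((∑ i, (if r i then 1 else 0)) + (∑ i, (if s i then 1 else 0))) →
      ∀ i, p i ∨ q i ∨ r i ∨ s i) := by
  have h : ∀ i, (if p i then 1 else 0) + (if q i then 1 else 0) +
      ((if r i then 1 else 0) + (if s i then 1 else 0)) ≤ 1 := by
    intro i
    have h1 := hpq i
    have h2 := hpr i
    have h3 := hps i
    have h4 := hqr i
    have h5 := hqs i
    have h6 := hrs i
    by_cases hp : p i <;> by_cases hq : q i <;> by_cases hr : r i <;> by_cases hs : s i <;>
      simp_all
  have hc : Fintype.card ι = ∑ _i : ι, 1 := by simp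
  rw [hc, ← Finset.sum_add_distrib, ← Finset.sum_add_distrib, ← Finset.sum_add_distrib]
  refine ⟨Finset.sum_le_sum fun i _ => h i, fun hle i => ?_⟩
  by_contra hi
  push Not at hi
  refine absurd hle (not_le.2 (Finset.sum_lt_sum (fun i _ => h i) ⟨i, Finset.mem_univ i, ?_⟩))
  simp [hi.1, hi.2.1, hi.2.2.1, hi.2.2.2]

lemma not_empty_of_single {A : Set ℕ} {F : Finset ℕ} (h : A = ∅) : ¬ ∃ t ∈ F, A = {t} := by
  rintro ⟨t, _, ht⟩
  exact Set.singleton_ne_empty t (ht.symm.trans h)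

lemma Spread.not_single {A : Set ℕ} {F : Finset ℕ} (h : Spread A) : ¬ ∃ t ∈ F, A = {t} := by
  rintro ⟨t, _, ht⟩
  exact h.ne_singleton t ht

/-- An empty set forces its partner to contain both parities, so the three conditions exclude each
other. When the bound is attained no other kind of branch is left, which is how branches are
identified later. -/
lemma singles_left (h : ∀ i, Balanced (A i) (B i)) (F : Finset ℕ) :
    numEmpty A + numEmpty B + ∑ t ∈ F, numSingle A t ≤ Fintype.card ι ∧
    (Fintype.card ι ≤ numEmpty A + numEmpty B + ∑ t ∈ F, numSingle A t →
      ∀ i, A i = ∅ ∨ B i = ∅ ∨ ∃ t ∈ F, A i = {t}) := by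
  classical
  have := sum_indicators_le (p := fun i => A i = ∅) (q := fun i => B i = ∅)
    (r := fun i => ∃ t ∈ F, A i = {t}) (s := fun _ => False)
    (fun i hA => ((h i).right_spread hA).ne_empty) (fun i hA => not_empty_of_single hA)
    (fun i _ => id) (fun i hB => ((h i).left_spread hB).not_single) (fun i _ => id)
    (fun i _ => id)
  rw [sum_numSingle, numEmpty_eq_sum, numEmpty_eq_sum]
  simp only [if_false, Finset.sum_const_zero, add_zero, or_false] at this
  convert this

lemma singles_right (h : ∀ i, Balanced (A i) (B i)) (F : Finset ℕ) :
    numEmpty A + numEmpty B + ∑ t ∈ F, numSingle B t ≤ Fintype.card ι ∧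
    (Fintype.card ι ≤ numEmpty A + numEmpty B + ∑ t ∈ F, numSingle B t →
      ∀ i, A i = ∅ ∨ B i = ∅ ∨ ∃ t ∈ F, B i = {t}) := by
  classical
  have := sum_indicators_le (p := fun i => A i = ∅) (q := fun i => B i = ∅)
    (r := fun i => ∃ t ∈ F, B i = {t}) (s := fun _ => False)
    (fun i hA => ((h i).right_spread hA).ne_empty)
    (fun i hA => ((h i).right_spread hA).not_single)
    (fun i _ => id) (fun i hB => not_empty_of_single hB) (fun i _ => id) (fun i _ => id)
  rw [sum_numSingle, numEmpty_eq_sum, numEmpty_eq_sum]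
  simp only [if_false, Finset.sum_const_zero, add_zero, or_false] at this
  convert this

/-- No branch has equal parities for its only two values. -/
lemma singles_same_parity (h : ∀ i, Balanced (A i) (B i)) (F : Finset ℕ)
    (hF : ∀ t ∈ F, ∀ t' ∈ F, Even (t + t')) :
    numEmpty A + numEmpty B + (∑ t ∈ F, numSingle A t + ∑ t ∈ F, numSingle B t) ≤
      Fintype.card ι := by
  classical
  have := (sum_indicators_le (p := fun i => A i = ∅) (q := fun i => B i = ∅)
    (r := fun i => ∃ t ∈ F, A i = {t}) (s := fun i => ∃ t ∈ F, B i = {t})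
    (fun i hA => ((h i).right_spread hA).ne_empty) (fun i hA => not_empty_of_single hA)
    (fun i hA => ((h i).right_spread hA).not_single)
    (fun i hB => ((h i).left_spread hB).not_single) (fun i hB => not_empty_of_single hB)
    (by
      rintro i ⟨t, ht, hA⟩ ⟨t', ht', hB⟩
      exact (Nat.not_even_iff_odd.2 ((h i).odd_add hA hB)) (hF t ht t' ht'))).1
  rw [sum_numSingle, sum_numSingle, numEmpty_eq_sum, numEmpty_eq_sum]
  convert this

end Values

/-! ### Few branches with exceptional values -/

section Counting

/-- Distinct natural numbers are at least 0, 1, 2, … in increasing order; a new maximum is at least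
the number of earlier elements. -/
lemma card_mul_le_two_mul_sum (P : Finset ℕ) :
    P.card * (P.card + 1) ≤ 2 * ∑ u ∈ P, (u + 1) := by
  induction P using Finset.induction_on_max with
  | empty => simp
  | insert m P hm ih =>
    have hmP : m ∉ P := fun h => lt_irrefl _ (hm m h)
    rw [Finset.card_insert_of_notMem hmP, Finset.sum_insert hmP]
    have hcard : P.card ≤ m := by
      have : P ⊆ Finset.range m := fun x hx => Finset.mem_range.2 (hm x hx)
      simpa using Finset.card_le_card this
    nlinarith

/-- Here `p` counts the values excluded through `a` and `q`, after the reflection `u ↦ N - u`, those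
excluded through `b`. Each side has budget `N`, an excluded `u` costs `u + 1`, and with `E` the two
sides cover all `N + 1` candidates. -/
lemma exists_of_cover {N : ℕ} {a b : ℕ → ℕ} (ha : ∑ u ∈ Finset.range (N + 1), a u ≤ N)
    (hb : ∑ u ∈ Finset.range (N + 1), b u ≤ N) (E : Finset ℕ)
    (h : ∀ u ≤ N, u ∉ E → u + 1 ≤ a u ∨ N + 1 ≤ b u + u) :
    ∃ p q, p * (p + 1) ≤ 2 * N ∧ q * (q + 1) ≤ 2 * N ∧ N + 1 ≤ p + q + E.card := by
  set P := (Finset.range (N + 1)).filter fun u => u + 1 ≤ a u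
  set Q := (Finset.range (N + 1)).filter fun u => u + 1 ≤ b (N - u)
  have hP : ∑ u ∈ P, (u + 1) ≤ N := by
    calc _ ≤ ∑ u ∈ P, a u := Finset.sum_le_sum fun u hu => (Finset.mem_filter.1 hu).2
      _ ≤ ∑ u ∈ Finset.range (N + 1), a u :=
        Finset.sum_le_sum_of_subset (Finset.filter_subset _ _)
      _ ≤ N := ha
  have hQ : ∑ u ∈ Q, (u + 1) ≤ N := by
    calc _ ≤ ∑ u ∈ Q, b (N - u) := Finset.sum_le_sum fun u hu => (Finset.mem_filter.1 hu).2
      _ ≤ ∑ u ∈ Finset.range (N + 1), b (N - u) :=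
        Finset.sum_le_sum_of_subset (Finset.filter_subset _ _)
      _ = ∑ u ∈ Finset.range (N + 1), b u := by
        rw [← Finset.sum_range_reflect]
        exact Finset.sum_congr rfl fun u hu => by
          rw [Finset.mem_range] at hu
          congr 1
          omega
      _ ≤ N := hb
  have hcover : Finset.range (N + 1) ⊆ E ∪ (P ∪ Q.image fun u => N - u) := by
    intro u hu
    rw [Finset.mem_range] at hu
    by_cases hu0 : u ∈ E
    · exact Finset.mem_union_left _ hu0
    refine Finset.mem_union_right _ (Finset.mem_union.2 ?_)
    rcases h u (by omega) hu0 with h | h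
    · left
      simp only [P, Finset.mem_filter, Finset.mem_range]
      omega
    · right
      refine Finset.mem_image.2 ⟨N - u, ?_, by omega⟩
      simp only [Q, Finset.mem_filter, Finset.mem_range]
      rw [show N - (N - u) = u by omega]
      omega
  have h1 := Finset.card_le_card hcover
  have h2 := Finset.card_union_le E (P ∪ Q.image fun u => N - u)
  have h3 := Finset.card_union_le P (Q.image fun u => N - u)
  have h4 := Finset.card_image_le (s := Q) (f := fun u => N - u)
  have h5 := card_mul_le_two_mul_sum P
  have h6 := card_mul_le_two_mul_sum Q
  rw [Finset.card_range] at h1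
  exact ⟨P.card, Q.card, by omega, by omega, by omega⟩

/-- From `p + q ≥ N + 1` and convexity, `(N + 1)(N + 3) ≤ 8N`, which fails from `N = 4` on. -/
lemma le_three_of_cover {N : ℕ} {a b : ℕ → ℕ} (ha : ∑ u ∈ Finset.range (N + 1), a u ≤ N)
    (hb : ∑ u ∈ Finset.range (N + 1), b u ≤ N)
    (h : ∀ u ≤ N, u + 1 ≤ a u ∨ N + 1 ≤ b u + u) : N ≤ 3 := by
  obtain ⟨p, q, hp, hq, hpq⟩ := exists_of_cover ha hb ∅ fun u hu _ => h u hu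
  rw [Finset.card_empty] at hpq
  by_contra hN
  have hN : 4 ≤ N := by omega
  zify at hp hq hpq hN
  nlinarith [sq_nonneg ((p : ℤ) - q)]

/-- One surviving value weakens the covering to `p + q ≥ N`, and convexity gives `N(N + 2) ≤ 8N`. -/
lemma le_six_of_cover {N : ℕ} {a b : ℕ → ℕ} (ha : ∑ u ∈ Finset.range (N + 1), a u ≤ N)
    (hb : ∑ u ∈ Finset.range (N + 1), b u ≤ N) (u₀ : ℕ)
    (h : ∀ u ≤ N, u ≠ u₀ → u + 1 ≤ a u ∨ N + 1 ≤ b u + u) : N ≤ 6 := by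
  obtain ⟨p, q, hp, hq, hpq⟩ := exists_of_cover ha hb {u₀} fun u hu hu' => h u hu (by simpa using hu')
  rw [Finset.card_singleton] at hpq
  by_contra hN
  have hN : 7 ≤ N := by omega
  zify at hp hq hpq hN
  nlinarith [sq_nonneg ((p : ℤ) - q)]

/-- The ways to exclude all values of a join. -/
lemma cover_all {N : ℕ} {a b : ℕ → ℕ} (ha : ∑ u ∈ Finset.range (N + 1), a u ≤ N)
    (hb : ∑ u ∈ Finset.range (N + 1), b u ≤ N)
    (h : ∀ u ≤ N, u + 1 ≤ a u ∨ N + 1 ≤ b u + u) :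
    (N = 1 ∧ 1 ≤ a 0 ∧ 1 ≤ b 1) ∨ (N = 3 ∧ 1 ≤ a 0 ∧ 2 ≤ a 1 ∧ 2 ≤ b 2 ∧ 1 ≤ b 3) := by
  have hN := le_three_of_cover ha hb h
  have h0 := h 0
  have h1 := h 1
  have h2 := h 2
  have h3 := h 3
  clear h
  interval_cases N <;> simp only [Finset.sum_range_succ, Finset.sum_range_zero] at ha hb <;> omega

/-- The ways to exclude all values but one of a join, with and without the increase at the root. -/
lemma cover_all_but_one {N : ℕ} {a b : ℕ → ℕ} {u₀ u₁ : ℕ}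
    (ha : ∑ u ∈ Finset.range (N + 2), a u ≤ N) (hb : ∑ u ∈ Finset.range (N + 2), b u ≤ N)
    (hpar : ∀ ε ≤ 1, ∑ u ∈ (Finset.range (N + 2)).filter (fun u => u % 2 = ε), a u +
      ∑ u ∈ (Finset.range (N + 2)).filter (fun u => u % 2 = ε), b u ≤ N)
    (h : ∀ u ≤ N, u ≠ u₀ → u + 1 ≤ a u ∨ N + 1 ≤ b u + u)
    (h' : ∀ u ≤ N, u ≠ u₁ → u + 1 ≤ a (u + 1) ∨ N + 1 ≤ b (u + 1) + u) :
    N = 0 ∨ (N = 2 ∧ 1 ≤ a 0 ∧ 1 ≤ a 1 ∧ 1 ≤ b 2 ∧ 1 ≤ b 3) ∨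
      (N = 2 ∧ 2 ≤ a 1 ∧ 2 ≤ b 2) := by
  -- The window without increase already bounds `N`; the shifted window and the parity bounds enter
  -- only in the finite check.
  have hN := le_six_of_cover (a := a) (b := b) (N := N)
    (by rw [Finset.sum_range_succ] at ha; omega) (by rw [Finset.sum_range_succ] at hb; omega) u₀ h
  have hp0 := hpar 0 (by omega)
  have hp1 := hpar 1 (by omega)
  have h0 := h 0
  have h1 := h 1
  have h2 := h 2
  have h3 := h 3
  have h4 := h 4
  have h5 := h 5
  have h6 := h 6
  have k0 := h' 0
  have k1 := h' 1
  have k2 := h' 2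
  have k3 := h' 3
  have k4 := h' 4
  have k5 := h' 5
  have k6 := h' 6
  clear h h' hpar
  interval_cases N <;>
    simp [Finset.sum_filter, Finset.sum_range_succ] at ha hb hp0 hp1 <;>
    simp at h0 h1 h2 h3 h4 h5 h6 k0 k1 k2 k3 k4 k5 k6
  · omega
  · omega
  · omega
  -- For `N = 3` each window loses two values at its lower or at its upper end. The same end twice
  -- breaks a sum bound, and opposite ends break a parity bound.
  · have e0 : (1 ≤ a 0 ∧ 2 ≤ a 1) ∨ (2 ≤ b 2 ∧ 1 ≤ b 3) := by clear k0 k1 k2 k3 k4 k5 k6; omega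
    have e1 : (1 ≤ a 1 ∧ 2 ≤ a 2) ∨ (2 ≤ b 3 ∧ 1 ≤ b 4) := by clear h0 h1 h2 h3 h4 h5 h6; omega
    clear h0 h1 h2 h3 h4 h5 h6 k0 k1 k2 k3 k4 k5 k6
    omega
  -- For `N = 4` only the middle value of each window can survive, and the demands of the two
  -- windows are then incompatible.
  · have e0 : u₀ = 2 := by clear k0 k1 k2 k3 k4 k5 k6; omega
    have e1 : u₁ = 2 := by clear h0 h1 h2 h3 h4 h5 h6; omega
    omega
  · clear k0 k1 k2 k3 k4 k5 k6
    omega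
  · have e0 : u₀ = 3 := by clear k0 k1 k2 k3 k4 k5 k6; omega
    omega

end Counting

/-! ### Kinds of branches and the possible shapes of a join -/

section Kinds

/-- The sets of values of a rooted tree of the given kind. -/
def HasKind : Kind → Set ℕ → Set ℕ → Prop
  | .bad, A, _ => A = ∅
  | .minus, _, B => B = ∅
  | .plusOne s, A, B => A = {s} ∧ B = {s + 1}
  | .plusThree s, A, B => A = {s} ∧ B = {s + 3}

variable {ι : Type u} [Fintype ι] {A B : ι → Set ℕ}

open Classical in
lemma count_eq_card_filter (c : ι → Kind) (k : Kind) :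
    count c k = (Finset.univ.filter fun i => c i = k).card := by
  rw [count, Nat.card_eq_fintype_card, Fintype.card_subtype]

lemma card_filter_and_const {p : ι → Prop} {q : Prop} [DecidablePred p] [Decidable q]
    [DecidablePred fun i => p i ∧ q] :
    (Finset.univ.filter fun i => p i ∧ q).card =
      if q then (Finset.univ.filter p).card else 0 := by
  split_ifs with h <;> simp [h]

lemma card_filter_or_eq {p q r : ι → Prop} [DecidablePred p] [DecidablePred q]
    [DecidablePred r] (h : ∀ i, r i ↔ p i ∨ q i) (h' : ∀ i, p i → ¬ q i) :
    (Finset.univ.filter r).card = (Finset.univ.filter p).card + (Finset.univ.filter q).card := by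
  simp only [h]
  classical
  rw [Finset.filter_or, Finset.card_union_of_disjoint]
  rw [Finset.disjoint_filter]
  exact fun i _ => h' i

/-- The numbers of branches with given values, in terms of the kinds of the branches. -/
lemma counts_of_kinds (h : ∀ i, Balanced (A i) (B i)) {c : ι → Kind}
    (hc : ∀ i, HasKind (c i) (A i) (B i)) {a b : ℕ}
    (hk : ∀ i, c i = .plusThree a ∨ c i = .plusOne b ∨ c i = .bad ∨ c i = .minus) :
    numEmpty A = count c .bad ∧ numEmpty B = count c .minus ∧
    (∀ t, numSingle A t = (if t = b then count c (.plusOne b) else 0) +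
      (if t = a then count c (.plusThree a) else 0)) ∧
    (∀ t, numSingle B t = (if t = b + 1 then count c (.plusOne b) else 0) +
      (if t = a + 3 then count c (.plusThree a) else 0)) ∧
    Fintype.card ι = count c (.plusThree a) + count c (.plusOne b) + count c .bad +
      count c .minus := by
  classical
  have hA : ∀ i, A i = ∅ ↔ c i = .bad := by
    intro i
    have := hc i
    rcases hk i with hi | hi | hi | hi <;> rw [hi] at this ⊢ <;> simp only [HasKind] at this
    · simp [this.1]
    · simp [this.1]
    · simpa using this
    · simp [((h i).left_spread this).ne_empty]
  have hB : ∀ i, B i = ∅ ↔ c i = .minus := by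
    intro i
    have := hc i
    rcases hk i with hi | hi | hi | hi <;> rw [hi] at this ⊢ <;> simp only [HasKind] at this
    · simp [this.2]
    · simp [this.2]
    · simpa using ((h i).right_spread this).ne_empty
    · simpa using this
  have hA1 : ∀ t i, A i = {t} ↔ (c i = .plusOne b ∧ t = b) ∨ (c i = .plusThree a ∧ t = a) := by
    intro t i
    have := hc i
    rcases hk i with hi | hi | hi | hi <;> rw [hi] at this ⊢ <;> simp only [HasKind] at this
    · simp [this.1, eq_comm]
    · simp [this.1, eq_comm]
    · simp [this]
    · simpa using ((h i).left_spread this).ne_singleton t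
  have hB1 : ∀ t i, B i = {t} ↔
      (c i = .plusOne b ∧ t = b + 1) ∨ (c i = .plusThree a ∧ t = a + 3) := by
    intro t i
    have := hc i
    rcases hk i with hi | hi | hi | hi <;> rw [hi] at this ⊢ <;> simp only [HasKind] at this
    · simp [this.2, eq_comm]
    · simp [this.2, eq_comm]
    · simpa using ((h i).right_spread this).ne_singleton t
    · simp [this]
  refine ⟨by simp only [numEmpty, hA, count_eq_card_filter],
    by simp only [numEmpty, hB, count_eq_card_filter], fun t => ?_, fun t => ?_, ?_⟩
  · rw [numSingle, card_filter_or_eq (hA1 t) (by simp +contextual), card_filter_and_const,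
      card_filter_and_const, count_eq_card_filter, count_eq_card_filter]
  · rw [numSingle, card_filter_or_eq (hB1 t) (by simp +contextual), card_filter_and_const,
      card_filter_and_const, count_eq_card_filter, count_eq_card_filter]
  · simp only [count_eq_card_filter, Finset.card_filter]
    rw [← Finset.sum_add_distrib, ← Finset.sum_add_distrib, ← Finset.sum_add_distrib,
      ← Finset.card_univ, Finset.card_eq_sum_ones]
    refine Finset.sum_congr rfl fun i _ => ?_
    rcases hk i with hi | hi | hi | hi <;> simp [hi]

/-- The values of a join whose branches have known kinds. -/
lemma mem_joinValues_of_kinds (h : ∀ i, Balanced (A i) (B i)) {c : ι → Kind}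
    (hc : ∀ i, HasKind (c i) (A i) (B i)) {a b : ℕ}
    (hk : ∀ i, c i = .plusThree a ∨ c i = .plusOne b ∨ c i = .bad ∨ c i = .minus) {d t : ℕ} :
    t ∈ joinValues A B d ↔
      count c .bad + ((if t = b then count c (.plusOne b) else 0) +
        (if t = a then count c (.plusThree a) else 0)) + d ≤ t ∧
      t + ((if t = b + 1 then count c (.plusOne b) else 0) +
        (if t = a + 3 then count c (.plusThree a) else 0)) ≤
        count c (.plusThree a) + count c (.plusOne b) + count c .bad + d := by
  obtain ⟨e1, e2, e3, e4, e5⟩ := counts_of_kinds h hc hk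
  rw [mem_joinValues_iff h, e1, e2, e3, e4, e5]
  omega

lemma count_eq_zero {c : ι → Kind} {k : Kind} (h : ∀ i, c i ≠ k) : count c k = 0 := by
  classical
  rw [count_eq_card_filter]
  simp [h]

/-- The shape of the branches when the join has no values. -/
lemma classify_empty (h : ∀ i, Balanced (A i) (B i)) (h0 : joinValues A B 0 = ∅) :
    (Fintype.card ι = numEmpty A + numEmpty B + 1 ∧
      ∀ i, A i = ∅ ∨ B i = ∅ ∨ (A i = {numEmpty A} ∧ B i = {numEmpty A + 1})) ∨
    (Fintype.card ι = numEmpty A + numEmpty B + 3 ∧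
      ∀ i, A i = ∅ ∨ B i = ∅ ∨ B i = {numEmpty A + 2} ∨ B i = {numEmpty A + 3}) := by
  have hle := (singles_left h ∅).1
  simp only [Finset.sum_empty, add_zero] at hle
  obtain ⟨N, hN⟩ := Nat.exists_eq_add_of_le hle
  set s := numEmpty A
  set m := numEmpty B
  have ha : ∀ n, ∑ u ∈ Finset.range n, numSingle A (s + u) ≤ N := by
    intro n
    have := (singles_left h ((Finset.range n).map (addLeftEmbedding s))).1
    simp only [Finset.sum_map, addLeftEmbedding_apply] at this
    omega
  have hb : ∀ n, ∑ u ∈ Finset.range n, numSingle B (s + u) ≤ N := by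
    intro n
    have := (singles_right h ((Finset.range n).map (addLeftEmbedding s))).1
    simp only [Finset.sum_map, addLeftEmbedding_apply] at this
    omega
  -- Writing `t = s + u`, with `N` the number of branches where both sets are nonempty, turns the
  -- absence of a value into a covering condition.
  have hcov : ∀ u ≤ N, u + 1 ≤ numSingle A (s + u) ∨ N + 1 ≤ numSingle B (s + u) + u := by
    intro u hu
    have : s + u ∉ joinValues A B 0 := by simp [h0]
    rw [mem_joinValues_iff h] at this
    omega
  rcases cover_all (ha _) (hb _) hcov with ⟨hN1, h1, h2⟩ | ⟨hN3, h1, h2, h3, h4⟩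
  · left
    refine ⟨by omega, fun i => ?_⟩
    have hA := (singles_left h {s}).2 (by simp only [Finset.sum_singleton] ; simp at h1; omega) i
    have hB := (singles_right h {s + 1}).2 (by simp only [Finset.sum_singleton] ; omega) i
    simp only [Finset.mem_singleton, exists_eq_left] at hA hB
    tauto
  -- For `N = 3` only the sets `B` are recorded. This is enough to exclude a one-vertex branch, for
  -- which `B = {1}`.
  · right
    refine ⟨by omega, fun i => ?_⟩
    have hB := (singles_right h {s + 2, s + 3}).2
      (by rw [Finset.sum_pair (by omega)]; omega) i
    simpa using hB

/-- The shape of the branches when the join has one value, with and without the increase. -/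
lemma classify_singles (h : ∀ i, Balanced (A i) (B i)) {t₀ t₁ : ℕ}
    (h0 : joinValues A B 0 = {t₀}) (h1 : joinValues A B 1 = {t₁}) :
    ∃ c : ι → Kind, (∀ i, HasKind (c i) (A i) (B i)) ∧ ∃ s, count c .bad = s ∧
      (((∀ i, c i = .bad ∨ c i = .minus) ∧ t₀ = s ∧ t₁ = s + 1) ∨
      ((∀ i, c i = .plusThree s ∨ c i = .plusOne (s + 1) ∨ c i = .bad ∨ c i = .minus) ∧
        count c (.plusThree s) = 1 ∧ count c (.plusOne (s + 1)) = 1 ∧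
        t₀ = s + 1 ∧ t₁ = s + 2) ∨
      ((∀ i, c i = .plusOne (s + 1) ∨ c i = .bad ∨ c i = .minus) ∧
        count c (.plusOne (s + 1)) = 2 ∧ t₀ = s ∧ t₁ = s + 3)) := by
  classical
  have hle := (singles_left h ∅).1
  simp only [Finset.sum_empty, add_zero] at hle
  obtain ⟨N, hN⟩ := Nat.exists_eq_add_of_le hle
  set s := numEmpty A
  set m := numEmpty B
  have hmap : ∀ F : Finset ℕ, ∀ f : ℕ → ℕ,
      ∑ t ∈ F.map (addLeftEmbedding s), f t = ∑ u ∈ F, f (s + u) := by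
    intro F f
    simp only [Finset.sum_map, addLeftEmbedding_apply]
  have ha : ∀ F : Finset ℕ, ∑ u ∈ F, numSingle A (s + u) ≤ N := by
    intro F
    have := (singles_left h (F.map (addLeftEmbedding s))).1
    rw [hmap] at this
    omega
  have hb : ∀ F : Finset ℕ, ∑ u ∈ F, numSingle B (s + u) ≤ N := by
    intro F
    have := (singles_right h (F.map (addLeftEmbedding s))).1
    rw [hmap] at this
    omega
  -- If both sets of a branch are singletons, their elements have opposite parities; so within one
  -- parity class a branch is counted at most once.
  have hpar : ∀ ε ≤ 1, ∑ u ∈ (Finset.range (N + 2)).filter (fun u => u % 2 = ε),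
      numSingle A (s + u) + ∑ u ∈ (Finset.range (N + 2)).filter (fun u => u % 2 = ε),
      numSingle B (s + u) ≤ N := by
    intro ε _
    have := singles_same_parity h (((Finset.range (N + 2)).filter
      (fun u => u % 2 = ε)).map (addLeftEmbedding s)) (by
        simp only [Finset.mem_map, Finset.mem_filter, addLeftEmbedding_apply]
        rintro _ ⟨u, ⟨_, hu⟩, rfl⟩ _ ⟨u', ⟨_, hu'⟩, rfl⟩
        rw [Nat.even_iff]
        omega)
    rw [hmap, hmap] at this
    omega
  have hv0 : ∀ t, t ∈ joinValues A B 0 ↔ t = t₀ := by simp [h0]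
  have hv1 : ∀ t, t ∈ joinValues A B 1 ↔ t = t₁ := by simp [h1]
  simp only [mem_joinValues_iff h] at hv0 hv1
  have hcov : ∀ u ≤ N, u ≠ t₀ - s →
      u + 1 ≤ numSingle A (s + u) ∨ N + 1 ≤ numSingle B (s + u) + u := by
    intro u hu hne
    have := (hv0 (s + u)).1
    omega
  -- The increase at the root moves the window of candidates up by one, hence `t = s + (u + 1)`.
  have hcov' : ∀ u ≤ N, u ≠ t₁ - (s + 1) →
      u + 1 ≤ numSingle A (s + (u + 1)) ∨ N + 1 ≤ numSingle B (s + (u + 1)) + u := by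
    intro u hu hne
    have := (hv1 (s + (u + 1))).1
    omega
  rcases cover_all_but_one (a := fun u => numSingle A (s + u)) (b := fun u => numSingle B (s + u))
    (ha _) (hb _) hpar hcov hcov' with hN0 | ⟨hN2, a0, a1, b2, b3⟩ | ⟨hN2, a1, b2⟩
  · have hi := (singles_left h ∅).2 (by simp only [Finset.sum_empty]; omega)
    simp only [Finset.notMem_empty, false_and, exists_false, or_false] at hi
    have x0 := ha {0}
    have x1 := ha {1}
    have y0 := hb {0}
    have y1 := hb {1}
    simp only [Finset.sum_singleton, add_zero] at x0 x1 y0 y1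
    have hk : ∀ i, ∃ k, HasKind k (A i) (B i) ∧ (k = .bad ∨ k = .minus) := fun i =>
      (hi i).elim (fun e => ⟨.bad, e, by simp⟩) (fun e => ⟨.minus, e, by simp⟩)
    choose c hc hc' using hk
    obtain ⟨e1, -⟩ := counts_of_kinds h hc (a := 0) (b := 0) fun i => Or.inr (Or.inr (hc' i))
    refine ⟨c, hc, s, e1.symm, Or.inl ⟨hc', ?_, ?_⟩⟩
    · exact ((hv0 s).1 (by omega)).symm
    · exact ((hv1 (s + 1)).1 (by omega)).symm
  · have hi := (singles_left h {s, s + 1}).2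
      (by rw [Finset.sum_pair (by omega)]; simp only [add_zero] at a0; omega)
    have hj := (singles_right h {s + 2, s + 3}).2 (by rw [Finset.sum_pair (by omega)]; omega)
    simp only [Finset.mem_insert, Finset.mem_singleton, exists_eq_or_imp, exists_eq_left] at hi hj
    have x := ha {0, 1}
    have y := hb {2, 3}
    rw [Finset.sum_pair (by omega)] at x y
    have x' := ha {0, 1, 2}
    have y' := hb {1, 2, 3}
    rw [Finset.sum_insert (by simp), Finset.sum_pair (by omega)] at x' y'
    simp only [add_zero] at a0 x x'
    have hk : ∀ i, ∃ k, HasKind k (A i) (B i) ∧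
        (k = .plusThree s ∨ k = .plusOne (s + 1) ∨ k = .bad ∨ k = .minus) := by
      intro i
      rcases hi i with e | e | e | e
      · exact ⟨.bad, e, by simp⟩
      · exact ⟨.minus, e, by simp⟩
      · rcases hj i with e' | e' | e' | e'
        · exact ⟨.bad, e', by simp⟩
        · exact ⟨.minus, e', by simp⟩
        -- The pair `{s}`, `{s + 2}` has even sum and is excluded by balance; this is what pairs `s`
        -- with `s + 3` and `s + 1` with `s + 2`.
        · have := Nat.odd_iff.1 ((h i).odd_add e e')
          omega
        · exact ⟨.plusThree s, ⟨e, e'⟩, by simp⟩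
      · rcases hj i with e' | e' | e' | e'
        · exact ⟨.bad, e', by simp⟩
        · exact ⟨.minus, e', by simp⟩
        · exact ⟨.plusOne (s + 1), ⟨e, e'⟩, by simp⟩
        · have := Nat.odd_iff.1 ((h i).odd_add e e')
          omega
    choose c hc hc' using hk
    obtain ⟨e1, -, e3, -⟩ := counts_of_kinds h hc hc'
    have e3s := e3 s
    have e3s' := e3 (s + 1)
    rw [if_neg (by omega), if_pos rfl] at e3s
    rw [if_pos rfl, if_neg (by omega)] at e3s'
    refine ⟨c, hc, s, e1.symm, Or.inr (Or.inl ⟨hc', ?_, ?_, ?_, ?_⟩)⟩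
    · omega
    · omega
    · exact ((hv0 (s + 1)).1 (by omega)).symm
    · exact ((hv1 (s + 2)).1 (by omega)).symm
  · have hi := (singles_left h {s + 1}).2 (by simp only [Finset.sum_singleton]; omega)
    have hj := (singles_right h {s + 2}).2 (by simp only [Finset.sum_singleton]; omega)
    simp only [Finset.mem_singleton, exists_eq_left] at hi hj
    have x := ha {0, 1}
    have y := hb {0, 2}
    rw [Finset.sum_pair (by omega)] at x y
    have x' := ha {3, 1}
    have y' := hb {3, 2}
    rw [Finset.sum_pair (by omega)] at x' y'
    simp only [add_zero] at x y
    have hk : ∀ i, ∃ k, HasKind k (A i) (B i) ∧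
        (k = .plusOne (s + 1) ∨ k = .bad ∨ k = .minus) := by
      intro i
      rcases hi i with e | e | e
      · exact ⟨.bad, e, by simp⟩
      · exact ⟨.minus, e, by simp⟩
      · rcases hj i with e' | e' | e'
        · exact ⟨.bad, e', by simp⟩
        · exact ⟨.minus, e', by simp⟩
        · exact ⟨.plusOne (s + 1), ⟨e, e'⟩, by simp⟩
    choose c hc hc' using hk
    obtain ⟨e1, -, e3, -⟩ := counts_of_kinds h hc (a := s) fun i => Or.inr (hc' i)
    have e3s := e3 (s + 1)
    rw [if_pos rfl, if_neg (by omega)] at e3s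
    refine ⟨c, hc, s, e1.symm, Or.inr (Or.inr ⟨hc', ?_, ?_, ?_⟩)⟩
    · omega
    · exact ((hv0 s).1 (by omega)).symm
    · exact ((hv1 (s + 3)).1 (by omega)).symm

end Kinds

/-! ### Values of rooted trees -/

section RootedTrees

/-- The values that the degree of `v`, increased by `c`, can have in a proper weighting. -/
def values {V : Type u} (G : SimpleGraph V) (v : V) (c : ℕ) : Set ℕ := {t | Attains G v c t}

lemma mem_values {V : Type u} {G : SimpleGraph V} {v : V} {c t : ℕ} :
    t ∈ values G v c ↔ Attains G v c t := Iff.rfl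

lemma values_iso {V W : Type u} {G : SimpleGraph V} {H : SimpleGraph W} (e : G ≃g H) (v : V)
    (c : ℕ) : values H (e v) c = values G v c :=
  Set.ext fun _ => attains_iso_iff e

lemma values_join {ι : Type u} {W : ι → Type u} [∀ i, Finite (W i)] (H : ∀ i, SimpleGraph (W i))
    (r : ∀ i, W i) (c : ℕ) :
    values (join H r) none c =
      joinValues (fun i => values (H i) (r i) 0) (fun i => values (H i) (r i) 1) c := by
  classical
  ext t
  rw [mem_values, attains_join_iff]
  unfold joinValues
  rw [Set.mem_ofPred_eq]
  refine exists_congr fun S => and_congr_right fun _ => forall_congr' fun i =>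
    exists_congr fun x => and_congr_right fun _ => ?_
  split_ifs <;> rfl

/-- Rooted trees are built by joining smaller ones. -/
theorem tree_induction {motive : ∀ {V : Type u}, SimpleGraph V → V → Prop}
    (hiso : ∀ {V W : Type u} {G : SimpleGraph V} {H : SimpleGraph W} (e : G ≃g H) (v : V),
      motive G v → motive H (e v))
    (hjoin : ∀ {ι : Type u} [Finite ι] {W : ι → Type u} [∀ i, Finite (W i)]
      (H : ∀ i, SimpleGraph (W i)) (r : ∀ i, W i), (∀ i, (H i).IsTree) →
      (∀ i, motive (H i) (r i)) → motive (join H r) none)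
    {V : Type u} [hV : Finite V] (G : SimpleGraph V) (v : V) (hG : G.IsTree) : motive G v := by
  induction hn : Nat.card V using Nat.strong_induction_on generalizing V with
  | _ n ih =>
  have := hiso (sideIso hG v) none (hjoin _ _ (fun i => side_induce_isTree hG.isAcyclic) fun i => ?_)
  · simpa using this
  · refine ih _ ?_ _ _ (side_induce_isTree hG.isAcyclic) rfl
    rw [← hn]
    refine Set.ncard_lt_card (Set.ne_univ_iff_exists_notMem _ |>.2 ⟨v, not_mem_side ?_⟩)
    exact i.2.ne'

/-! ### Parity -/

/-- The vertices of the summands of a join that lie in given sets. -/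
def liftSet {ι : Type u} {W : ι → Type u} (Y : ∀ i, Set (W i)) : Set (Option (Σ i, W i)) :=
  {a | ∃ i, ∃ x ∈ Y i, a = some ⟨i, x⟩}

lemma some_mem_liftSet {ι : Type u} {W : ι → Type u} {Y : ∀ i, Set (W i)} {i : ι} {x : W i} :
    some ⟨i, x⟩ ∈ liftSet Y ↔ x ∈ Y i := by
  constructor
  · rintro ⟨j, y, hy, h⟩
    cases h
    exact hy
  · exact fun h => ⟨i, x, h, rfl⟩

lemma none_notMem_liftSet {ι : Type u} {W : ι → Type u} {Y : ∀ i, Set (W i)} :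
    none ∉ liftSet Y := by
  rintro ⟨j, y, hy, h⟩
  cases h

lemma ncard_liftSet {ι : Type u} [Fintype ι] {W : ι → Type u} [∀ i, Finite (W i)]
    (Y : ∀ i, Set (W i)) : (liftSet Y).ncard = ∑ i, (Y i).ncard := by
  have e : (Σ i, Y i) ≃ liftSet Y := Equiv.ofBijective
    (fun a => ⟨some ⟨a.1, a.2.1⟩, some_mem_liftSet.2 a.2.2⟩) (by
      constructor
      · rintro ⟨i, x, hx⟩ ⟨j, y, hy⟩ h
        simp only [Subtype.mk.injEq] at h
        cases h
        rfl
      · rintro ⟨_, i, x, hx, rfl⟩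
        exact ⟨⟨i, x, hx⟩, rfl⟩)
  rw [← Nat.card_coe_set_eq, ← Nat.card_congr e, Nat.card_sigma]
  rfl

/-- Prescribing the parities of all degrees: the vertices of a 2-colouring class have odd degree,
the others even degree. -/
def HasParityValues {V : Type u} (G : SimpleGraph V) (v : V) : Prop :=
  ∃ X : Set V, v ∈ X ∧ (∀ x y, G.Adj x y → (x ∈ X ↔ y ∉ X)) ∧ ∀ c ≤ 1,
    (Even (X.ncard + c) → ∃ a ∈ values G v c, Odd a) ∧
    (Even (Xᶜ.ncard + c) → ∃ a ∈ values G v c, Even a)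

lemma odd_ncard_odd_iff {ι : Type u} [Fintype ι] (f : ι → ℕ) :
    Odd {i | Odd (f i)}.ncard ↔ Odd (∑ i, f i) := by
  classical
  rw [Finset.odd_sum_iff_odd_card_odd, Set.ncard_eq_toFinset_card']
  simp

/-- Give weight 1 to exactly the new edges whose branch needs it for its own parity. The roots of
the branches then satisfy `Q` and the new vertex does not, so they differ automatically. -/
lemma mem_joinValues_of_parity {ι : Type u} [Fintype ι] {A B : ι → Set ℕ} (f : ι → ℕ) (c : ℕ)
    (Q : ℕ → Prop) (hQ : ¬ Q ({i | Odd (f i)}.ncard + c))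
    (h : ∀ i, (Even (f i) → ∃ a ∈ A i, Q a) ∧ (Odd (f i) → ∃ a ∈ B i, Q a)) :
    {i | Odd (f i)}.ncard + c ∈ joinValues A B c := by
  refine ⟨_, rfl, fun i => ?_⟩
  split_ifs with hi
  · obtain ⟨a, ha, hq⟩ := (h i).2 hi
    exact ⟨a, fun e => hQ (e ▸ hq), ha⟩
  · obtain ⟨a, ha, hq⟩ := (h i).1 (Nat.not_odd_iff_even.1 hi)
    exact ⟨a, fun e => hQ (e ▸ hq), ha⟩

/-- Within each branch the number of vertices of prescribed odd degree determines the weight of its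
new edge modulo 2. The hypothesis on the cardinality of a class is exactly what makes the degree at
the new vertex come out with the required parity. -/
lemma hasParityValues {V : Type u} [Finite V] (G : SimpleGraph V) (v : V) (hG : G.IsTree) :
    HasParityValues G v := by
  refine tree_induction (motive := fun G v => HasParityValues G v) ?_ ?_ G v hG
  · rintro V W G H e v ⟨X, hv, hX, h⟩
    refine ⟨e '' X, Set.mem_image_of_mem _ hv, ?_, fun c hc => ?_⟩
    · intro x y hxy
      obtain ⟨x, rfl⟩ := e.surjective x
      obtain ⟨y, rfl⟩ := e.surjective y
      rw [e.injective.mem_set_image, e.injective.mem_set_image]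
      exact hX x y (e.map_adj_iff.1 hxy)
    · rw [← Set.image_compl_eq e.bijective, Set.ncard_image_of_injective _ e.injective,
        Set.ncard_image_of_injective _ e.injective, values_iso]
      exact h c hc
  · intro ι _ W _ H r _ ih
    have := Fintype.ofFinite ι
    choose X hr hX h using ih
    -- The classes are exchanged in each branch because `r i ∈ X i` is adjacent to the new vertex.
    refine ⟨insert none (liftSet fun i => (X i)ᶜ), Set.mem_insert _ _, ?_, fun c hc => ?_⟩
    · intro a b hab
      cases hab with
      | inner i x y h' =>
        simp only [Set.mem_insert_iff, reduceCtorEq, some_mem_liftSet, false_or, Set.mem_compl_iff]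
        rw [not_not, hX i x y h', not_not]
      | down i => simp [some_mem_liftSet, hr i]
      | up i => simp [some_mem_liftSet, hr i]
    · have hcompl : (insert none (liftSet fun i => (X i)ᶜ))ᶜ = liftSet X := by
        ext a
        match a with
        | none => simp [none_notMem_liftSet]
        | some ⟨i, x⟩ => simp [some_mem_liftSet]
      rw [hcompl, Set.ncard_insert_of_notMem none_notMem_liftSet (Set.toFinite _),
        ncard_liftSet, ncard_liftSet, values_join]
      have h0 := fun i => h i 0 (by omega)
      have h1 := fun i => h i 1 (by omega)
      simp only [add_zero] at h0
      constructor
      · intro he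
        have hodd := odd_ncard_odd_iff fun i => (X i)ᶜ.ncard
        have ht : Odd ({i | Odd (X i)ᶜ.ncard}.ncard + c) := by
          rw [Nat.odd_add, hodd]
          rw [Nat.even_add, Nat.even_add_one, Nat.not_even_iff_odd] at he
          exact he
        refine ⟨_, mem_joinValues_of_parity (fun i => (X i)ᶜ.ncard) c Even
          (Nat.not_even_iff_odd.2 ht) fun i => ⟨(h0 i).2, fun ho => (h1 i).2 ?_⟩, ht⟩
        exact ho.add_odd odd_one
      · intro he
        have hodd := odd_ncard_odd_iff fun i => (X i).ncard
        have ht : Even ({i | Odd (X i).ncard}.ncard + c) := by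
          rw [Nat.even_add, ← Nat.not_odd_iff_even, hodd, Nat.not_odd_iff_even]
          rwa [Nat.even_add] at he
        refine ⟨_, mem_joinValues_of_parity (fun i => (X i).ncard) c Odd
          (Nat.not_odd_iff_even.2 ht) fun i => ⟨(h0 i).1, fun ho => (h1 i).1 ?_⟩, ht⟩
        exact ho.add_odd odd_one

/-- If both classes are even, `A` has both parities; if both are odd, `B` has; in the mixed cases
`A` and `B` each receive a value, of opposite parities. -/
lemma HasParityValues.balanced {V : Type u} {G : SimpleGraph V} {v : V}
    (h : HasParityValues G v) : Balanced (values G v 0) (values G v 1) := by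
  obtain ⟨X, -, -, h⟩ := h
  have h0 := h 0 (by omega)
  have h1 := h 1 (by omega)
  simp only [add_zero, Nat.even_add_one, Nat.not_even_iff_odd] at h0 h1
  rcases Nat.even_or_odd X.ncard with hX | hX <;> rcases Nat.even_or_odd Xᶜ.ncard with hY | hY
  · exact Or.inl ⟨h0.2 hY, h0.1 hX⟩
  · obtain ⟨a, ha, ha'⟩ := h0.1 hX
    obtain ⟨b, hb, hb'⟩ := h1.2 hY
    exact Or.inr (Or.inr ⟨a, ha, b, hb, ha'.add_even hb'⟩)
  · obtain ⟨a, ha, ha'⟩ := h0.2 hY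
    obtain ⟨b, hb, hb'⟩ := h1.1 hX
    exact Or.inr (Or.inr ⟨a, ha, b, hb, ha'.add_odd hb'⟩)
  · exact Or.inr (Or.inl ⟨h1.2 hY, h1.1 hX⟩)

lemma balanced_values {V : Type u} [Finite V] {G : SimpleGraph V} (hG : G.IsTree) (v : V) :
    Balanced (values G v 0) (values G v 1) :=
  (hasParityValues G v hG).balanced

/-! ### The semantic classes -/

/-- `G` is a finite tree whose sets of values at `v` are those of the given kind. -/
def IsKind (k : Kind) {V : Type u} (G : SimpleGraph V) (v : V) : Prop :=
  Finite V ∧ G.IsTree ∧ HasKind k (values G v 0) (values G v 1)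

lemma IsKind.map_iso {k : Kind} {V W : Type u} {G : SimpleGraph V} {H : SimpleGraph W} {v : V}
    (h : IsKind k G v) (e : G ≃g H) : IsKind k H (e v) := by
  obtain ⟨hV, hG, hk⟩ := h
  refine ⟨Finite.of_equiv V e.toEquiv, e.isTree_iff.1 hG, ?_⟩
  rwa [values_iso, values_iso]

lemma values_zero_eq_empty_iff {V : Type u} {G : SimpleGraph V} (v v' : V) :
    values G v 0 = ∅ ↔ values G v' 0 = ∅ := by
  have : ∀ v, values G v 0 = ∅ ↔ ¬ ∃ t, Attains G v 0 t := fun v => by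
    simp [Set.eq_empty_iff_forall_notMem, mem_values]
  rw [this, this, exists_attains_zero_iff v v']

lemma IsKind.bad_of_bad {V : Type u} {G : SimpleGraph V} {v : V} (h : IsKind .bad G v) (v' : V) :
    IsKind .bad G v' :=
  ⟨h.1, h.2.1, (values_zero_eq_empty_iff v v').1 h.2.2⟩

lemma isKind_bad_iff {V : Type u} [Fintype V] {G : SimpleGraph V} {v : V} :
    IsKind .bad G v ↔ IsBadTree G := by
  simp only [IsKind, HasKind, IsBadTree, hasZeroOneProperty_iff v, true_and,
    Set.eq_empty_iff_forall_notMem, mem_values, not_exists, Finite.of_fintype]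

/-- The evenness of the bipartition sets is automatic: an odd one would, after the increase, provide
a proper weighting by `hasParityValues`. -/
lemma isKind_minus_iff {V : Type u} [Fintype V] {G : SimpleGraph V} {v : V} :
    IsKind .minus G v ↔ IsMinusTree G v := by
  have h1 : values G v 1 = ∅ ↔ ¬ ∃ w, IsProperIncreased G v w := by
    rw [exists_isProperIncreased_iff, Set.eq_empty_iff_forall_notMem, not_exists]
    rfl
  simp only [IsKind, HasKind, IsMinusTree, h1, Finite.of_fintype, true_and]
  refine and_congr_right fun hG => ⟨fun h => ⟨?_, h⟩, fun h => h.2⟩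
  obtain ⟨X, -, hX, hX'⟩ := hasParityValues G v hG
  have := hX' 1 le_rfl
  rw [h1.2 h] at this
  simp only [Nat.even_add_one, Set.mem_empty_iff_false, false_and, exists_false, imp_false,
    not_not] at this
  exact ⟨X, hX, this⟩

/-- The definition only gives inclusions in singletons. For odd order the parity values make both
sets nonempty; for even order one of the sets has both parities and is no singleton. -/
lemma isTwoValueTree_iff {V : Type u} [Fintype V] {G : SimpleGraph V} {v : V} {a b : ℕ} :
    IsTwoValueTree a b G v ↔ G.IsTree ∧ values G v 0 = {a} ∧ values G v 1 = {b} := by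
  have h0 : (∀ w, IsProper G w → weightedDegree G w v = a) ↔ values G v 0 ⊆ {a} := by
    simp only [Set.subset_def, mem_values, attains_zero_iff, Set.mem_singleton_iff]
    constructor
    · rintro h _ ⟨w, hw, rfl⟩
      exact h w hw
    · exact fun h w hw => h _ ⟨w, hw, rfl⟩
  have h1 : (∀ w, IsProperIncreased G v w → increasedDegree G v w v = b) ↔
      values G v 1 ⊆ {b} := by
    simp only [Set.subset_def, mem_values, attains_one_iff, Set.mem_singleton_iff]
    constructor
    · rintro h _ ⟨w, hw, rfl⟩
      exact h w hw
    · exact fun h w hw => h _ ⟨w, hw, rfl⟩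
  rw [IsTwoValueTree, h0, h1]
  refine and_congr_right fun hG => ?_
  obtain ⟨X, -, -, hX⟩ := hasParityValues G v hG
  have hcard : X.ncard + Xᶜ.ncard = Fintype.card V := by
    rw [Set.ncard_add_ncard_compl, Nat.card_eq_fintype_card]
  have k0 := hX 0 (by omega)
  have k1 := hX 1 (by omega)
  simp only [add_zero, Nat.even_add_one, Nat.not_even_iff_odd] at k0 k1
  constructor
  · rintro ⟨hodd, hA, hB⟩
    rw [Set.subset_singleton_iff_eq] at hA hB
    rw [← hcard] at hodd
    rcases Nat.even_or_odd X.ncard with hX | hX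
    · have hY : Odd Xᶜ.ncard := (Nat.odd_add'.1 hodd).2 hX
      obtain ⟨x, hx, -⟩ := k0.1 hX
      obtain ⟨y, hy, -⟩ := k1.2 hY
      exact ⟨hA.resolve_left (Set.nonempty_iff_ne_empty.1 ⟨x, hx⟩),
        hB.resolve_left (Set.nonempty_iff_ne_empty.1 ⟨y, hy⟩)⟩
    · have hY : Even Xᶜ.ncard := (Nat.odd_add.1 hodd).1 hX
      obtain ⟨x, hx, -⟩ := k0.2 hY
      obtain ⟨y, hy, -⟩ := k1.1 hX
      exact ⟨hA.resolve_left (Set.nonempty_iff_ne_empty.1 ⟨x, hx⟩),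
        hB.resolve_left (Set.nonempty_iff_ne_empty.1 ⟨y, hy⟩)⟩
  · rintro ⟨hA, hB⟩
    refine ⟨?_, hA.le, hB.le⟩
    rw [← hcard]
    rcases Nat.even_or_odd X.ncard with hX | hX <;> rcases Nat.even_or_odd Xᶜ.ncard with hY | hY
    · exact absurd hA (Spread.ne_singleton ⟨k0.2 hY, k0.1 hX⟩ _)
    · exact hX.add_odd hY
    · exact hX.add_even hY
    · exact absurd hB (Spread.ne_singleton ⟨k1.2 hY, k1.1 hX⟩ _)

lemma isKind_plusOne_iff {V : Type u} [Fintype V] {G : SimpleGraph V} {v : V} {s : ℕ} :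
    IsKind (.plusOne s) G v ↔ IsTwoValueTree s (s + 1) G v := by
  simp only [IsKind, HasKind, isTwoValueTree_iff, Finite.of_fintype, true_and]

lemma isKind_plusThree_iff {V : Type u} [Fintype V] {G : SimpleGraph V} {v : V} {s : ℕ} :
    IsKind (.plusThree s) G v ↔ IsTwoValueTree s (s + 3) G v := by
  simp only [IsKind, HasKind, isTwoValueTree_iff, Finite.of_fintype, true_and]

end RootedTrees

/-! ### Bridges to a graph on two vertices -/

section Bridge

variable {V W : Type u}

@[simp] lemma bridge_adj_inl_inl {G : SimpleGraph V} {v : V} {K : SimpleGraph W} {k : W}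
    {x y : V} : (bridge G v K k).Adj (Sum.inl x) (Sum.inl y) ↔ G.Adj x y := by
  simp [bridge, SimpleGraph.edge_adj]

@[simp] lemma bridge_adj_inr_inr {G : SimpleGraph V} {v : V} {K : SimpleGraph W} {k : W}
    {x y : W} : (bridge G v K k).Adj (Sum.inr x) (Sum.inr y) ↔ K.Adj x y := by
  simp [bridge, SimpleGraph.edge_adj]

@[simp] lemma bridge_adj_inl_inr {G : SimpleGraph V} {v : V} {K : SimpleGraph W} {k : W}
    {x : V} {y : W} : (bridge G v K k).Adj (Sum.inl x) (Sum.inr y) ↔ x = v ∧ y = k := by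
  simp [bridge, SimpleGraph.edge_adj]

@[simp] lemma bridge_adj_inr_inl {G : SimpleGraph V} {v : V} {K : SimpleGraph W} {k : W}
    {x : V} {y : W} : (bridge G v K k).Adj (Sum.inr y) (Sum.inl x) ↔ x = v ∧ y = k := by
  rw [SimpleGraph.adj_comm, bridge_adj_inl_inr]

/-- Applied to a subgraph in place of `G`, this says that a connecting edge of weight 1 is felt on
the side of `v` as the increase by 1. -/
lemma ncard_neighborSet_bridge_inl [Finite V] (G : SimpleGraph V) (v : V) (K : SimpleGraph W)
    (k : W) (x : V) :
    ((bridge G v K k).neighborSet (Sum.inl x)).ncard = shiftedDegree G v 1 x := by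
  unfold shiftedDegree
  rw [← Set.ncard_image_of_injective _ (Sum.inl_injective (α := V) (β := W))]
  split_ifs with h
  · subst h
    rw [← Set.ncard_insert_of_notMem (a := Sum.inr k) (by simp) (Set.toFinite _)]
    congr 1
    ext (y | y) <;> simp
  · rw [add_zero]
    congr 1
    ext (y | y) <;> simp [h]

lemma ncard_neighborSet_bridge_inr [Finite W] (G : SimpleGraph V) (v : V) (K : SimpleGraph W)
    (k y : W) :
    ((bridge G v K k).neighborSet (Sum.inr y)).ncard = shiftedDegree K k 1 y := by
  unfold shiftedDegree
  rw [← Set.ncard_image_of_injective _ (Sum.inr_injective (α := V) (β := W))]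
  split_ifs with h
  · subst h
    rw [← Set.ncard_insert_of_notMem (a := Sum.inl v) (by simp) (Set.toFinite _)]
    congr 1
    ext (y | y) <;> simp
  · rw [add_zero]
    congr 1
    ext (y | y) <;> simp [h]

lemma bridge_isTree {G : SimpleGraph V} (hG : G.IsTree) {K : SimpleGraph W} (hK : K.IsTree)
    (v : V) (k : W) : (bridge G v K k).IsTree := by
  constructor
  · have key : ∀ a, (bridge G v K k).Reachable (Sum.inl v) a := by
      rintro (x | y)
      · exact reachable_map_of_adj (H := bridge G v K k) Sum.inl
          (fun x y h => SimpleGraph.Adj.reachable (bridge_adj_inl_inl.2 h))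
          (hG.connected.preconnected v x)
      · refine (SimpleGraph.Adj.reachable (bridge_adj_inl_inr.2 ⟨rfl, rfl⟩)).trans
          (reachable_map_of_adj (H := bridge G v K k) Sum.inr
          (fun x y h => SimpleGraph.Adj.reachable (bridge_adj_inr_inr.2 h))
          (hK.connected.preconnected k y))
    have : Nonempty (V ⊕ W) := ⟨Sum.inl v⟩
    exact ⟨fun a b => (key a).symm.trans (key b)⟩
  · apply isAcyclic_of_retractions
    have hnew : ∃ f : V ⊕ W → ULift.{u} Bool, f (Sum.inl v) ≠ f (Sum.inr k) ∧
        ∀ a b, (bridge G v K k).Adj a b → f a = f b ∨ s(a, b) = s(Sum.inl v, Sum.inr k) := by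
      refine ⟨Sum.elim (fun _ => ⟨false⟩) (fun _ => ⟨true⟩), by simp, ?_⟩
      rintro (a | a) (b | b) hab
      · exact Or.inl rfl
      · obtain ⟨rfl, rfl⟩ := bridge_adj_inl_inr.1 hab
        exact Or.inr rfl
      · obtain ⟨rfl, rfl⟩ := bridge_adj_inr_inl.1 hab
        exact Or.inr Sym2.eq_swap
      · exact Or.inl rfl
    obtain ⟨f, hf, hf'⟩ := hnew
    rintro (x | x) (y | y) hxy
    · refine ⟨V, G, Sum.elim id fun _ => v, hG.isAcyclic, bridge_adj_inl_inl.1 hxy, ?_⟩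
      rintro (a | a) (b | b) hab
      · refine Or.inr ⟨bridge_adj_inl_inl.1 hab, fun h => ?_⟩
        exact congrArg (Sym2.map Sum.inl) h
      · exact Or.inl (bridge_adj_inl_inr.1 hab).1
      · exact Or.inl (bridge_adj_inr_inl.1 hab).1.symm
      · exact Or.inl rfl
    · obtain ⟨rfl, rfl⟩ := bridge_adj_inl_inr.1 hxy
      refine ⟨_, ⊤, f, isAcyclic_top_bool, hf, fun a b hab => ?_⟩
      by_cases he : f a = f b
      · exact Or.inl he
      · exact Or.inr ⟨he, fun _ => (hf' a b hab).resolve_left he⟩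
    · obtain ⟨rfl, rfl⟩ := bridge_adj_inr_inl.1 hxy
      refine ⟨_, ⊤, f, isAcyclic_top_bool, hf.symm, fun a b hab => ?_⟩
      by_cases he : f a = f b
      · exact Or.inl he
      · refine Or.inr ⟨he, fun _ => ?_⟩
        rw [(hf' a b hab).resolve_left he, Sym2.eq_swap]
    · refine ⟨W, K, Sum.elim (fun _ => k) id, hK.isAcyclic, bridge_adj_inr_inr.1 hxy, ?_⟩
      rintro (a | a) (b | b) hab
      · exact Or.inl rfl
      · exact Or.inl (bridge_adj_inl_inr.1 hab).2.symm
      · exact Or.inl (bridge_adj_inr_inl.1 hab).2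
      · refine Or.inr ⟨bridge_adj_inr_inr.1 hab, fun h => ?_⟩
        exact congrArg (Sym2.map Sum.inr) h

lemma isTree_of_bridge_isTree {G : SimpleGraph V} {K : SimpleGraph W} {v : V} {k : W}
    (h : (bridge G v K k).IsTree) : G.IsTree := by
  constructor
  · have : Nonempty V := ⟨v⟩
    refine ⟨fun x y => ?_⟩
    refine reachable_map_of_adj (Sum.elim id fun _ => v) ?_
      (h.connected.preconnected (Sum.inl x) (Sum.inl y))
    rintro (a | a) (b | b) hab
    · exact (bridge_adj_inl_inl.1 hab).reachable
    · rw [(bridge_adj_inl_inr.1 hab).1]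
      exact .rfl
    · rw [(bridge_adj_inr_inl.1 hab).1]
      exact .rfl
    · exact .rfl
  · exact h.isAcyclic.comap ⟨Sum.inl, fun h => bridge_adj_inl_inl.2 h⟩ Sum.inl_injective

lemma exists_eq_or_eq_of_card_two (h : Nat.card W = 2) (k : W) :
    ∃ k', k' ≠ k ∧ ∀ y, y = k ∨ y = k' := by
  obtain ⟨k', hk'⟩ := (Nat.card_eq_two_iff' k).1 h
  refine ⟨k', hk'.1, fun y => ?_⟩
  by_cases hy : y = k
  · exact Or.inl hy
  · exact Or.inr (hk'.2 y hy)

lemma ncard_neighborSet_of_two {k k' : W} (h : ∀ y, y = k ∨ y = k')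
    (E : SimpleGraph W) [Decidable (E.Adj k k')] :
    (E.neighborSet k).ncard = if E.Adj k k' then 1 else 0 := by
  split_ifs with hE
  · have : E.neighborSet k = {k'} := by
      ext y
      rcases h y with rfl | rfl
      · simp [hE.ne]
      · simp [hE]
    rw [this, Set.ncard_singleton]
  · have : E.neighborSet k = ∅ := by
      ext y
      rcases h y with rfl | rfl
      · simp
      · simp [hE]
    rw [this, Set.ncard_empty]

lemma ncard_neighborSet_eq_of_two {k k' : W} (h : ∀ y, y = k ∨ y = k') (E : SimpleGraph W) :
    (E.neighborSet k).ncard = (E.neighborSet k').ncard := by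
  classical
  rw [ncard_neighborSet_of_two h, ncard_neighborSet_of_two fun y => (h y).symm]
  simp only [E.adj_comm]

lemma IsK2.isTree {K : SimpleGraph W} (h : IsK2 K) : K.IsTree := by
  have hfin : Finite W := Nat.finite_of_card_ne_zero (by rw [h.1]; decide)
  have : Nonempty W := by
    rw [← Finite.card_pos_iff, h.1]
    decide
  refine ⟨?_, SimpleGraph.IsAcyclic.of_card_le_two ?_⟩
  · rw [h.2]
    exact SimpleGraph.connected_top
  · rw [ENat.card_eq_coe_natCard, h.1]
    rfl

lemma IsK2.isKind_bad {K : SimpleGraph W} (h : IsK2 K) (k : W) : IsKind .bad K k := by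
  refine ⟨Nat.finite_of_card_ne_zero (by rw [h.1]; decide), h.isTree, ?_⟩
  refine Set.eq_empty_iff_forall_notMem.2 ?_
  rintro t ⟨E, -, hE, -⟩
  obtain ⟨k', hk', hW⟩ := exists_eq_or_eq_of_card_two h.1 k
  refine hE k k' (by rw [h.2]; exact hk'.symm) ?_
  rw [shiftedDegree_zero, shiftedDegree_zero, ncard_neighborSet_eq_of_two hW]

/-- A rooted tree has no proper weighting with increased root if and only if attaching a pendant
path with two edges makes it bad. -/
lemma isKind_minus_iff_bridge {G : SimpleGraph V} {v : V} {K : SimpleGraph W} (hK : IsK2 K)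
    (k : W) (x : V ⊕ W) : IsKind .minus G v ↔ IsKind .bad (bridge G v K k) x := by
  classical
  have hW : Finite W := Nat.finite_of_card_ne_zero (by rw [hK.1]; decide)
  obtain ⟨k', hk', hall⟩ := exists_eq_or_eq_of_card_two hK.1 k
  have hadj : K.Adj k k' := by rw [hK.2]; exact hk'.symm
  constructor
  · rintro ⟨hV, hG, h⟩
    refine ⟨inferInstance, bridge_isTree hG hK.isTree v k, ?_⟩
    refine Set.eq_empty_iff_forall_notMem.2 ?_
    rintro t ⟨E, hE, hp, -⟩
    simp only [shiftedDegree_zero] at hp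
    -- Weight 1 on the connecting edge would leave a weighting of `G` that is proper with increased
    -- `v`; weight 0 leaves the two ends of `K` with equal degrees.
    by_cases he : E.Adj (Sum.inl v) (Sum.inr k)
    · have heq : E = bridge (E.comap Sum.inl) v (E.comap Sum.inr) k := by
        ext (a | a) (b | b)
        · simp
        · rw [bridge_adj_inl_inr]
          exact ⟨fun h => bridge_adj_inl_inr.1 (hE h), by rintro ⟨rfl, rfl⟩; exact he⟩
        · rw [bridge_adj_inr_inl]
          exact ⟨fun h => bridge_adj_inr_inl.1 (hE h), by rintro ⟨rfl, rfl⟩; exact he.symm⟩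
        · simp
      refine Set.eq_empty_iff_forall_notMem.1 h _ ⟨E.comap Sum.inl, fun a b hab =>
        bridge_adj_inl_inl.1 (hE hab), fun a b hab => ?_, rfl⟩
      have := hp (Sum.inl a) (Sum.inl b) (bridge_adj_inl_inl.2 hab)
      rw [heq, ncard_neighborSet_bridge_inl, ncard_neighborSet_bridge_inl] at this
      exact this
    · have himg : ∀ y, (E.neighborSet (Sum.inr y)).ncard =
          ((E.comap Sum.inr).neighborSet y).ncard := by
        intro y
        rw [← Set.ncard_image_of_injective _ (Sum.inr_injective (α := V) (β := W))]
        congr 1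
        ext (b | b)
        · simp only [SimpleGraph.mem_neighborSet, Set.mem_image, reduceCtorEq, and_false,
            exists_false, iff_false]
          intro hb
          obtain ⟨rfl, rfl⟩ := bridge_adj_inr_inl.1 (hE hb)
          exact he hb.symm
        · simp
      refine hp (Sum.inr k) (Sum.inr k') (bridge_adj_inr_inr.2 hadj) ?_
      rw [himg, himg]
      exact ncard_neighborSet_eq_of_two hall _
  · rintro ⟨hfin, hT, h⟩
    have hV : Finite V := Finite.of_injective (Sum.inl : V → V ⊕ W) Sum.inl_injective
    refine ⟨hV, isTree_of_bridge_isTree hT, ?_⟩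
    refine Set.eq_empty_iff_forall_notMem.2 ?_
    rintro t ⟨E, hE, hp, ht⟩
    -- The connecting edge gets weight 1, so `k` has degree 1 or 2 according to the last edge, and
    -- `k'` has one less. The choice avoids the degree `t` of `v`.
    let L : SimpleGraph W := if t = 2 then ⊥ else ⊤
    have hLK : L ≤ K := by rw [hK.2]; exact le_top
    have hdk : ((bridge E v L k).neighborSet (Sum.inr k)).ncard = if t = 2 then 1 else 2 := by
      rw [ncard_neighborSet_bridge_inr, shiftedDegree_self, ncard_neighborSet_of_two hall]
      simp only [L]
      split_ifs <;> simp_all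
    have hdk' : ((bridge E v L k).neighborSet (Sum.inr k')).ncard = if t = 2 then 0 else 1 := by
      rw [ncard_neighborSet_bridge_inr, shiftedDegree_ne _ _ hk',
        ncard_neighborSet_of_two fun y => (hall y).symm]
      simp only [L]
      split_ifs <;> simp_all
    refine Set.eq_empty_iff_forall_notMem.1 h _ ⟨bridge E v L k, ?_, ?_, rfl⟩
    · rintro (a | a) (b | b) hab
      · simpa using hE (bridge_adj_inl_inl.1 hab)
      · simpa using hab
      · simpa using hab
      · simpa using hLK (bridge_adj_inr_inr.1 hab)
    · simp only [shiftedDegree_zero]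
      rintro (a | a) (b | b) hab
      · rw [ncard_neighborSet_bridge_inl, ncard_neighborSet_bridge_inl]
        exact hp a b (bridge_adj_inl_inl.1 hab)
      · obtain ⟨rfl, rfl⟩ := bridge_adj_inl_inr.1 hab
        rw [hdk, ncard_neighborSet_bridge_inl, ht]
        split_ifs <;> omega
      · obtain ⟨rfl, rfl⟩ := bridge_adj_inr_inl.1 hab
        rw [hdk, ncard_neighborSet_bridge_inl, ht]
        split_ifs <;> omega
      · have hab' := (bridge_adj_inr_inr.1 hab).ne
        rcases hall a with rfl | rfl <;> rcases hall b with rfl | rfl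
        · exact absurd rfl hab'
        · rw [hdk, hdk']
          split_ifs <;> omega
        · rw [hdk, hdk']
          split_ifs <;> omega
        · exact absurd rfl hab'

end Bridge

/-! ### Gluing along pendant edges -/

section Gluing

variable {V₁ V₂ V : Type u} {G₁ : SimpleGraph V₁} {a₁ b₁ : V₁} {G₂ : SimpleGraph V₂} {a₂ b₂ : V₂}
  {G : SimpleGraph V}

lemma neighborSet_eq_singleton {a b : V} (hab : G.Adj a b) (h : (G.neighborSet a).ncard = 1) :
    ∀ y, G.Adj a y → y = b := by
  obtain ⟨c, hc⟩ := Set.ncard_eq_one.1 h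
  have hb : b ∈ G.neighborSet a := hab
  intro y hy
  have hy : y ∈ G.neighborSet a := hy
  rw [hc] at hb hy
  exact hy.trans hb.symm

/-- The two parts share only the glued edge, and its end `a` has no neighbour but `b`; so one can
leave a part only through `b`. -/
lemma gluing_adj {f₁ : G₁ ↪g G} {f₂ : G₂ ↪g G} (ha : f₁ a₁ = f₂ a₂) (hb : f₁ b₁ = f₂ b₂)
    (hi : Set.range f₁ ∩ Set.range f₂ = {f₁ a₁, f₁ b₁})
    (hadj : ∀ x y, G.Adj x y →
      (x ∈ Set.range f₁ ∧ y ∈ Set.range f₁) ∨ (x ∈ Set.range f₂ ∧ y ∈ Set.range f₂))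
    (h₂ : ∀ y, G₂.Adj a₂ y → y = b₂) {x : V₁} {y : V} (hx : x ≠ b₁) (h : G.Adj (f₁ x) y) :
    y ∈ Set.range f₁ := by
  rcases hadj _ _ h with h' | ⟨h1, h2⟩
  · exact h'.2
  · have hx' : f₁ x ∈ ({f₁ a₁, f₁ b₁} : Set V) := hi ▸ ⟨⟨x, rfl⟩, h1⟩
    rcases hx' with hx' | hx'
    · obtain ⟨z, rfl⟩ := h2
      rw [hx', ha, f₂.map_adj_iff] at h
      rw [h₂ z h, ← hb]
      exact ⟨b₁, rfl⟩
    · exact absurd (f₁.injective hx') hx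

open Classical in
/-- An edge of the first part survives in the retraction of the gluing onto the first part. -/
lemma gluing_retraction {f₁ : G₁ ↪g G} {f₂ : G₂ ↪g G} (ha : f₁ a₁ = f₂ a₂) (hb : f₁ b₁ = f₂ b₂)
    (hi : Set.range f₁ ∩ Set.range f₂ = {f₁ a₁, f₁ b₁})
    (hadj : ∀ x y, G.Adj x y →
      (x ∈ Set.range f₁ ∧ y ∈ Set.range f₁) ∨ (x ∈ Set.range f₂ ∧ y ∈ Set.range f₂))
    (h₂ : ∀ y, G₂.Adj a₂ y → y = b₂) {x y : V} (hx : x ∈ Set.range f₁) (hy : y ∈ Set.range f₁)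
    (hxy : G.Adj x y) :
    ∃ f : V → V₁, G₁.Adj (f x) (f y) ∧ ∀ a b, G.Adj a b → f a = f b ∨
        (G₁.Adj (f a) (f b) ∧ (s(f a, f b) = s(f x, f y) → s(a, b) = s(x, y))) := by
  let f : V → V₁ := fun z => if h : z ∈ Set.range f₁ then h.choose else b₁
  have hf : ∀ z, f (f₁ z) = z := by
    intro z
    have h : f₁ z ∈ Set.range f₁ := ⟨z, rfl⟩
    simp only [f, dif_pos h]
    exact f₁.injective h.choose_spec
  have hf' : ∀ z, z ∉ Set.range f₁ → f z = b₁ := fun z hz => by simp only [f, dif_neg hz]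
  have hout : ∀ z c, G.Adj (f₁ z) c → c ∉ Set.range f₁ → z = b₁ := by
    intro z c hzc hc
    by_contra hz
    exact hc (gluing_adj ha hb hi hadj h₂ hz hzc)
  obtain ⟨x, rfl⟩ := hx
  obtain ⟨y, rfl⟩ := hy
  refine ⟨f, by rw [hf, hf]; exact f₁.map_adj_iff.1 hxy, ?_⟩
  intro c d hcd
  by_cases hc : c ∈ Set.range f₁ <;> by_cases hd : d ∈ Set.range f₁
  · obtain ⟨c, rfl⟩ := hc
    obtain ⟨d, rfl⟩ := hd
    rw [hf, hf, hf, hf]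
    exact Or.inr ⟨f₁.map_adj_iff.1 hcd, fun h => congrArg (Sym2.map f₁) h⟩
  · obtain ⟨c, rfl⟩ := hc
    left
    rw [hf' d hd, hf, hout c d hcd hd]
  · obtain ⟨d, rfl⟩ := hd
    left
    rw [hf' c hc, hf, hout d c hcd.symm hc]
  · left
    rw [hf' c hc, hf' d hd]

lemma IsGluing.isTree (h : IsGluing G₁ a₁ b₁ G₂ a₂ b₂ G) (h₁ : ∀ y, G₁.Adj a₁ y → y = b₁)
    (h₂ : ∀ y, G₂.Adj a₂ y → y = b₂) (hG₁ : G₁.IsTree) (hG₂ : G₂.IsTree) : G.IsTree := by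
  obtain ⟨f₁, f₂, ha, hb, hu, hi, hadj⟩ := h
  have hi' : Set.range f₂ ∩ Set.range f₁ = {f₂ a₂, f₂ b₂} := by
    rw [Set.inter_comm, hi, ha, hb]
  constructor
  · have key : ∀ x, G.Reachable (f₁ b₁) x := by
      intro x
      have hx : x ∈ Set.range f₁ ∪ Set.range f₂ := hu ▸ Set.mem_univ x
      rcases hx with ⟨x, rfl⟩ | ⟨x, rfl⟩
      · exact (hG₁.connected.preconnected b₁ x).map f₁.toHom
      · rw [hb]
        exact (hG₂.connected.preconnected b₂ x).map f₂.toHom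
    have : Nonempty V := ⟨f₁ b₁⟩
    exact ⟨fun x y => (key x).symm.trans (key y)⟩
  · apply isAcyclic_of_retractions
    intro x y hxy
    rcases hadj x y hxy with ⟨hx, hy⟩ | ⟨hx, hy⟩
    · obtain ⟨f, hf⟩ := gluing_retraction ha hb hi hadj h₂ hx hy hxy
      exact ⟨V₁, G₁, f, hG₁.isAcyclic, hf⟩
    · obtain ⟨f, hf⟩ := gluing_retraction ha.symm hb.symm hi' (fun x y h => (hadj x y h).symm)
        h₁ hx hy hxy
      exact ⟨V₂, G₂, f, hG₂.isAcyclic, hf⟩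

/-- `K` with the pair `a, b` made adjacent or not according to `e`. -/
def setEdge (K : SimpleGraph V) (a b : V) (hab : a ≠ b) (e : Prop) : SimpleGraph V where
  Adj x y := (s(x, y) ≠ s(a, b) ∧ K.Adj x y) ∨ (s(x, y) = s(a, b) ∧ e)
  symm := ⟨fun x y h => by rw [Sym2.eq_swap, K.adj_comm]; exact h⟩
  loopless := ⟨fun x h => by
    rcases h with h | h
    · exact K.loopless.irrefl _ h.2
    · rcases Sym2.eq_iff.1 h.1 with ⟨rfl, h'⟩ | ⟨rfl, h'⟩
      · exact hab h'
      · exact hab h'.symm⟩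

lemma exists_third_neighbor {b a : V₁} {f₁ : G₁ ↪g G} {f₂ : G₂ ↪g G} {K : SimpleGraph V}
    (hK : K ≤ G) (hadj : ∀ x y, G.Adj x y →
      (x ∈ Set.range f₁ ∧ y ∈ Set.range f₁) ∨ (x ∈ Set.range f₂ ∧ y ∈ Set.range f₂))
    (ha : f₁ a ∈ Set.range f₂) (h : ¬ K.neighborSet (f₁ b) ⊆ Set.range f₂) :
    ∃ c, K.Adj (f₁ b) (f₁ c) ∧ c ≠ a := by
  obtain ⟨y, hy, hy'⟩ := Set.not_subset.1 h
  rcases hadj _ _ (hK hy) with ⟨-, c, rfl⟩ | h'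
  · refine ⟨c, hy, ?_⟩
    rintro rfl
    exact hy' ha
  · exact absurd h'.2 hy'

open Classical in
-- Let `c` be the other neighbour of `b` in the first part. If `bc` has weight 0, the restriction to
-- the second part is proper. If it has weight 1, the pendant edge can be reweighted so that the
-- restriction to the first part is proper. Either contradicts badness.
lemma IsGluing.not_proper (h : IsGluing G₁ a₁ b₁ G₂ a₂ b₂ G) (hab₁ : G₁.Adj a₁ b₁)
    (h₁ : ∀ y, G₁.Adj a₁ y → y = b₁) (h₂ : ∀ y, G₂.Adj a₂ y → y = b₂)
    (hd : (G₁.neighborSet b₁).ncard = 2)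
    (hbad₁ : values G₁ a₁ 0 = ∅) (hbad₂ : values G₂ a₂ 0 = ∅) (x : V) : values G x 0 = ∅ := by
  obtain ⟨f₁, f₂, ha, hb, hu, hi, hadj⟩ := h
  have hi' : Set.range f₂ ∩ Set.range f₁ = {f₂ a₂, f₂ b₂} := by
    rw [Set.inter_comm, hi, ha, hb]
  refine Set.eq_empty_iff_forall_notMem.2 ?_
  rintro t ⟨K, hK, hp, -⟩
  simp only [shiftedDegree_zero] at hp
  have hd₁ : ∀ x, K.neighborSet (f₁ x) ⊆ Set.range f₁ →
      ((K.comap f₁).neighborSet x).ncard = (K.neighborSet (f₁ x)).ncard := by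
    intro x hx
    rw [← Set.ncard_image_of_injective _ f₁.injective]
    congr 1
    ext y
    constructor
    · rintro ⟨z, hz, rfl⟩
      exact hz
    · intro hy
      obtain ⟨z, rfl⟩ := hx hy
      exact ⟨z, hy, rfl⟩
  have hd₂ : ∀ x, K.neighborSet (f₂ x) ⊆ Set.range f₂ →
      ((K.comap f₂).neighborSet x).ncard = (K.neighborSet (f₂ x)).ncard := by
    intro x hx
    rw [← Set.ncard_image_of_injective _ f₂.injective]
    congr 1
    ext y
    constructor
    · rintro ⟨z, hz, rfl⟩
      exact hz
    · intro hy
      obtain ⟨z, rfl⟩ := hx hy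
      exact ⟨z, hy, rfl⟩
  have hr₁ : ∀ x, x ≠ b₁ → K.neighborSet (f₁ x) ⊆ Set.range f₁ := fun x hx y hy =>
    gluing_adj ha hb hi hadj h₂ hx (hK hy)
  have hr₂ : ∀ x, x ≠ b₂ → K.neighborSet (f₂ x) ⊆ Set.range f₂ := fun x hx y hy =>
    gluing_adj ha.symm hb.symm hi' (fun x y h => (hadj x y h).symm) h₁ hx (hK hy)
  by_cases hb2 : K.neighborSet (f₂ b₂) ⊆ Set.range f₂
  · have hall : ∀ x, ((K.comap f₂).neighborSet x).ncard = (K.neighborSet (f₂ x)).ncard := by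
      intro x
      by_cases hx : x = b₂
      · exact hd₂ x (hx ▸ hb2)
      · exact hd₂ x (hr₂ x hx)
    refine Set.eq_empty_iff_forall_notMem.1 hbad₂ _ ⟨K.comap f₂,
      fun x y h => f₂.map_adj_iff.1 (hK h), fun x y h => ?_, rfl⟩
    rw [shiftedDegree_zero, shiftedDegree_zero, hall, hall]
    exact hp _ _ (f₂.map_adj_iff.2 h)
  rw [← hb] at hb2
  obtain ⟨c, hbc, hca⟩ := exists_third_neighbor hK hadj (a := a₁) ⟨a₂, ha.symm⟩ hb2
  have hG₁bc : G₁.Adj b₁ c := f₁.map_adj_iff.1 (hK hbc)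
  have hnb : ∀ y, G₁.Adj b₁ y → y = a₁ ∨ y = c := by
    have hsub : ({a₁, c} : Set V₁) ⊆ G₁.neighborSet b₁ := by
      rintro y (rfl | rfl)
      · exact hab₁.symm
      · exact hG₁bc
    have heq := Set.eq_of_subset_of_ncard_le hsub (by rw [hd, Set.ncard_pair hca.symm])
      (Set.finite_of_ncard_ne_zero (by rw [hd]; decide))
    intro y hy
    have hy : y ∈ G₁.neighborSet b₁ := hy
    rw [← heq] at hy
    exact hy
  set d := (K.neighborSet (f₁ c)).ncard with hdc
  -- Since `bc` has weight 1, `b` gets degree 1 or 2 and `a` one less; the pendant edge is weighted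
  -- so that `b` differs from the degree `d` of `c`.
  let L := setEdge (K.comap f₁) a₁ b₁ hab₁.ne (d ≠ 2)
  have hLa : (L.neighborSet a₁).ncard = if d = 2 then 0 else 1 := by
    have : L.neighborSet a₁ = if d = 2 then ∅ else {b₁} := by
      ext y
      simp only [L, setEdge, SimpleGraph.mem_neighborSet, SimpleGraph.comap_adj]
      constructor
      · rintro (⟨h, h'⟩ | ⟨h, h'⟩)
        · exact absurd (by rw [h₁ y (f₁.map_adj_iff.1 (hK h'))]) h
        · rw [if_neg h']
          rcases Sym2.eq_iff.1 h with h | h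
          · exact h.2
          · exact absurd h.1 hab₁.ne
      · split_ifs with he
        · exact fun h => h.elim
        · rintro rfl
          exact Or.inr ⟨rfl, he⟩
    rw [this]
    split_ifs <;> simp
  have hLb : (L.neighborSet b₁).ncard = if d = 2 then 1 else 2 := by
    have : L.neighborSet b₁ = if d = 2 then {c} else {a₁, c} := by
      ext y
      simp only [L, setEdge, SimpleGraph.mem_neighborSet, SimpleGraph.comap_adj]
      constructor
      · rintro (⟨h, h'⟩ | ⟨h, h'⟩)
        · rcases hnb y (f₁.map_adj_iff.1 (hK h')) with rfl | rfl
          · exact absurd Sym2.eq_swap h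
          · split_ifs <;> simp
        · rw [if_neg h']
          rcases Sym2.eq_iff.1 h with h | h
          · exact absurd h.1 hab₁.ne'
          · exact Or.inl h.2
      · have hbc' : s(b₁, c) ≠ s(a₁, b₁) := by
          intro h
          rcases Sym2.eq_iff.1 h with h | h
          · exact hab₁.ne' h.1
          · exact hca h.2
        split_ifs with he
        · rintro rfl
          exact Or.inl ⟨hbc', hbc⟩
        · rintro (rfl | rfl)
          · exact Or.inr ⟨Sym2.eq_swap, he⟩
          · exact Or.inl ⟨hbc', hbc⟩
    rw [this]
    split_ifs
    · simp
    · exact Set.ncard_pair hca.symm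
  have hLx : ∀ x, x ≠ a₁ → x ≠ b₁ → (L.neighborSet x).ncard = (K.neighborSet (f₁ x)).ncard := by
    intro x hxa hxb
    rw [← hd₁ x (hr₁ x hxb)]
    congr 1
    ext y
    have hs : s(x, y) ≠ s(a₁, b₁) := by
      intro h
      rcases Sym2.eq_iff.1 h with h | h
      · exact hxa h.1
      · exact hxb h.1
    simp only [L, setEdge, SimpleGraph.mem_neighborSet, SimpleGraph.comap_adj, ne_eq, hs,
      not_false_eq_true, true_and, false_and, or_false]
  have hLb' : ∀ y, G₁.Adj b₁ y → (L.neighborSet b₁).ncard ≠ (L.neighborSet y).ncard := by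
    intro y hy
    rcases hnb y hy with rfl | rfl
    · rw [hLa, hLb]
      split_ifs <;> omega
    · rw [hLb, hLx y hca hy.ne', ← hdc]
      split_ifs <;> omega
  refine Set.eq_empty_iff_forall_notMem.1 hbad₁ _ ⟨L, ?_, fun x y h => ?_, rfl⟩
  · rintro x y (⟨-, h⟩ | ⟨h, -⟩)
    · exact f₁.map_adj_iff.1 (hK h)
    · rcases Sym2.eq_iff.1 h with ⟨rfl, rfl⟩ | ⟨rfl, rfl⟩
      · exact hab₁
      · exact hab₁.symm
  · rw [shiftedDegree_zero, shiftedDegree_zero]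
    by_cases hxb : x = b₁
    · subst hxb
      exact hLb' y h
    by_cases hyb : y = b₁
    · subst hyb
      exact (hLb' x h.symm).symm
    have hxa : x ≠ a₁ := fun e => hyb (h₁ y (e ▸ h))
    have hya : y ≠ a₁ := fun e => hxb (h₁ x (e ▸ h.symm))
    rw [hLx x hxa hxb, hLx y hya hyb]
    exact hp _ _ (f₁.map_adj_iff.2 h)

end Gluing

/-! ### Soundness of the construction -/

section Soundness

/-- All joining rules share the same pair of inequalities, so each soundness case is reduced to
counting kinds and arithmetic. -/
lemma isKind_join {ι : Type u} [Finite ι] {W : ι → Type u} {H : ∀ i, SimpleGraph (W i)}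
    {r : ∀ i, W i} {c : ι → Kind} (h : ∀ i, IsKind (c i) (H i) (r i)) {a b : ℕ}
    (hk : ∀ i, c i = .plusThree a ∨ c i = .plusOne b ∨ c i = .bad ∨ c i = .minus) {k : Kind}
    (hval : ∀ A : ℕ → Set ℕ, (∀ d t, t ∈ A d ↔
      count c .bad + ((if t = b then count c (.plusOne b) else 0) +
        (if t = a then count c (.plusThree a) else 0)) + d ≤ t ∧
      t + ((if t = b + 1 then count c (.plusOne b) else 0) +
        (if t = a + 3 then count c (.plusThree a) else 0)) ≤
        count c (.plusThree a) + count c (.plusOne b) + count c .bad + d) →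
      HasKind k (A 0) (A 1)) :
    IsKind k (join H r) none := by
  have := Fintype.ofFinite ι
  have hfin : ∀ i, Finite (W i) := fun i => (h i).1
  refine ⟨inferInstance, join_isTree fun i => (h i).2.1, hval (values (join H r) none) ?_⟩
  intro d t
  rw [values_join]
  exact mem_joinValues_of_kinds (fun i => balanced_values (h i).2.1 _) (fun i => (h i).2.2) hk

theorem isKind_of_built {k : Kind} {V : Type u} {G : SimpleGraph V} {v : V} (h : Built k G v) :
    IsKind k G v := by
  induction h with
  | iso _ e ih => exact ih.map_iso e
  | K2 h v => exact h.isKind_bad v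
  | @bad_join s hs ι _ W H r i₀ h₀ hK hcard x ih =>
    classical
    have := Fintype.ofFinite ι
    let c : ι → Kind := fun i => if i = i₀ then .plusOne s else .bad
    have hc : ∀ i, IsKind (c i) (H i) (r i) := by
      intro i
      by_cases hi : i = i₀
      · subst hi
        simpa [c] using ih
      · simpa [c, hi] using (hK i hi).isKind_bad (r i)
    have e1 : count c (.plusOne s) = 1 := by
      rw [count_eq_card_filter, Finset.card_eq_one]
      refine ⟨i₀, ?_⟩
      ext i
      simp [c]
    have e2 : count c .bad = s := by
      rw [← hcard]
      unfold count
      simp [c]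
    -- No branch is of this kind; the parameter 0 merely fills the slot in `isKind_join`.
    have e3 : count c (.plusThree 0) = 0 := count_eq_zero fun i => by
      simp only [c]
      split_ifs <;> simp
    refine IsKind.bad_of_bad (v := none) (isKind_join hc (a := 0) (b := s) ?_ ?_) x
    · intro i
      simp only [c]
      split_ifs <;> simp
    · intro A hA
      refine Set.eq_empty_iff_forall_notMem.2 fun t => ?_
      rw [hA, e1, e2, e3]
      split_ifs <;> omega
  | bad_glue h₁ h₂ hab₁ hab₂ ha₁ hb₁ ha₂ hb₂ hG x ih₁ ih₂ =>
    have n₁ := neighborSet_eq_singleton hab₁ ha₁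
    have n₂ := neighborSet_eq_singleton hab₂ ha₂
    have hT := hG.isTree n₁ n₂ ih₁.2.1 ih₂.2.1
    have hv := hG.not_proper hab₁ n₁ n₂ hb₁ (ih₁.bad_of_bad _).2.2 (ih₂.bad_of_bad _).2.2 x
    have hf₁ := ih₁.1
    have hf₂ := ih₂.1
    obtain ⟨f₁, f₂, -, -, hu, -⟩ := hG
    refine ⟨?_, hT, hv⟩
    exact Set.finite_univ_iff.1 (hu ▸ (Set.finite_range f₁).union (Set.finite_range f₂))
  | minus hK h ih => exact (isKind_minus_iff_bridge hK _ _).2 ih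
  | @plusThree s ι _ W H r c h hc h_one h_bad ih =>
    have := Fintype.ofFinite ι
    have e3 : count c (.plusThree 0) = 0 := count_eq_zero fun i => by
      rcases hc i with e | e | e <;> simp [e]
    refine isKind_join ih (a := 0) (b := s + 1) (fun i => Or.inr (hc i)) fun A hA => ⟨?_, ?_⟩ <;>
    · ext t
      rw [hA, h_one, h_bad, e3, Set.mem_singleton_iff]
      split_ifs <;> omega
  | @plusOne s ι _ W H r c h hc h_bad ih =>
    have := Fintype.ofFinite ι
    have e3 : count c (.plusThree 0) = 0 := count_eq_zero fun i => by
      rcases hc i with e | e <;> simp [e]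
    have e1 : count c (.plusOne 0) = 0 := count_eq_zero fun i => by
      rcases hc i with e | e <;> simp [e]
    refine isKind_join ih (a := 0) (b := 0) (fun i => Or.inr (Or.inr (hc i)))
      fun A hA => ⟨?_, ?_⟩ <;>
    · ext t
      rw [hA, e1, h_bad, e3, Set.mem_singleton_iff]
      split_ifs <;> omega
  | @plusOne' s ι _ W H r c h hc h_three h_one h_bad ih =>
    refine isKind_join ih hc fun A hA => ⟨?_, ?_⟩ <;>
    · ext t
      rw [hA, h_one, h_bad, h_three, Set.mem_singleton_iff]
      split_ifs <;> omega

end Soundness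

/-! ### Completeness of the construction -/

section Completeness

variable {V : Type u} {G : SimpleGraph V}

/-- Avoiding `p` or avoiding `r` both mean avoiding the bridge `pr`, so a common vertex would
connect its two ends without it. -/
lemma disjoint_sides (hG : G.IsAcyclic) {p r x : V} (h : G.Adj p r) (hx : x ∈ side G p r)
    (hx' : x ∈ side G r p) : False := by
  have hb := SimpleGraph.isAcyclic_iff_forall_adj_isBridge.1 hG h
  rw [SimpleGraph.isBridge_iff] at hb
  apply hb
  have h1 : avoid G p ≤ G.deleteEdges {s(p, r)} := by
    intro a b hab
    simp only [SimpleGraph.deleteEdges_adj, Set.mem_singleton_iff]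
    refine ⟨hab.1, fun e => ?_⟩
    rcases Sym2.eq_iff.1 e with e | e
    · exact hab.2.1 e.1
    · exact hab.2.2 e.2
  have h2 : avoid G r ≤ G.deleteEdges {s(p, r)} := by
    intro a b hab
    simp only [SimpleGraph.deleteEdges_adj, Set.mem_singleton_iff]
    refine ⟨hab.1, fun e => ?_⟩
    rcases Sym2.eq_iff.1 e with e | e
    · exact hab.2.2 e.2
    · exact hab.2.1 e.1
  exact (SimpleGraph.Reachable.mono h2 hx').trans (SimpleGraph.Reachable.mono h1 hx).symm

/-- A walk from `c` avoiding `r` cannot meet `p`, because `p` lies in a different branch at `r`; so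
it remains on the side of `r` seen from `p`. Counting `r` itself makes the inclusion of the branch
strict. -/
lemma side_subset_side (hG : G.IsAcyclic) {p r c : V} (hp : G.Adj r p) (hc : G.Adj r c)
    (hcp : c ≠ p) : insert r (side G r c) ⊆ side G p r := by
  rintro x (rfl | hx)
  · exact mem_side_self _ _
  · have hne : ∀ z, (avoid G r).Reachable c z → z ≠ p := by
      rintro z hz rfl
      exact hcp (side_unique hG hc hp hz (mem_side_self _ _))
    obtain ⟨w⟩ := SimpleGraph.Reachable.symm hx
    induction w with
    | nil => exact side_step (mem_side_self _ _) hp.ne hcp hc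
    | cons hab w ih =>
      have hb := w.reverse.reachable
      exact side_step (ih hc hcp hb hne) (hne _ hb) (hne _ (hb.trans hab.symm.reachable))
        hab.1.symm

lemma mem_side_cases (hG : G.IsTree) {p r x : V} (h : G.Adj p r) (hx : x ∈ side G p r) :
    x = r ∨ ∃ c, c ≠ p ∧ G.Adj r c ∧ x ∈ side G r c := by
  by_cases hxr : x = r
  · exact Or.inl hxr
  · obtain ⟨c, hc, hxc⟩ := exists_side hG.connected r x hxr
    refine Or.inr ⟨c, ?_, hc, hxc⟩
    rintro rfl
    exact disjoint_sides hG.isAcyclic h hx hxc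

lemma isK2_of_connected (hG : G.Connected) (h : Nat.card V = 2) : IsK2 G := by
  refine ⟨h, eq_top_iff.2 fun x y hxy => ?_⟩
  obtain ⟨c, hc, -⟩ := exists_side hG x y hxy.symm
  obtain ⟨z, hz, hall⟩ := exists_eq_or_eq_of_card_two h x
  have e1 : y = z := (hall y).resolve_left hxy.symm
  have e2 : c = z := (hall c).resolve_left hc.ne'
  rwa [e1, ← e2]

lemma values_of_subsingleton [Subsingleton V] (v : V) (c : ℕ) : values G v c = {c} := by
  have h : ∀ K : SimpleGraph V, shiftedDegree K v c v = c := by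
    intro K
    have : K.neighborSet v = ∅ := by
      ext y
      simp [Subsingleton.elim y v]
    rw [shiftedDegree_self, this, Set.ncard_empty, zero_add]
  ext t
  constructor
  · rintro ⟨K, -, -, ht⟩
    exact ((h K).symm.trans ht).symm
  · rintro rfl
    exact ⟨⊥, bot_le, fun x y hxy => absurd (Subsingleton.elim x y) hxy.ne, h ⊥⟩

lemma card_side_lt [Finite V] {p c : V} (hc : c ≠ p) : Nat.card (side G p c) < Nat.card V :=
  Set.ncard_lt_card (Set.ne_univ_iff_exists_notMem _ |>.2 ⟨p, not_mem_side hc⟩)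

/-- Without any value, both bipartition sets have to be odd, so the order is even and at least 2. -/
lemma four_le_card_of_bad {v : V} (h : IsKind .bad G v) (h2 : Nat.card V ≠ 2) :
    4 ≤ Nat.card V := by
  obtain ⟨hV, hG, h⟩ := h
  obtain ⟨X, -, -, hX⟩ := hasParityValues G v hG
  have := hX 0 (by omega)
  simp only [HasKind] at h
  simp only [h, add_zero, Set.mem_empty_iff_false, false_and, exists_false, imp_false,
    Nat.not_even_iff_odd, Nat.odd_iff] at this
  have hc := Set.ncard_add_ncard_compl X
  omega

/-- Seen from a leaf, its neighbour has all other vertices on its side, so a side with at least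
three vertices exists. A smallest one has only tiny branches below `r`. -/
lemma exists_minimal_side [Finite V] (hG : G.IsTree) (h4 : 4 ≤ Nat.card V) :
    ∃ p r, G.Adj p r ∧ 3 ≤ (side G p r).ncard ∧
      ∀ p' r', G.Adj p' r' → 3 ≤ (side G p' r').ncard →
        (side G p r).ncard ≤ (side G p' r').ncard := by
  classical
  have := Fintype.ofFinite V
  have hex : ∃ m, ∃ p r, G.Adj p r ∧ 3 ≤ (side G p r).ncard ∧ (side G p r).ncard = m := by
    have : Nontrivial V := by
      rw [← Finite.one_lt_card_iff_nontrivial]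
      omega
    obtain ⟨p, hp⟩ := hG.exists_vert_degree_one_of_nontrivial
    obtain ⟨r, hr, hr'⟩ := SimpleGraph.degree_eq_one_iff_existsUnique_adj.1 hp
    have hsub : insert p (side G p r) = Set.univ := by
      refine Set.eq_univ_iff_forall.2 fun x => ?_
      by_cases hx : x = p
      · exact Or.inl hx
      · obtain ⟨c, hc, hxc⟩ := exists_side hG.connected p x hx
        exact Or.inr (hr' c hc ▸ hxc)
    have hcard := Set.ncard_insert_le p (side G p r)
    rw [hsub, Set.ncard_univ] at hcard
    exact ⟨_, p, r, hr, by omega, rfl⟩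
  obtain ⟨p, r, hpr, h3, hm⟩ := Nat.find_spec hex
  exact ⟨p, r, hpr, h3, fun p' r' h h' => hm ▸ Nat.find_min' hex ⟨p', r', h, h', rfl⟩⟩

/-- A bad tree with at least four vertices is obtained from a smaller rooted tree and copies of
`K₂` by adding a vertex. -/
lemma exists_bad_join {v : V} (h : IsKind .bad G v) (h4 : 4 ≤ Nat.card V) :
    ∃ (r : V) (i₀ : G.neighborSet r) (s : ℕ), 1 ≤ s ∧
      IsKind (.plusOne s) (sideGraph G r i₀) (sideRoot G r i₀) ∧
      (∀ i, i ≠ i₀ → IsK2 (sideGraph G r i)) ∧ Nat.card {i // i ≠ i₀} = s ∧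
      Nat.card (side G r i₀.1) + 3 ≤ Nat.card V := by
  classical
  have hV := h.1
  have hG := h.2.1
  obtain ⟨p, r, hpr, h3, hmin⟩ := exists_minimal_side hG h4
  let i₀ : G.neighborSet r := ⟨p, hpr.symm⟩
  have := Fintype.ofFinite (G.neighborSet r)
  -- Together with `r` such a branch fits into the chosen side, so it is smaller, and minimality
  -- leaves it fewer than three vertices.
  have hsmall : ∀ i, i ≠ i₀ → Nat.card (side G r i.1) = 1 ∨ Nat.card (side G r i.1) = 2 := by
    rintro ⟨c, hc⟩ hi
    have hcp : c ≠ p := fun e => hi (Subtype.ext e)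
    have h1 := Set.ncard_le_ncard (side_subset_side hG.isAcyclic hpr.symm hc hcp)
    rw [Set.ncard_insert_of_notMem (not_mem_side (SimpleGraph.Adj.ne' hc))] at h1
    have h2 := mt (hmin r c hc)
    have h5 : 0 < (side G r c).ncard := (Set.ncard_pos).2 ⟨c, mem_side_self _ _⟩
    change (side G r c).ncard = 1 ∨ (side G r c).ncard = 2
    omega
  let A : G.neighborSet r → Set ℕ := fun i => values (sideGraph G r i) (sideRoot G r i) 0
  let B : G.neighborSet r → Set ℕ := fun i => values (sideGraph G r i) (sideRoot G r i) 1
  have htree : ∀ i, (sideGraph G r i).IsTree := fun i => side_induce_isTree hG.isAcyclic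
  have hbal : ∀ i, Balanced (A i) (B i) := fun i => balanced_values (htree i) _
  have hempty : joinValues A B 0 = ∅ := by
    rw [← values_join, ← values_iso (sideIso hG r)]
    exact (h.bad_of_bad _).2.2
  have hcl := classify_empty hbal hempty
  have hone : ∀ i, Nat.card (side G r i.1) = 1 → A i = {0} ∧ B i = {1} := by
    intro i hi
    have : Subsingleton (side G r i.1) := (Nat.card_eq_one_iff_unique.1 hi).1
    exact ⟨values_of_subsingleton _ _, values_of_subsingleton _ _⟩
  have hK2 : ∀ i, Nat.card (side G r i.1) = 2 → IsK2 (sideGraph G r i) := fun i hi =>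
    isK2_of_connected (htree i).connected hi
  have hA2 : ∀ i, Nat.card (side G r i.1) = 2 → A i = ∅ := fun i hi =>
    ((hK2 i hi).isKind_bad _).2.2
  -- A one-vertex branch has `A = {0}` and `B = {1}`. In the first shape this gives `numEmpty A =
  -- 0`, so no branch away from `p` is K_2, and the count leaves only `p` and this leaf at `r`:
  -- fewer than three vertices on the chosen side. The second shape requires elements of `B` that
  -- are at least 2.
  have hnoleaf : ∀ j, j ≠ i₀ → Nat.card (side G r j.1) ≠ 1 := by
    intro j hj hj1
    obtain ⟨hAj, hBj⟩ := hone j hj1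
    rcases hcl with ⟨hN, hcl⟩ | ⟨hN, hcl⟩
    · have hs : numEmpty A = 0 := by
        rcases hcl j with e | e | e
        · simp [e] at hAj
        · exact absurd (e.symm.trans hBj).symm (Set.singleton_ne_empty _)
        · exact Set.singleton_injective (e.1.symm.trans hAj)
      have hleaf : ∀ i, i ≠ i₀ → Nat.card (side G r i.1) = 1 := by
        intro i hi
        refine (hsmall i hi).resolve_right fun h2 => ?_
        rw [numEmpty, Finset.card_eq_zero] at hs
        have : i ∈ Finset.univ.filter fun i => A i = ∅ := by simpa using hA2 i h2
        simp [hs] at this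
      have hm : numEmpty B ≤ 1 := by
        rw [numEmpty]
        refine (Finset.card_le_card (t := {i₀}) fun i hi => ?_).trans (by simp)
        rw [Finset.mem_singleton]
        by_contra hne
        have := (hone i (hleaf i hne)).2
        rw [(Finset.mem_filter.1 hi).2] at this
        exact Set.singleton_ne_empty _ this.symm
      have huniv : ∀ i, i = i₀ ∨ i = j := by
        intro i
        by_contra hi
        push Not at hi
        have : ({i₀, j, i} : Finset (G.neighborSet r)).card ≤ Fintype.card (G.neighborSet r) :=
          Finset.card_le_univ _
        rw [Finset.card_eq_three.2 ⟨i₀, j, i, hj.symm, hi.1.symm, hi.2.symm, rfl⟩] at this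
        omega
      have hsub : side G p r ⊆ insert r (side G r j.1) := by
        intro x hx
        rcases mem_side_cases hG hpr hx with rfl | ⟨c, hcp, hc, hxc⟩
        · exact Or.inl rfl
        · rcases huniv ⟨c, hc⟩ with e | e
          · exact absurd (congrArg Subtype.val e) hcp
          · rw [← e]
            exact Or.inr hxc
      have h5 := Set.ncard_le_ncard hsub
      have h6 := Set.ncard_insert_le r (side G r j.1)
      have h7 : (side G r j.1).ncard = 1 := hj1
      omega
    · rcases hcl j with e | e | e | e
      · simp [e] at hAj
      · exact absurd (e.symm.trans hBj).symm (Set.singleton_ne_empty _)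
      · have := Set.singleton_injective (e.symm.trans hBj)
        omega
      · have := Set.singleton_injective (e.symm.trans hBj)
        omega
  have htwo : ∀ i, i ≠ i₀ → Nat.card (side G r i.1) = 2 := fun i hi =>
    (hsmall i hi).resolve_left (hnoleaf i hi)
  have hcard : Nat.card {i // i ≠ i₀} = Fintype.card (G.neighborSet r) - 1 := by
    rw [Nat.card_eq_fintype_card, Fintype.card_subtype, Finset.filter_ne',
      Finset.card_erase_of_mem (Finset.mem_univ _), Finset.card_univ]
  have hpos : 0 < Fintype.card (G.neighborSet r) := Fintype.card_pos_iff.2 ⟨i₀⟩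
  have hle : Fintype.card (G.neighborSet r) - 1 ≤ numEmpty A := by
    rw [← Finset.card_univ, ← Finset.card_erase_of_mem (Finset.mem_univ i₀), numEmpty]
    refine Finset.card_le_card fun i hi => ?_
    simpa using hA2 i (htwo i (Finset.ne_of_mem_erase hi))
  have hcl : Fintype.card (G.neighborSet r) = numEmpty A + numEmpty B + 1 ∧
      (A i₀ = ∅ ∨ B i₀ = ∅ ∨ (A i₀ = {numEmpty A} ∧ B i₀ = {numEmpty A + 1})) := by
    -- All branches except `i₀` are K_2 and have empty `A`, so three exceptional branches cannot
    -- exist.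
    rcases hcl with ⟨h1, h2⟩ | ⟨h1, -⟩
    · exact ⟨h1, h2 i₀⟩
    · omega
  have hA0 : A i₀ ≠ ∅ := by
    intro h0
    have : numEmpty A = Fintype.card (G.neighborSet r) := by
      rw [numEmpty, Finset.filter_true_of_mem, Finset.card_univ]
      intro i _
      by_cases hi : i = i₀
      · rw [hi, h0]
      · exact hA2 i (htwo i hi)
    omega
  have hB0 : B i₀ ≠ ∅ := by
    intro h0
    have : 0 < numEmpty B := Finset.card_pos.2 ⟨i₀, by simpa using h0⟩
    omega
  -- The side at `r` takes away at least three vertices; this drop pays for the constant 4 in the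
  -- measure of `plusOne`.
  have hfar : (side G r p).ncard + (side G p r).ncard ≤ Nat.card V := by
    rw [← Set.ncard_union_eq, ← Set.ncard_univ]
    · exact Set.ncard_le_ncard (Set.subset_univ _)
    · exact Set.disjoint_left.2 fun x hx hx' => disjoint_sides hG.isAcyclic hpr hx' hx
  refine ⟨r, i₀, numEmpty A, ?_, ⟨inferInstance, htree i₀, ?_⟩, fun i hi => hK2 i (htwo i hi),
    by omega, ?_⟩
  · by_contra hs
    have : Fintype.card (G.neighborSet r) = 1 := by omega
    have huniv : ∀ i, i = i₀ := fun i => (Fintype.card_eq_one_iff.1 this).elim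
      fun x hx => (hx i).trans (hx i₀).symm
    have hsub : side G p r ⊆ {r} := by
      intro x hx
      rcases mem_side_cases hG hpr hx with rfl | ⟨c, hcp, hc, hxc⟩
      · rfl
      · exact absurd (congrArg Subtype.val (huniv ⟨c, hc⟩)) hcp
    have h5 := Set.ncard_le_ncard hsub
    rw [Set.ncard_singleton] at h5
    omega
  · exact (hcl.2.resolve_left hA0).resolve_left hB0
  · change (side G r p).ncard + 3 ≤ _
    omega

/-- The measure for the recursion: a tree of kind `minus` is recognised through a bad tree with two
more vertices. -/
def Kind.measure : Kind → ℕ → ℕ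
  | .bad, n => 2 * n
  | .minus, n => 2 * n + 5
  | .plusOne _, n => 2 * n + 4
  | .plusThree _, n => 2 * n + 4

lemma Kind.measure_lt (k : Kind) {m n : ℕ} (h : m < n) : k.measure m < 2 * n + 4 := by
  cases k <;> simp only [Kind.measure] <;> omega

/-- Classification of the branches of a tree with one value, with and without the increase. -/
lemma exists_branch_kinds [Finite V] (hG : G.IsTree) (v : V) [Fintype (G.neighborSet v)]
    {t₀ t₁ : ℕ} (h0 : values G v 0 = {t₀}) (h1 : values G v 1 = {t₁}) :
    ∃ c : G.neighborSet v → Kind, (∀ i, IsKind (c i) (sideGraph G v i) (sideRoot G v i)) ∧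
      ∃ s, count c .bad = s ∧
      (((∀ i, c i = .bad ∨ c i = .minus) ∧ t₀ = s ∧ t₁ = s + 1) ∨
      ((∀ i, c i = .plusThree s ∨ c i = .plusOne (s + 1) ∨ c i = .bad ∨ c i = .minus) ∧
        count c (.plusThree s) = 1 ∧ count c (.plusOne (s + 1)) = 1 ∧
        t₀ = s + 1 ∧ t₁ = s + 2) ∨
      ((∀ i, c i = .plusOne (s + 1) ∨ c i = .bad ∨ c i = .minus) ∧
        count c (.plusOne (s + 1)) = 2 ∧ t₀ = s ∧ t₁ = s + 3)) := by
  have htree : ∀ i, (sideGraph G v i).IsTree := fun i => side_induce_isTree hG.isAcyclic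
  rw [← sideIso_none hG v, values_iso, values_join] at h0 h1
  obtain ⟨c, hc, h⟩ := classify_singles (fun i => balanced_values (htree i) _) h0 h1
  exact ⟨c, fun i => ⟨inferInstance, htree i, hc i⟩, h⟩

/-- A bad tree of order `n` calls for one of kind `plusOne` with order at most `n - 3`; kind `minus`
calls for a bad tree of order `n + 2`; the other two kinds call for proper branches of any kind. The
measure decreases in each case. -/
theorem built_of_isKind {k : Kind} {V : Type u} {G : SimpleGraph V} {v : V}
    (h : IsKind k G v) : Built k G v := by
  induction hn : k.measure (Nat.card V) using Nat.strong_induction_on generalizing k V with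
  | _ n ih =>
  have hV := h.1
  have hG := h.2.1
  have hbranch : 2 * Nat.card V + 4 ≤ n → ∀ c : G.neighborSet v → Kind,
      (∀ i, IsKind (c i) (sideGraph G v i) (sideRoot G v i)) →
      ∀ i, Built (c i) (sideGraph G v i) (sideRoot G v i) := by
    intro hle c hc i
    refine ih _ ?_ (hc i) rfl
    have := (c i).measure_lt (card_side_lt (G := G) (p := v) i.2.ne')
    omega
  have hback : ∀ k, Built k (join (sideGraph G v) (sideRoot G v)) none → Built k G v := by
    intro k h
    simpa using Built.iso h (sideIso hG v)
  have := Fintype.ofFinite (G.neighborSet v)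
  cases k with
  | bad =>
    by_cases h2 : Nat.card V = 2
    · exact .K2 (isK2_of_connected hG.connected h2) v
    · obtain ⟨r, i₀, s, hs, h₀, hK, hcard, hlt⟩ :=
        exists_bad_join h (four_le_card_of_bad h h2)
      have hb : Built .bad (join (sideGraph G r) (sideRoot G r)) ((sideIso hG r).symm v) := by
        refine Built.bad_join hs _ _ i₀ (ih _ ?_ h₀ rfl) hK hcard _
        simp only [Kind.measure] at hn ⊢
        omega
      simpa using Built.iso hb (sideIso hG r)
  | minus =>
    have hK : IsK2 (⊤ : SimpleGraph (ULift.{u} Bool)) := ⟨by simp, rfl⟩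
    refine Built.minus (x := Sum.inl v) (k := ⟨true⟩) hK
      (ih _ ?_ ((isKind_minus_iff_bridge hK _ _).1 h) rfl)
    rw [← hn]
    simp only [Kind.measure, Nat.card_sum, hK.1]
    omega
  | plusOne t =>
    obtain ⟨c, hc, s, hbad, hcase⟩ := exists_branch_kinds hG v h.2.2.1 h.2.2.2
    have hb := hbranch hn.le c hc
    rcases hcase with ⟨hk, e, -⟩ | ⟨hk, hk3, hk1, e, -⟩ | ⟨-, -, e, e'⟩
    · rw [e]
      exact hback _ (Built.plusOne _ _ c hb hk hbad)
    · rw [e]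
      exact hback _ (Built.plusOne' _ _ c hb hk hk3 hk1 hbad)
    · omega
  | plusThree t =>
    obtain ⟨c, hc, s, hbad, hcase⟩ := exists_branch_kinds hG v h.2.2.1 h.2.2.2
    have hb := hbranch hn.le c hc
    rcases hcase with ⟨-, e, e'⟩ | ⟨-, -, -, e, e'⟩ | ⟨hk, hk1, e, -⟩
    · omega
    · omega
    · rw [e]
      exact hback _ (Built.plusThree _ _ c hb hk hk1 hbad)

theorem built_iff_isKind {k : Kind} {V : Type u} {G : SimpleGraph V} {v : V} :
    Built k G v ↔ IsKind k G v :=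
  ⟨isKind_of_built, built_of_isKind⟩

theorem inB_iff_isBadTree {V : Type u} [Fintype V] {G : SimpleGraph V} :
    InB G ↔ IsBadTree G := by
  constructor
  · rintro ⟨v, hv⟩
    exact isKind_bad_iff.1 (isKind_of_built hv)
  · intro h
    obtain ⟨v⟩ := h.1.connected.nonempty
    exact ⟨v, built_of_isKind (isKind_bad_iff.2 h)⟩

end Completeness

/-! ### Eliminating the leaves of a graph -/

section Elimination

variable {V : Type u} {G : SimpleGraph V}

open Classical in
/-- Removing a leaf. -/
lemma isTree_iff_of_leaf {V' : Type u} {G' : SimpleGraph V'} (f : G' ↪g G) {v : V} {p : V'}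
    (hrange : ∀ x, x ∈ Set.range f ↔ x ≠ v) (hv : ∀ y, G.Adj v y ↔ y = f p) :
    G.IsTree ↔ G'.IsTree := by
  let g : V → V' := fun z => if h : z ∈ Set.range f then h.choose else p
  have hg : ∀ z, g (f z) = z := by
    intro z
    have h : f z ∈ Set.range f := ⟨z, rfl⟩
    simp only [g, dif_pos h]
    exact f.injective h.choose_spec
  have hgv : g v = p := by
    have : v ∉ Set.range f := fun h => (hrange v).1 h rfl
    simp only [g, dif_neg this]
  have hcases : ∀ x, x = v ∨ ∃ z, x = f z := by
    intro x
    by_cases hx : x = v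
    · exact Or.inl hx
    · obtain ⟨z, hz⟩ := (hrange x).2 hx
      exact Or.inr ⟨z, hz.symm⟩
  constructor
  · intro hG
    refine ⟨?_, hG.isAcyclic.comap f.toHom f.injective⟩
    have : Nonempty V' := ⟨p⟩
    refine ⟨fun x y => ?_⟩
    have := reachable_map_of_adj (H := G') g ?_ (hG.connected.preconnected (f x) (f y))
    · rwa [hg, hg] at this
    · intro a b hab
      rcases hcases a with rfl | ⟨a, rfl⟩
      · rw [(hv b).1 hab, hg, hgv]
      · rcases hcases b with rfl | ⟨b, rfl⟩
        · rw [(hv _).1 hab.symm, hg, hgv]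
        · rw [hg, hg]
          exact (f.map_adj_iff.1 hab).reachable
  · intro hG'
    constructor
    · have key : ∀ x, G.Reachable (f p) x := by
        intro x
        rcases hcases x with rfl | ⟨x, rfl⟩
        · exact ((hv _).2 rfl).symm.reachable
        · exact (hG'.connected.preconnected p x).map f.toHom
      have : Nonempty V := ⟨v⟩
      exact ⟨fun x y => (key x).symm.trans (key y)⟩
    · apply isAcyclic_of_retractions
      have hnew : ∃ h : V → ULift.{u} Bool, h v ≠ h (f p) ∧
          ∀ a b, G.Adj a b → h a = h b ∨ s(a, b) = s(v, f p) := by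
        have hne : ∀ z, f z ≠ v := fun z => (hrange _).1 ⟨z, rfl⟩
        refine ⟨fun z => ⟨decide (z = v)⟩, by simp [hne p], ?_⟩
        intro a b hab
        rcases hcases a with rfl | ⟨a, rfl⟩
        · rw [(hv b).1 hab]
          exact Or.inr rfl
        · rcases hcases b with rfl | ⟨b, rfl⟩
          · rw [(hv _).1 hab.symm]
            exact Or.inr Sym2.eq_swap
          · left
            simp [hne a, hne b]
      obtain ⟨h, hh, hh'⟩ := hnew
      intro x y hxy
      rcases hcases x with rfl | ⟨x, rfl⟩
      · rw [(hv y).1 hxy]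
        refine ⟨_, ⊤, h, isAcyclic_top_bool, hh, fun a b hab => ?_⟩
        by_cases he : h a = h b
        · exact Or.inl he
        · exact Or.inr ⟨he, fun _ => (hh' a b hab).resolve_left he⟩
      rcases hcases y with rfl | ⟨y, rfl⟩
      · rw [(hv _).1 hxy.symm]
        refine ⟨_, ⊤, h, isAcyclic_top_bool, hh.symm, fun a b hab => ?_⟩
        by_cases he : h a = h b
        · exact Or.inl he
        · refine Or.inr ⟨he, fun _ => ?_⟩
          rw [(hh' a b hab).resolve_left he, Sym2.eq_swap]
      refine ⟨V', G', g, hG'.isAcyclic, by rw [hg, hg]; exact f.map_adj_iff.1 hxy, ?_⟩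
      intro a b hab
      rcases hcases a with rfl | ⟨a, rfl⟩
      · left
        rw [(hv b).1 hab, hg, hgv]
      · rcases hcases b with rfl | ⟨b, rfl⟩
        · left
          rw [(hv _).1 hab.symm, hg, hgv]
        · rw [hg, hg, hg, hg]
          exact Or.inr ⟨f.map_adj_iff.1 hab, fun e => congrArg (Sym2.map f) e⟩

lemma induce_isTree_iff_of_leaf {S : Set V} {v q : V} (hv : v ∈ S) (hq : q ∈ S)
    (hvq : G.Adj v q) (huniq : ∀ y ∈ S, G.Adj v y → y = q) :
    (G.induce S).IsTree ↔ (G.induce (S \ {v})).IsTree := by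
  refine isTree_iff_of_leaf (SimpleGraph.induceHomOfLE G (Set.sdiff_subset (t := {v})))
    (v := ⟨v, hv⟩) (p := ⟨q, hq, hvq.ne'⟩) ?_ ?_
  · rintro ⟨x, hx⟩
    constructor
    · rintro ⟨⟨y, hy⟩, h⟩ e
      have h1 : y = x := congrArg Subtype.val h
      have h2 : x = v := congrArg Subtype.val e
      exact hy.2 (h1.trans h2)
    · intro h
      exact ⟨⟨x, hx, fun e => h (Subtype.ext e)⟩, rfl⟩
  · rintro ⟨y, hy⟩
    constructor
    · intro h
      exact Subtype.ext (huniq y hy h)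
    · intro h
      have : y = q := congrArg Subtype.val h
      subst this
      exact hvq

/-- A tree with at least two vertices has a leaf. The hypothesis holds vacuously at an isolated
vertex, so the one-vertex tree remains possible. -/
lemma not_induce_isTree_of_no_leaf [Finite V] {S : Set V} (h : ∀ v ∈ S, ∀ q ∈ S, G.Adj v q →
    ∃ y ∈ S, G.Adj v y ∧ y ≠ q) : (G.induce S).IsTree ↔ S.ncard = 1 := by
  classical
  constructor
  · intro hT
    obtain ⟨⟨x, hx⟩⟩ := hT.connected.nonempty
    by_contra hne
    have hnt : Nontrivial S := by
      rw [← Finite.one_lt_card_iff_nontrivial, Nat.card_coe_set_eq]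
      have := (Set.ncard_pos (s := S)).2 ⟨x, hx⟩
      omega
    have := Fintype.ofFinite S
    obtain ⟨v, hv⟩ := hT.exists_vert_degree_one_of_nontrivial
    obtain ⟨q, hq, hq'⟩ := SimpleGraph.degree_eq_one_iff_existsUnique_adj.1 hv
    obtain ⟨y, hy, hvy, hne⟩ := h v.1 v.2 q.1 q.2 hq
    exact hne (congrArg Subtype.val (hq' ⟨y, hy⟩ hvy))
  · intro h1
    obtain ⟨x, rfl⟩ := Set.ncard_eq_one.1 h1
    exact SimpleGraph.IsTree.of_subsingleton

/-- A proper weighting of the subgraph induced by `S` exists if each vertex `x` can receive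
contributions from eliminated branches: `D x t c` says that the contribution `c` is possible when
the weighted degree of `x` is `t`. -/
def Solvable (G : SimpleGraph V) (S : Set V) (D : V → ℕ → ℕ → Prop) : Prop :=
  ∃ K ≤ G, ∃ d : V → ℕ, (∀ x ∈ S, ∀ y ∈ S, G.Adj x y → d x ≠ d y) ∧
    ∀ x ∈ S, ∃ c, D x (d x) c ∧ c + (K.neighborSet x ∩ S).ncard = d x

/-- Degrees are smaller than the order, so restricting to `t < Fintype.card V` costs nothing and
tables with `n` columns suffice. -/
lemma solvable_univ_iff [Fintype V] :
    Solvable G Set.univ (fun _ t c => t < Fintype.card V ∧ c = 0) ↔ HasZeroOneProperty G := by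
  have h1 : HasZeroOneProperty G ↔ ∃ K ≤ G, ∀ x y, G.Adj x y →
      (K.neighborSet x).ncard ≠ (K.neighborSet y).ncard := by
    constructor
    · rintro ⟨w, hw, h⟩
      simp only [weightedDegree_eq_ncard hw] at h
      exact ⟨_, oneGraph_le G w, h⟩
    · rintro ⟨K, hK, h⟩
      have hw := isZeroOneWeighting_indicatorWeight G K
      refine ⟨indicatorWeight K, hw, ?_⟩
      simp only [weightedDegree_eq_ncard hw, oneGraph_indicatorWeight hK]
      exact h
  rw [h1]
  constructor
  · rintro ⟨K, hK, d, hd, h⟩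
    have : ∀ x, (K.neighborSet x).ncard = d x := by
      intro x
      obtain ⟨c, ⟨-, rfl⟩, hc⟩ := h x (Set.mem_univ x)
      rwa [zero_add, Set.inter_univ] at hc
    refine ⟨K, hK, fun x y hxy => ?_⟩
    rw [this, this]
    exact hd x (Set.mem_univ x) y (Set.mem_univ y) hxy
  · rintro ⟨K, hK, h⟩
    refine ⟨K, hK, fun x => (K.neighborSet x).ncard, fun x _ y _ => h x y, fun x _ => ?_⟩
    refine ⟨0, ⟨?_, rfl⟩, by rw [zero_add, Set.inter_univ]⟩
    rw [← Nat.card_eq_fintype_card]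
    exact Set.ncard_lt_card (Set.ne_univ_iff_exists_notMem _ |>.2 ⟨x, K.loopless.irrefl x⟩)

lemma solvable_singleton_iff {D : V → ℕ → ℕ → Prop} (v : V) :
    Solvable G {v} D ↔ ∃ t, D v t t := by
  have h0 : ∀ K : SimpleGraph V, K.neighborSet v ∩ {v} = ∅ := by
    intro K
    ext y
    simp only [Set.mem_inter_iff, SimpleGraph.mem_neighborSet, Set.mem_singleton_iff,
      Set.mem_empty_iff_false, iff_false]
    rintro ⟨h, rfl⟩
    exact K.loopless.irrefl _ h
  constructor
  · rintro ⟨K, -, d, -, h⟩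
    obtain ⟨c, hc, hd⟩ := h v rfl
    rw [h0, Set.ncard_empty, add_zero] at hd
    exact ⟨c, by rwa [← hd] at hc⟩
  · rintro ⟨t, ht⟩
    refine ⟨⊥, bot_le, fun _ => t, ?_, ?_⟩
    · rintro x rfl y rfl h
      exact absurd h (G.loopless.irrefl _)
    · rintro x rfl
      exact ⟨t, ht, by rw [h0, Set.ncard_empty, add_zero]⟩

open Classical in
lemma ncard_neighborSet_inter_of_leaf [Finite V] {S : Set V} {v q : V} (hv : v ∈ S) (hq : q ∈ S)
    (hvq : G.Adj v q) (huniq : ∀ y ∈ S, G.Adj v y → y = q) {K : SimpleGraph V} (hK : K ≤ G) :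
    (K.neighborSet v ∩ S).ncard = (if K.Adj v q then 1 else 0) ∧
    (K.neighborSet q ∩ S).ncard = (K.neighborSet q ∩ (S \ {v})).ncard +
      (if K.Adj v q then 1 else 0) ∧
    ∀ x ∈ S, x ≠ q → (K.neighborSet x ∩ (S \ {v})).ncard = (K.neighborSet x ∩ S).ncard := by
  refine ⟨?_, ?_, fun x hx hxq => ?_⟩
  · split_ifs with h
    · rw [Set.ncard_eq_one]
      refine ⟨q, ?_⟩
      ext y
      constructor
      · rintro ⟨h1, h2⟩
        exact huniq y h2 (hK h1)
      · rintro rfl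
        exact ⟨h, hq⟩
    · rw [Set.ncard_eq_zero]
      ext y
      simp only [Set.mem_inter_iff, SimpleGraph.mem_neighborSet, Set.mem_empty_iff_false, iff_false]
      rintro ⟨h1, h2⟩
      exact h (huniq y h2 (hK h1) ▸ h1)
  · rw [← Set.inter_sdiff_assoc]
    split_ifs with h
    · exact (Set.ncard_sdiff_singleton_add_one (show v ∈ K.neighborSet q ∩ S from ⟨h.symm, hv⟩) (Set.toFinite _)).symm
    · rw [add_zero, Set.sdiff_singleton_eq_self]
      exact fun h' => h (SimpleGraph.Adj.symm h'.1)
  · congr 1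
    rw [← Set.inter_sdiff_assoc, Set.sdiff_singleton_eq_self]
    exact fun h' => hxq (huniq x hx (hK h'.1).symm)

/-- The leaf `v` interacts with the rest only through the weight `e` of `vq` and the requirement
that its degree differ from that of `q`. For given degree `t` of `q`, both are absorbed into the
contributions at `q`. -/
lemma solvable_iff_of_leaf [Finite V] {S : Set V} {v q : V} (hv : v ∈ S) (hq : q ∈ S)
    (hvq : G.Adj v q) (huniq : ∀ y ∈ S, G.Adj v y → y = q) {D D' : V → ℕ → ℕ → Prop}
    (hD : ∀ x ∈ S, x ≠ v → x ≠ q → ∀ t c, D' x t c ↔ D x t c)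
    (hDq : ∀ t c, D' q t c ↔ ∃ e ≤ 1, ∃ c₀, D q t c₀ ∧ c = c₀ + e ∧
      ∃ t', t' ≠ t ∧ ∃ c₁, D v t' c₁ ∧ c₁ + e = t') :
    Solvable G S D ↔ Solvable G (S \ {v}) D' := by
  classical
  constructor
  · rintro ⟨K, hK, d, hd, h⟩
    obtain ⟨h1, h2, h3⟩ := ncard_neighborSet_inter_of_leaf hv hq hvq huniq hK
    refine ⟨K, hK, d, fun x hx y hy => hd x hx.1 y hy.1, ?_⟩
    rintro x ⟨hx, hxv⟩
    by_cases hxq : x = q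
    · subst hxq
      obtain ⟨c₀, hc₀, hdx⟩ := h x hx
      obtain ⟨c₁, hc₁, hdv⟩ := h v hv
      refine ⟨c₀ + if K.Adj v x then 1 else 0, (hDq _ _).2
        ⟨_, ?_, c₀, hc₀, rfl, d v, hd v hv x hx hvq, c₁, hc₁, ?_⟩, ?_⟩
      · split_ifs <;> omega
      · rw [← hdv, h1]
      · rw [← hdx, h2]
        omega
    · obtain ⟨c, hc, hdx⟩ := h x hx
      exact ⟨c, (hD x hx hxv hxq _ _).2 hc, by rw [h3 x hx hxq, hdx]⟩
  · rintro ⟨K, hK, d, hd, h⟩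
    obtain ⟨c, hc, hdq⟩ := h q ⟨hq, hvq.ne'⟩
    obtain ⟨e, he, c₀, hc₀, rfl, t', ht', c₁, hc₁, hct⟩ := (hDq _ _).1 hc
    -- The smaller problem does not see the edge `vq`, so its weight may be reset to the `e` hidden
    -- in the contribution at `q`.
    set L := setEdge K v q hvq.ne (e = 1) with hL
    have hLG : L ≤ G := by
      rintro x y (⟨-, h⟩ | ⟨h, -⟩)
      · exact hK h
      · rcases Sym2.eq_iff.1 h with ⟨rfl, rfl⟩ | ⟨rfl, rfl⟩
        · exact hvq
        · exact hvq.symm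
    have hLvq : (if L.Adj v q then 1 else 0) = e := by
      have : L.Adj v q ↔ e = 1 := by simp [hL, setEdge]
      rw [if_congr this rfl rfl]
      split_ifs <;> omega
    have hLK : ∀ x, x ≠ v → L.neighborSet x ∩ (S \ {v}) = K.neighborSet x ∩ (S \ {v}) := by
      intro x hx
      ext y
      simp only [Set.mem_inter_iff, and_congr_left_iff, SimpleGraph.mem_neighborSet]
      rintro ⟨-, hy⟩
      have hs : s(x, y) ≠ s(v, q) := by
        intro h
        rcases Sym2.eq_iff.1 h with h | h
        · exact hx h.1
        · exact hy h.2
      simp only [hL, setEdge, ne_eq, hs, not_false_eq_true, true_and, false_and, or_false]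
    obtain ⟨h1, h2, h3⟩ := ncard_neighborSet_inter_of_leaf hv hq hvq huniq hLG
    rw [hLvq] at h1 h2
    refine ⟨L, hLG, Function.update d v t', ?_, ?_⟩
    · intro x hx y hy hxy
      by_cases hxv : x = v
      · subst hxv
        obtain rfl := huniq y hy hxy
        rw [Function.update_self, Function.update_of_ne hxy.ne']
        exact ht'
      · by_cases hyv : y = v
        · subst hyv
          obtain rfl := huniq x hx hxy.symm
          rw [Function.update_self, Function.update_of_ne hxy.ne]
          exact ht'.symm
        · rw [Function.update_of_ne hxv, Function.update_of_ne hyv]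
          exact hd x ⟨hx, hxv⟩ y ⟨hy, hyv⟩ hxy
    · intro x hx
      by_cases hxv : x = v
      · subst hxv
        rw [Function.update_self]
        exact ⟨c₁, hc₁, by rw [h1, hct]⟩
      · rw [Function.update_of_ne hxv]
        by_cases hxq : x = q
        · subst hxq
          refine ⟨c₀, hc₀, ?_⟩
          rw [h2, hLK x hxv, ← hdq]
          omega
        · obtain ⟨c, hc, hdx⟩ := h x ⟨hx, hxv⟩
          refine ⟨c, (hD x hx hxv hxq _ _).1 hc, ?_⟩
          rw [← h3 x hx hxq, hLK x hxv, hdx]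

end Elimination

/-! ### Reasoning about the machine -/

section Machine

/-- `P` halts from `σ` within `T` steps in a store that satisfies `Q`. -/
def Reaches (P : Program) (σ : Store) (T : ℕ) (Q : Store → Prop) : Prop :=
  ∃ m τ, Runs P σ m τ ∧ m ≤ T ∧ Q τ

lemma Reaches.mono {P : Program} {σ : Store} {T T' : ℕ} {Q Q' : Store → Prop}
    (h : Reaches P σ T Q) (hT : T ≤ T') (hQ : ∀ τ, Q τ → Q' τ) : Reaches P σ T' Q' := by
  obtain ⟨m, τ, hr, hm, hq⟩ := h
  exact ⟨m, τ, hr, hm.trans hT, hQ τ hq⟩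

lemma Reaches.seq {P P' : Program} {σ : Store} {T T' : ℕ} {Q Q' : Store → Prop}
    (h : Reaches P σ T Q) (h' : ∀ τ, Q τ → Reaches P' τ T' Q') :
    Reaches (.seq P P') σ (T + T') Q' := by
  obtain ⟨m, τ, hr, hm, hq⟩ := h
  obtain ⟨m', τ', hr', hm', hq'⟩ := h' τ hq
  exact ⟨m + m', τ', hr.seq hr', by omega, hq'⟩

lemma Reaches.cond {P P' : Program} {σ : Store} {r T : ℕ} {Q : Store → Prop}
    (h : σ.reg r ≠ 0 → Reaches P σ T Q) (h' : σ.reg r = 0 → Reaches P' σ T Q) :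
    Reaches (.cond r P P') σ (T + 1) Q := by
  by_cases hr : σ.reg r = 0
  · obtain ⟨m, τ, hm, hT, hq⟩ := h' hr
    exact ⟨m + 1, τ, .cond_zero hr hm, by omega, hq⟩
  · obtain ⟨m, τ, hm, hT, hq⟩ := h hr
    exact ⟨m + 1, τ, .cond_pos hr hm, by omega, hq⟩

/-- A program without loops. -/
def Program.LoopFree : Program → Prop
  | .seq P Q => P.LoopFree ∧ Q.LoopFree
  | .cond _ P Q => P.LoopFree ∧ Q.LoopFree
  | .loop _ _ => False
  | _ => True

/-- The result of a loop-free program. -/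
def Program.exec : Program → Store → Store
  | .skip, σ => σ
  | .const r n, σ => σ.setReg r n
  | .add r a b, σ => σ.setReg r (σ.reg a + σ.reg b)
  | .sub r a b, σ => σ.setReg r (σ.reg a - σ.reg b)
  | .load r t a b, σ => σ.setReg r (σ.tab t (σ.reg a) (σ.reg b))
  | .store t a b r, σ => σ.setTab t (σ.reg a) (σ.reg b) (σ.reg r)
  | .seq P Q, σ => Q.exec (P.exec σ)
  | .cond r P Q, σ => if σ.reg r = 0 then Q.exec σ else P.exec σ
  | .loop _ _, σ => σ

/-- A bound for the number of steps of a loop-free program. -/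
def Program.size : Program → ℕ
  | .seq P Q => P.size + Q.size
  | .cond _ P Q => P.size + Q.size + 1
  | _ => 1

lemma Program.LoopFree.reaches {P : Program} (hP : P.LoopFree) (σ : Store) {Q : Store → Prop}
    (h : Q (P.exec σ)) : Reaches P σ P.size Q := by
  induction P generalizing σ Q with
  | skip => exact ⟨1, _, .skip σ, le_rfl, h⟩
  | const r n => exact ⟨1, _, .const r n σ, le_rfl, h⟩
  | add r a b => exact ⟨1, _, .add r a b σ, le_rfl, h⟩
  | sub r a b => exact ⟨1, _, .sub r a b σ, le_rfl, h⟩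
  | load r t a b => exact ⟨1, _, .load r t a b σ, le_rfl, h⟩
  | store t a b r => exact ⟨1, _, .store t a b r σ, le_rfl, h⟩
  | seq P P' ih ih' =>
    exact (ih hP.1 σ (Q := fun τ => τ = P.exec σ) rfl).seq fun τ hτ => ih' hP.2 τ (hτ ▸ h)
  | cond r P P' ih ih' =>
    refine Reaches.cond (fun hr => ?_) fun hr => ?_
    · rw [Program.exec, if_neg hr] at h
      exact (ih hP.1 σ h).mono (Nat.le_add_right _ _) fun _ => id
    · rw [Program.exec, if_pos hr] at h
      exact (ih' hP.2 σ h).mono (Nat.le_add_left _ _) fun _ => id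
  | loop => exact hP.elim

/-- The constants that the program keeps in its registers. -/
def Store.Ready (n : ℕ) (σ : Store) : Prop :=
  σ.reg 0 = n ∧ σ.reg 2 = 1 ∧ σ.reg 3 = 0

/-- Run `P` with register `r` running from `n - 1` down to `0`. -/
def forDown (r : ℕ) (P : Program) : Program :=
  .seq (.add r 0 3) (.loop r (.seq (.sub r r 2) P))

/-- The counter is decremented before the body runs, so `I (k + 1)` describes the store before index
`k` is treated and `I k` the store afterwards. -/
lemma reaches_forDown {n r T : ℕ} {P : Program} {σ : Store} (hσ : σ.Ready n)
    (I : ℕ → Store → Prop) (hI : ∀ k τ, I k τ → τ.Ready n ∧ τ.reg r = k)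
    (init : I n (σ.setReg r n))
    (step : ∀ k < n, ∀ τ, I (k + 1) τ → Reaches P (τ.setReg r k) T (I k)) :
    Reaches (forDown r P) σ (n * (T + 2) + 2) (I 0) := by
  have key : ∀ k ≤ n, ∀ τ, I k τ →
      Reaches (.loop r (.seq (.sub r r 2) P)) τ (k * (T + 2) + 1) (I 0) := by
    intro k
    induction k with
    | zero =>
      intro _ τ hτ
      refine ⟨1, τ, ?_, by omega, hτ⟩
      constructor
      exact (hI _ _ hτ).2
    | succ k ih =>
      intro hk τ hτ
      obtain ⟨h1, h2⟩ := hI _ _ hτ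
      have hs : Runs (.sub r r 2) τ 1 (τ.setReg r k) := by
        have := Runs.sub r r 2 τ
        rwa [h2, h1.2.1, Nat.add_sub_cancel] at this
      obtain ⟨m, τ', hm, hT, hτ'⟩ := step k hk τ hτ
      obtain ⟨m', ρ, hm', hT', hρ⟩ := ih (Nat.le_of_succ_le hk) τ' hτ'
      refine ⟨_, ρ, .loop_step (by omega) (hs.seq hm) hm', ?_, hρ⟩
      rw [Nat.succ_mul]
      omega
  have hs : Runs (.add r 0 3) σ 1 (σ.setReg r n) := by
    have := Runs.add r 0 3 σ
    rwa [hσ.1, hσ.2.2, Nat.add_zero] at this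
  obtain ⟨m, τ, hm, hT, hτ⟩ := key n le_rfl _ init
  exact ⟨_, τ, hs.seq hm, by omega, hτ⟩

end Machine

/-! ### The program that eliminates a leaf -/

section Admits

/-- With contribution 0 (`e = 0`) or 1 (`e = 1`) of the edge to its parent, vertex `x` admits a
weighted degree below `n` other than `t`, according to the tables 2 (least contribution), 3
(greatest contribution) and 4 (excluded degrees). -/
def Admits (n : ℕ) (tab : ℕ → ℕ → ℕ → ℕ) (x e t : ℕ) : Prop :=
  ∃ t' < n, t' ≠ t ∧ tab 4 x t' = 0 ∧ tab 2 x t' + e ≤ t' ∧ t' ≤ tab 3 x t' + e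

/-- Set register `r` to 1 if register 15 lies between registers 18 and 19. -/
def markIfBetween (r : ℕ) : Program :=
  .seq (.sub 20 18 15) (.seq (.sub 21 15 19) (.seq (.add 20 20 21)
    (.cond 20 .skip (.const r 1))))

/-- The tests for the degree in register 15. -/
def admitsBody : Program :=
  .seq (.load 16 4 7 15) (.seq (.sub 17 12 15) (.seq (.sub 18 15 12) (.seq (.add 17 17 18)
    (.cond 16 .skip (.cond 17
      (.seq (.load 18 2 7 15) (.seq (.load 19 3 7 15) (.seq (markIfBetween 13)
        (.seq (.add 18 18 2) (.seq (.add 19 19 2) (markIfBetween 14))))))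
      .skip)))))

/-- Comparisons are made by truncated subtraction: `(a - b) + (b - a)` vanishes only if `a = b`, and
`(l - t) + (t - u)` only if `l ≤ t ≤ u`. -/
lemma reaches_admitsBody {n : ℕ} {σ : Store} (hσ : σ.Ready n) :
    Reaches admitsBody σ admitsBody.size fun τ =>
      (∀ r < 16, r ≠ 13 → r ≠ 14 → τ.reg r = σ.reg r) ∧ τ.tab = σ.tab ∧
      (τ.reg 13 ≠ 0 ↔ σ.reg 13 ≠ 0 ∨ (σ.reg 15 ≠ σ.reg 12 ∧ σ.tab 4 (σ.reg 7) (σ.reg 15) = 0 ∧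
        σ.tab 2 (σ.reg 7) (σ.reg 15) ≤ σ.reg 15 ∧ σ.reg 15 ≤ σ.tab 3 (σ.reg 7) (σ.reg 15))) ∧
      (τ.reg 14 ≠ 0 ↔ σ.reg 14 ≠ 0 ∨ (σ.reg 15 ≠ σ.reg 12 ∧ σ.tab 4 (σ.reg 7) (σ.reg 15) = 0 ∧
        σ.tab 2 (σ.reg 7) (σ.reg 15) + 1 ≤ σ.reg 15 ∧
        σ.reg 15 ≤ σ.tab 3 (σ.reg 7) (σ.reg 15) + 1)) := by
  obtain ⟨-, h2, -⟩ := hσ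
  refine Program.LoopFree.reaches (by simp [admitsBody, markIfBetween, Program.LoopFree]) σ ?_
  simp only [admitsBody, markIfBetween, Program.exec, Store.setReg, apply_ite Store.reg, ite_apply,
    apply_ite Store.tab, ite_self, Function.update_apply, Nat.reduceEqDiff,
    if_true, if_false, h2]
  generalize σ.tab 4 (σ.reg 7) (σ.reg 15) = a
  generalize σ.tab 2 (σ.reg 7) (σ.reg 15) = b
  generalize σ.tab 3 (σ.reg 7) (σ.reg 15) = c
  refine ⟨fun r hr h13 h14 => ?_, ?_, ?_, ?_⟩
  · have hne : ∀ s, 16 ≤ s → r ≠ s := fun s hs => by omega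
    simp [h13, h14, hne]
  · trivial
  all_goals split_ifs <;> omega


/-- Set registers 13 and 14 to the two truth values of `Admits` for the vertex in register 7 and
the degree in register 12. -/
def admitsLoop : Program :=
  .seq (.const 13 0) (.seq (.const 14 0) (forDown 15 admitsBody))

lemma reaches_admitsLoop {n : ℕ} {σ : Store} (hσ : σ.Ready n) :
    Reaches admitsLoop σ (2 + (n * (admitsBody.size + 2) + 2)) fun τ =>
      (∀ r < 13, τ.reg r = σ.reg r) ∧ τ.tab = σ.tab ∧
      (τ.reg 13 ≠ 0 ↔ Admits n σ.tab (σ.reg 7) 0 (σ.reg 12)) ∧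
      (τ.reg 14 ≠ 0 ↔ Admits n σ.tab (σ.reg 7) 1 (σ.reg 12)) := by
  have h0 : Reaches (.const 13 0) σ 1 fun τ =>
      (∀ r < 13, τ.reg r = σ.reg r) ∧ τ.tab = σ.tab ∧ τ.reg 13 = 0 :=
    ⟨1, _, .const _ _ _, le_rfl, fun r hr => by simp [Store.setReg, hr.ne], rfl, rfl⟩
  have h1 : ∀ τ : Store,
      ((∀ r < 13, τ.reg r = σ.reg r) ∧ τ.tab = σ.tab ∧ τ.reg 13 = 0) →
      Reaches (.const 14 0) τ 1 fun τ =>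
        (∀ r < 13, τ.reg r = σ.reg r) ∧ τ.tab = σ.tab ∧ τ.reg 13 = 0 ∧ τ.reg 14 = 0 := by
    rintro τ ⟨h1, h2, h3⟩
    refine ⟨1, _, .const _ _ _, le_rfl, fun r hr => ?_, h2, ?_, rfl⟩
    · have : r ≠ 14 := by omega
      simp [Store.setReg, this, h1 r hr]
    · simpa [Store.setReg] using h3
  rw [show 2 + (n * (admitsBody.size + 2) + 2) = 1 + (1 + (n * (admitsBody.size + 2) + 2)) by omega]
  refine h0.seq fun τ hτ => (h1 τ hτ).seq ?_
  clear h0 h1 hτ τ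
  rintro τ ⟨h1, h2, h3, h4⟩
  have hR : ∀ τ : Store, (∀ r < 13, τ.reg r = σ.reg r) → τ.Ready n := fun τ h =>
    ⟨(h 0 (by omega)).trans hσ.1, (h 2 (by omega)).trans hσ.2.1, (h 3 (by omega)).trans hσ.2.2⟩
  refine (reaches_forDown (hR τ h1) (fun k τ => τ.reg 15 = k ∧ (∀ r < 13, τ.reg r = σ.reg r) ∧
      τ.tab = σ.tab ∧
      (τ.reg 13 ≠ 0 ↔ ∃ t' < n, k ≤ t' ∧ t' ≠ σ.reg 12 ∧ σ.tab 4 (σ.reg 7) t' = 0 ∧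
        σ.tab 2 (σ.reg 7) t' ≤ t' ∧ t' ≤ σ.tab 3 (σ.reg 7) t') ∧
      (τ.reg 14 ≠ 0 ↔ ∃ t' < n, k ≤ t' ∧ t' ≠ σ.reg 12 ∧ σ.tab 4 (σ.reg 7) t' = 0 ∧
        σ.tab 2 (σ.reg 7) t' + 1 ≤ t' ∧ t' ≤ σ.tab 3 (σ.reg 7) t' + 1))
    (fun k τ h => ⟨hR τ h.2.1, h.1⟩) ?_ ?_).mono le_rfl ?_
  · refine ⟨by simp [Store.setReg], fun r hr => ?_, h2, ?_, ?_⟩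
    · have : r ≠ 15 := by omega
      simp [Store.setReg, this, h1 r hr]
    · simp only [Store.setReg, ne_eq, Function.update_apply, Nat.reduceEqDiff, if_false, h3,
        not_true, false_iff]
      rintro ⟨t, h, h', -⟩
      omega
    · simp only [Store.setReg, ne_eq, Function.update_apply, Nat.reduceEqDiff, if_false, h4,
        not_true, false_iff]
      rintro ⟨t, h, h', -⟩
      omega
  · rintro k hk τ ⟨-, h1, h2, h3, h4⟩
    have hs : ∀ r, r ≠ 15 → (τ.setReg 15 k).reg r = τ.reg r := fun r hr => by
      simp [Store.setReg, hr]
    have h15 : (τ.setReg 15 k).reg 15 = k := by simp [Store.setReg]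
    have ht : (τ.setReg 15 k).tab = σ.tab := h2
    have h13 : ∀ r < 13, (τ.setReg 15 k).reg r = σ.reg r := fun r hr =>
      (hs r (by omega)).trans (h1 r hr)
    refine (reaches_admitsBody (hR _ h13)).mono le_rfl ?_
    rintro ρ ⟨a1, a2, a3, a4⟩
    rw [ht] at a2
    rw [h15, ht, h13 7 (by omega), h13 12 (by omega), hs _ (by omega)] at a3 a4
    have split : ∀ p : ℕ → Prop, (∃ t < n, k ≤ t ∧ p t) ↔ (∃ t < n, k + 1 ≤ t ∧ p t) ∨ p k := by
      intro p
      constructor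
      · rintro ⟨t, ht, hkt, hp⟩
        obtain rfl | h := hkt.eq_or_lt
        · exact .inr hp
        · exact .inl ⟨t, ht, h, hp⟩
      · rintro (⟨t, ht, hkt, hp⟩ | hp)
        · exact ⟨t, ht, by omega, hp⟩
        · exact ⟨k, hk, le_rfl, hp⟩
    refine ⟨(a1 15 (by omega) (by omega) (by omega)).trans h15, fun r hr => ?_, a2, ?_, ?_⟩
    · rw [a1 r (by omega) (by omega) (by omega), h13 r hr]
    · rw [a3, h3, ← split]
    · rw [a4, h4, ← split]
  · rintro ρ ⟨-, b1, b2, b3, b4⟩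
    simp only [zero_le, true_and] at b3 b4
    exact ⟨b1, b2, b3, b4⟩

/-- Adjust the bounds for the vertex in register 10 and the degree in register 12 according to
the truth values in registers 13 and 14. -/
def adjustBody : Program :=
  .seq (.load 16 2 10 12) (.seq (.cond 13 .skip (.add 16 16 2)) (.seq (.store 2 10 12 16)
    (.seq (.load 16 3 10 12) (.seq (.cond 14 (.add 16 16 2) .skip) (.seq (.store 3 10 12 16)
    (.seq (.add 16 13 14) (.cond 16 .skip (.store 4 10 12 2))))))))

/-- The entries of the tables `f'` for vertex `q` and degree `t` arise from those of `f` by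
attaching a branch with the admissible contributions `p₀` (for 0) and `p₁` (for 1). -/
def Adjusted (f f' : ℕ → ℕ → ℕ → ℕ) (q t : ℕ) (p₀ p₁ : Prop) : Prop :=
  (p₀ → f' 2 q t = f 2 q t) ∧ (¬ p₀ → f' 2 q t = f 2 q t + 1) ∧
  (p₁ → f' 3 q t = f 3 q t + 1) ∧ (¬ p₁ → f' 3 q t = f 3 q t) ∧
  (p₀ ∨ p₁ → f' 4 q t = f 4 q t) ∧ (¬ p₀ → ¬ p₁ → f' 4 q t = 1)

lemma reaches_adjustBody {n : ℕ} {σ : Store} (hσ : σ.Ready n) :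
    Reaches adjustBody σ adjustBody.size fun τ =>
      (∀ r < 16, τ.reg r = σ.reg r) ∧
      (∀ k i j, k < 2 ∨ i ≠ σ.reg 10 ∨ j ≠ σ.reg 12 → τ.tab k i j = σ.tab k i j) ∧
      Adjusted σ.tab τ.tab (σ.reg 10) (σ.reg 12) (σ.reg 13 ≠ 0) (σ.reg 14 ≠ 0) := by
  obtain ⟨-, h2, -⟩ := hσ
  refine Program.LoopFree.reaches (by simp [adjustBody, Program.LoopFree]) σ ?_
  simp only [Adjusted, adjustBody, Program.exec, Store.setReg, Store.setTab, apply_ite Store.reg,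
    ite_apply, apply_ite Store.tab, ite_self, Function.update_apply, Nat.reduceEqDiff,
    if_true, if_false, h2, and_true, true_and, and_self, false_and]
  refine ⟨fun r hr => ?_, fun k i j h => ?_, ?_⟩
  · have hne : r ≠ 16 := by omega
    simp [hne]
  · have h' : ∀ s, 2 ≤ s → ¬ (k = s ∧ i = σ.reg 10 ∧ j = σ.reg 12) := fun s hs => by omega
    simp [h']
  · refine ⟨?_, ?_, ?_, ?_, ?_, ?_⟩
    all_goals split_ifs <;> omega

/-- Attach the branch at the vertex in register 7 to the vertex in register 10. -/
def adjustLoop : Program :=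
  forDown 12 (.seq admitsLoop adjustBody)

/-- The running time of `adjustLoop`. -/
def adjustCost (n : ℕ) : ℕ :=
  n * (2 + (n * (admitsBody.size + 2) + 2) + adjustBody.size + 2) + 2

lemma reaches_adjustLoop {n : ℕ} {σ : Store} (hσ : σ.Ready n) (hne : σ.reg 7 ≠ σ.reg 10) :
    Reaches adjustLoop σ (adjustCost n) fun τ =>
      (∀ r < 12, τ.reg r = σ.reg r) ∧
      (∀ k i j, k < 2 ∨ i ≠ σ.reg 10 → τ.tab k i j = σ.tab k i j) ∧
      ∀ t < n, Adjusted σ.tab τ.tab (σ.reg 10) t (Admits n σ.tab (σ.reg 7) 0 t)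
        (Admits n σ.tab (σ.reg 7) 1 t) := by
  have hR : ∀ τ : Store, (∀ r < 12, τ.reg r = σ.reg r) → τ.Ready n := fun τ h =>
    ⟨(h 0 (by omega)).trans hσ.1, (h 2 (by omega)).trans hσ.2.1, (h 3 (by omega)).trans hσ.2.2⟩
  refine (reaches_forDown hσ (fun k τ => τ.reg 12 = k ∧ (∀ r < 12, τ.reg r = σ.reg r) ∧
      (∀ l i j, l < 2 ∨ i ≠ σ.reg 10 ∨ j < k → τ.tab l i j = σ.tab l i j) ∧
      ∀ t < n, k ≤ t → Adjusted σ.tab τ.tab (σ.reg 10) t (Admits n σ.tab (σ.reg 7) 0 t)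
        (Admits n σ.tab (σ.reg 7) 1 t))
    (fun k τ h => ⟨hR τ h.2.1, h.1⟩) ?_ ?_).mono le_rfl ?_
  · refine ⟨by simp [Store.setReg], fun r hr => ?_, fun _ _ _ _ => rfl, fun t h h' => by omega⟩
    have : r ≠ 12 := by omega
    simp [Store.setReg, this]
  · rintro k hk τ ⟨-, h1, h2, h3⟩
    have hs : ∀ r < 12, (τ.setReg 12 k).reg r = σ.reg r := fun r hr => by
      have : r ≠ 12 := by omega
      simp [Store.setReg, this, h1 r hr]
    have h12 : (τ.setReg 12 k).reg 12 = k := by simp [Store.setReg]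
    refine (reaches_admitsLoop (hR _ hs)).seq ?_
    rintro ρ ⟨a1, a2, a3, a4⟩
    have hρ : ∀ r < 12, ρ.reg r = σ.reg r := fun r hr => (a1 r (by omega)).trans (hs r hr)
    have ρ12 : ρ.reg 12 = k := (a1 12 (by omega)).trans h12
    have hA : ∀ e, Admits n (τ.setReg 12 k).tab ((τ.setReg 12 k).reg 7) e
        ((τ.setReg 12 k).reg 12) ↔ Admits n σ.tab (σ.reg 7) e k := by
      intro e
      -- Only the row of register 10 is rewritten, so the leaf's row is still the original one; this
      -- needs the two vertices to be distinct.
      rw [h12, hs 7 (by omega)]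
      have : ∀ l t, (τ.setReg 12 k).tab l (σ.reg 7) t = σ.tab l (σ.reg 7) t := fun l t =>
        h2 l _ t (.inr (.inl hne))
      simp only [Admits, this]
    rw [hA] at a3 a4
    refine (reaches_adjustBody (hR _ hρ)).mono le_rfl ?_
    rintro ω ⟨b1, b2, b3⟩
    rw [ρ12, hρ 10 (by omega)] at b2 b3
    have hρt : ∀ l i j, ρ.tab l i j = τ.tab l i j := fun l i j => by rw [a2]; rfl
    refine ⟨(b1 12 (by omega)).trans ρ12, fun r hr => (b1 r (by omega)).trans (hρ r hr), ?_, ?_⟩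
    · intro l i j h
      rw [b2 l i j (by omega), hρt, h2 l i j (by omega)]
    · intro t ht hkt
      obtain rfl | hlt := hkt.eq_or_lt
      · have e : ∀ l, ρ.tab l (σ.reg 10) k = σ.tab l (σ.reg 10) k := fun l => by
          rw [hρt, h2 _ _ _ (.inr (.inr (Nat.lt_succ_self k)))]
        simpa only [Adjusted, e, a3, a4] using b3
      · have e : ∀ l, ω.tab l (σ.reg 10) t = τ.tab l (σ.reg 10) t := fun l => by
          rw [b2 _ _ _ (by omega), hρt]
        simpa only [Adjusted, e] using h3 t ht hlt
  · rintro ρ ⟨-, b1, b2, b3⟩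
    exact ⟨b1, fun l i j h => b2 l i j (by omega), fun t ht => b3 t ht t.zero_le⟩

end Admits

/-! ### The invariant of the elimination -/

section Invariant

/-- The vertices that are not marked as removed in table 1. -/
def alive (n : ℕ) (f : ℕ → ℕ → ℕ → ℕ) : Set (Fin n) :=
  {x | f 1 x 0 = 0}

/-- The contributions that the tables 2, 3 and 4 permit. -/
def allowed (n : ℕ) (f : ℕ → ℕ → ℕ → ℕ) (x : Fin n) (t c : ℕ) : Prop :=
  t < n ∧ f 4 x t = 0 ∧ f 2 x t ≤ c ∧ c ≤ f 3 x t

/-- The invariant of the elimination of leaves. -/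
structure Invariant {n : ℕ} (G : SimpleGraph (Fin n)) (σ : Store) : Prop where
  ready : σ.Ready n
  adj : ∀ x y : Fin n, σ.tab 0 x y ≠ 0 ↔ G.Adj x y
  card : σ.reg 4 = (alive n σ.tab).ncard
  nonempty : 0 < n → (alive n σ.tab).Nonempty
  tree : (G.induce (alive n σ.tab)).IsTree ↔ G.IsTree
  solvable : Solvable G (alive n σ.tab) (allowed n σ.tab) ↔ HasZeroOneProperty G
  le : ∀ (x : Fin n), ∀ t < n, σ.tab 4 x t = 0 → σ.tab 2 x t ≤ σ.tab 3 x t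

variable {n : ℕ} {G : SimpleGraph (Fin n)} {σ τ : Store}

lemma Invariant.congr (h : Invariant G σ) (ht : τ.tab = σ.tab)
    (h0 : τ.reg 0 = σ.reg 0) (h2 : τ.reg 2 = σ.reg 2) (h3 : τ.reg 3 = σ.reg 3)
    (h4 : τ.reg 4 = σ.reg 4) : Invariant G τ where
  ready := ⟨h0.trans h.ready.1, h2.trans h.ready.2.1, h3.trans h.ready.2.2⟩
  adj := ht ▸ h.adj
  card := by rw [h4, ht, h.card]
  nonempty := ht ▸ h.nonempty
  tree := ht ▸ h.tree
  solvable := ht ▸ h.solvable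
  le := ht ▸ h.le

/-- The branch at `v` offers the contribution 0, 1, both or neither. Accordingly the interval at `q`
stays, moves up by one, grows by one at the top, or is excluded; it always remains an interval, so
the tables can express the contributions required by `solvable_iff_of_leaf`. -/
lemma Invariant.remove_leaf (h : Invariant G σ) {v q : Fin n} (hv : v ∈ alive n σ.tab)
    (hq : q ∈ alive n σ.tab) (hvq : G.Adj v q)
    (huniq : ∀ y ∈ alive n σ.tab, G.Adj v y → y = q) (hτ : τ.Ready n)
    (h4 : τ.reg 4 = σ.reg 4 - 1) (h0 : τ.tab 0 = σ.tab 0)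
    (h1 : alive n τ.tab = alive n σ.tab \ {v})
    (hrow : ∀ k i j, 2 ≤ k → i ≠ (q : ℕ) → τ.tab k i j = σ.tab k i j)
    (hadj : ∀ t < n, Adjusted σ.tab τ.tab q t (Admits n σ.tab v 0 t) (Admits n σ.tab v 1 t)) :
    Invariant G τ where
  ready := hτ
  adj := h0 ▸ h.adj
  card := by rw [h4, h.card, h1, Set.ncard_sdiff_singleton_of_mem hv]
  nonempty := fun _ => by
    rw [h1]
    exact ⟨q, hq, hvq.ne'⟩
  tree := by
    rw [h1, ← h.tree]
    exact (induce_isTree_iff_of_leaf hv hq hvq huniq).symm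
  solvable := by
    rw [h1, ← h.solvable]
    refine (solvable_iff_of_leaf hv hq hvq huniq (fun x _ _ hxq t c => ?_) fun t c => ?_).symm
    · have hne : (x : ℕ) ≠ q := fun e => hxq (Fin.ext e)
      simp only [allowed, hrow 2 _ t le_rfl hne, hrow 3 _ t (by omega) hne, hrow 4 _ t (by omega) hne]
    · by_cases ht : t < n
      · obtain ⟨a1, a2, a3, a4, a5, a6⟩ := hadj t ht
        have hA : ∀ e, (∃ t', t' ≠ t ∧ ∃ c₁, allowed n σ.tab v t' c₁ ∧ c₁ + e = t') ↔
            Admits n σ.tab v e t := by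
          intro e
          constructor
          · rintro ⟨t', hne, c₁, ⟨b1, b2, b3, b4⟩, b5⟩
            exact ⟨t', b1, hne, b2, by omega, by omega⟩
          · rintro ⟨t', b1, hne, b2, b3, b4⟩
            exact ⟨t', hne, t' - e, ⟨b1, b2, by omega, by omega⟩, by omega⟩
        simp only [hA]
        have hex : (∃ e ≤ 1, ∃ c₀, allowed n σ.tab q t c₀ ∧ c = c₀ + e ∧ Admits n σ.tab v e t) ↔
            (allowed n σ.tab q t c ∧ Admits n σ.tab v 0 t) ∨
            (∃ c₀, allowed n σ.tab q t c₀ ∧ c = c₀ + 1 ∧ Admits n σ.tab v 1 t) := by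
          constructor
          · rintro ⟨e, he, c₀, b1, b2, b3⟩
            obtain rfl | rfl : e = 0 ∨ e = 1 := by omega
            · exact .inl ⟨by rwa [b2, add_zero], b3⟩
            · exact .inr ⟨c₀, b1, b2, b3⟩
          · rintro (⟨b1, b2⟩ | ⟨c₀, b⟩)
            · exact ⟨0, by omega, c, b1, rfl, b2⟩
            · exact ⟨1, le_rfl, c₀, b⟩
        rw [hex]
        have hle := h.le q t ht
        simp only [allowed]
        generalize Admits n σ.tab v 0 t = p₀ at *
        generalize Admits n σ.tab v 1 t = p₁ at *
        by_cases h₀ : p₀ <;> by_cases h₁ : p₁ <;>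
          simp only [h₀, h₁, or_true, not_true_eq_false, not_false_eq_true, forall_const,
            IsEmpty.forall_iff, and_true, and_false, or_false, false_or, exists_false] at *
        · rw [a1, a3, a5]
          constructor
          · rintro ⟨b1, b2, b3, b4⟩
            -- The only new contribution is one above the old maximum; that the old maximum is
            -- itself permitted is the invariant `le`.
            by_cases hc : c ≤ σ.tab 3 q t
            · exact .inl ⟨b1, b2, b3, hc⟩
            · exact .inr ⟨σ.tab 3 q t, ⟨b1, b2, hle b2, le_rfl⟩, by omega⟩
          · rintro (⟨b1, b2, b3, b4⟩ | ⟨c₀, ⟨b1, b2, b3, b4⟩, b5⟩)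
            · exact ⟨b1, b2, b3, by omega⟩
            · exact ⟨b1, b2, by omega, by omega⟩
        · rw [a1, a4, a5]
        · rw [a2, a3, a5]
          constructor
          · rintro ⟨b1, b2, b3, b4⟩
            exact ⟨c - 1, ⟨b1, b2, by omega, by omega⟩, by omega⟩
          · rintro ⟨c₀, ⟨b1, b2, b3, b4⟩, b5⟩
            exact ⟨b1, b2, by omega, by omega⟩
        · rw [a6]
          simp
      · constructor
        · exact fun b => absurd b.1 ht
        · rintro ⟨e, -, c₀, b, -⟩
          exact absurd b.1 ht
  le := by
    intro x t ht hx
    by_cases hxq : (x : ℕ) = q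
    · obtain ⟨a1, a2, a3, a4, a5, a6⟩ := hadj t ht
      have hle := h.le q t ht
      rw [hxq] at hx ⊢
      by_cases h₀ : Admits n σ.tab v 0 t <;> by_cases h₁ : Admits n σ.tab v 1 t <;>
        simp only [h₀, h₁, or_true, not_true_eq_false, not_false_eq_true, forall_const,
          IsEmpty.forall_iff, or_false] at a1 a2 a3 a4 a5 a6 <;> grind
    · rw [hrow 2 _ _ le_rfl hxq, hrow 3 _ _ (by omega) hxq]
      rw [hrow 4 _ _ (by omega) hxq] at hx
      exact h.le x t ht hx

/-- Register 9 is tested for being a remaining neighbour of the vertex in register 7. -/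
def neighborBody : Program :=
  .seq (.load 11 1 9 3) (.cond 11 .skip (.seq (.load 11 0 7 9)
    (.cond 11 (.seq (.add 8 8 2) (.add 10 9 3)) .skip)))

/-- Count the remaining neighbours of the vertex in register 7 in register 8, and leave one of
them in register 10. -/
def neighborLoop : Program :=
  .seq (.const 8 0) (forDown 9 neighborBody)

lemma reaches_neighborBody (hσ : σ.Ready n) :
    Reaches neighborBody σ neighborBody.size fun τ =>
      (∀ r < 10, r ≠ 8 → τ.reg r = σ.reg r) ∧ τ.tab = σ.tab ∧
      (σ.tab 1 (σ.reg 9) 0 = 0 ∧ σ.tab 0 (σ.reg 7) (σ.reg 9) ≠ 0 →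
        τ.reg 8 = σ.reg 8 + 1 ∧ τ.reg 10 = σ.reg 9) ∧
      (¬ (σ.tab 1 (σ.reg 9) 0 = 0 ∧ σ.tab 0 (σ.reg 7) (σ.reg 9) ≠ 0) →
        τ.reg 8 = σ.reg 8 ∧ τ.reg 10 = σ.reg 10) := by
  obtain ⟨-, h2, h3⟩ := hσ
  refine Program.LoopFree.reaches (by simp [neighborBody, Program.LoopFree]) σ ?_
  simp only [neighborBody, Program.exec, Store.setReg, apply_ite Store.reg, ite_apply,
    apply_ite Store.tab, ite_self, Function.update_apply, Nat.reduceEqDiff,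
    if_true, if_false, h2, h3]
  refine ⟨fun r hr h8 => ?_, trivial, ?_, ?_⟩
  · have hne : ∀ s, 10 ≤ s → r ≠ s := fun s hs => by omega
    simp [h8, hne]
  all_goals split_ifs <;> omega

lemma reaches_neighborLoop (hσ : σ.Ready n) :
    Reaches neighborLoop σ (1 + (n * (neighborBody.size + 2) + 2)) fun τ =>
      (∀ r < 8, τ.reg r = σ.reg r) ∧ τ.tab = σ.tab ∧
      (τ.reg 8 = 0 → ∀ y < n, ¬ (σ.tab 1 y 0 = 0 ∧ σ.tab 0 (σ.reg 7) y ≠ 0)) ∧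
      (τ.reg 8 = 1 → ∃ q < n, τ.reg 10 = q ∧ ∀ y < n,
        (σ.tab 1 y 0 = 0 ∧ σ.tab 0 (σ.reg 7) y ≠ 0) ↔ y = q) ∧
      (2 ≤ τ.reg 8 → ∃ y < n, ∃ y' < n, y ≠ y' ∧
        (σ.tab 1 y 0 = 0 ∧ σ.tab 0 (σ.reg 7) y ≠ 0) ∧
        (σ.tab 1 y' 0 = 0 ∧ σ.tab 0 (σ.reg 7) y' ≠ 0)) := by
  have h0 : Reaches (.const 8 0) σ 1 fun τ =>
      (∀ r < 8, τ.reg r = σ.reg r) ∧ τ.tab = σ.tab ∧ τ.reg 8 = 0 :=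
    ⟨1, _, .const _ _ _, le_rfl, fun r hr => by simp [Store.setReg, hr.ne], rfl, rfl⟩
  refine h0.seq ?_
  clear h0
  rintro τ ⟨h1, h2, h3⟩
  have hR : ∀ τ : Store, (∀ r < 8, τ.reg r = σ.reg r) → τ.Ready n := fun τ h =>
    ⟨(h 0 (by omega)).trans hσ.1, (h 2 (by omega)).trans hσ.2.1, (h 3 (by omega)).trans hσ.2.2⟩
  generalize hp : (fun y => σ.tab 1 y 0 = 0 ∧ σ.tab 0 (σ.reg 7) y ≠ 0) = p
  have hp' : ∀ y, (σ.tab 1 y 0 = 0 ∧ σ.tab 0 (σ.reg 7) y ≠ 0) ↔ p y := fun y => by rw [← hp]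
  simp only [hp']
  refine (reaches_forDown (hR τ h1) (fun k τ => τ.reg 9 = k ∧ (∀ r < 8, τ.reg r = σ.reg r) ∧
      τ.tab = σ.tab ∧
      (τ.reg 8 = 0 → ∀ y < n, k ≤ y → ¬ p y) ∧
      (τ.reg 8 ≠ 0 → ∃ q < n, k ≤ q ∧ τ.reg 10 = q ∧ p q) ∧
      (τ.reg 8 = 1 → ∀ y < n, k ≤ y → p y → y = τ.reg 10) ∧
      (2 ≤ τ.reg 8 → ∃ y < n, ∃ y' < n, y ≠ y' ∧ p y ∧ p y'))
    (fun k τ h => ⟨hR τ h.2.1, h.1⟩) ?_ ?_).mono le_rfl ?_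
  · have h8 : (τ.setReg 9 n).reg 8 = 0 := by simpa [Store.setReg] using h3
    refine ⟨by simp [Store.setReg], fun r hr => ?_, h2, fun _ y _ _ => by omega,
      fun h => absurd h8 h, fun _ y _ _ => by omega, fun h => by omega⟩
    have : r ≠ 9 := by omega
    simp [Store.setReg, this, h1 r hr]
  · rintro k hk τ ⟨-, h1, h2, h3, h4, h5, h6⟩
    have hs : ∀ r, r ≠ 9 → (τ.setReg 9 k).reg r = τ.reg r := fun r hr => by
      simp [Store.setReg, hr]
    have h9 : (τ.setReg 9 k).reg 9 = k := by simp [Store.setReg]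
    have ht : (τ.setReg 9 k).tab = σ.tab := h2
    have h8 : ∀ r < 8, (τ.setReg 9 k).reg r = σ.reg r := fun r hr =>
      (hs r (by omega)).trans (h1 r hr)
    refine (reaches_neighborBody (hR _ h8)).mono le_rfl ?_
    rintro ρ ⟨a1, a2, a3, a4⟩
    rw [ht, h8 7 (by omega), h9, hp'] at a3 a4
    rw [hs 8 (by omega)] at a3 a4
    rw [hs 10 (by omega)] at a4
    refine ⟨(a1 9 (by omega) (by omega)).trans h9,
      fun r hr => (a1 r (by omega) (by omega)).trans (h8 r hr), a2.trans ht, ?_⟩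
    have low : ∀ y, k ≤ y → y = k ∨ k + 1 ≤ y := fun y _ => by omega
    by_cases hpk : p k
    · obtain ⟨b1, b2⟩ := a3 hpk
      refine ⟨fun h => by omega, fun _ => ⟨k, hk, le_rfl, b2, hpk⟩, fun h y hy hky hpy => ?_,
        fun h => ?_⟩
      · obtain rfl | hlt := low y hky
        · exact b2.symm
        · exact absurd hpy (h3 (by omega) y hy hlt)
      · obtain ⟨q, hq, hkq, -, hpq⟩ := h4 (by omega)
        exact ⟨k, hk, q, hq, by omega, hpk, hpq⟩
    · obtain ⟨b1, b2⟩ := a4 hpk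
      rw [b1, b2]
      refine ⟨fun h y hy hky => ?_, fun h => ?_, fun h y hy hky hpy => ?_, h6⟩
      · obtain rfl | hlt := low y hky
        · exact hpk
        · exact h3 h y hy hlt
      · obtain ⟨q, hq, hkq, h'⟩ := h4 h
        exact ⟨q, hq, by omega, h'⟩
      · obtain rfl | hlt := low y hky
        · exact absurd hpy hpk
        · exact h5 h y hy hlt hpy
  · rintro ρ ⟨-, b1, b2, b3, b4, b5, b6⟩
    refine ⟨b1, b2, fun h y hy => b3 h y hy y.zero_le, fun h => ?_, b6⟩
    obtain ⟨q, hq, -, hq', hpq⟩ := b4 (by omega)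
    refine ⟨q, hq, hq', fun y hy => ⟨fun hy' => (b5 h y hy y.zero_le hy').trans hq', ?_⟩⟩
    rintro rfl
    exact hpq

end Invariant

/-! ### Eliminating all leaves -/

section Program

/-- Remove the vertex in register 7 and attach its branch to the vertex in register 10. -/
def removeLeaf : Program :=
  .seq (.seq (.store 1 7 3 2) (.sub 4 4 2)) adjustLoop

/-- Remove the vertex in register 7 if it is a remaining leaf. -/
def visitVertex : Program :=
  .seq (.load 8 1 7 3) (.cond 8 .skip (.seq neighborLoop (.seq (.sub 11 8 2)
    (.cond 8 (.cond 11 .skip removeLeaf) .skip))))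

/-- The running time of `visitVertex`. -/
def visitCost (n : ℕ) : ℕ :=
  1 + (1 + (n * (neighborBody.size + 2) + 2) + (1 + ((2 + adjustCost n) + 1 + 1)) + 1)

/-- The vertex `x` is not a remaining leaf. -/
def NotLeafAt {n : ℕ} (G : SimpleGraph (Fin n)) (f : ℕ → ℕ → ℕ → ℕ) (x : Fin n) : Prop :=
  x ∈ alive n f → ∀ q ∈ alive n f, G.Adj x q → ∃ y ∈ alive n f, G.Adj x y ∧ y ≠ q

variable {n : ℕ} {G : SimpleGraph (Fin n)} {σ τ : Store}

lemma reaches_removeLeaf (h : Invariant G σ) {v q : Fin n} (h7 : σ.reg 7 = v) (h10 : σ.reg 10 = q)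
    (hv : v ∈ alive n σ.tab) (hq : q ∈ alive n σ.tab) (hvq : G.Adj v q)
    (huniq : ∀ y ∈ alive n σ.tab, G.Adj v y → y = q) :
    Reaches removeLeaf σ (2 + adjustCost n) fun τ =>
      (∀ r < 12, r ≠ 4 → τ.reg r = σ.reg r) ∧ Invariant G τ ∧ τ.reg 4 < σ.reg 4 := by
  obtain ⟨r0, r2, r3⟩ := h.ready
  have hpos : 0 < σ.reg 4 := by
    rw [h.card]
    exact (Set.ncard_pos).2 ⟨v, hv⟩
  have hfirst : Reaches (.seq (.store 1 7 3 2) (.sub 4 4 2)) σ 2 fun τ =>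
      (∀ r, r ≠ 4 → τ.reg r = σ.reg r) ∧ τ.reg 4 = σ.reg 4 - 1 ∧
      ∀ k i j, τ.tab k i j = if k = 1 ∧ i = v ∧ j = 0 then 1 else σ.tab k i j := by
    refine Program.LoopFree.reaches (P := .seq (.store 1 7 3 2) (.sub 4 4 2))
      (by simp [Program.LoopFree]) σ ?_
    simp only [Program.exec, Store.setReg, Store.setTab, r2, r3, h7, Function.update_self]
    exact ⟨fun r hr => Function.update_of_ne hr _ _, trivial, fun k i j => trivial⟩
  refine hfirst.seq ?_
  rintro τ ⟨a1, a2, a3⟩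
  have e : ∀ k i j, k ≠ 1 → τ.tab k i j = σ.tab k i j := fun k i j hk => by
    rw [a3, if_neg fun h => hk h.1]
  have hR : ∀ τ : Store, (∀ r < 12, r ≠ 4 → τ.reg r = σ.reg r) → τ.Ready n := fun τ h =>
    ⟨(h 0 (by omega) (by omega)).trans r0, (h 2 (by omega) (by omega)).trans r2,
      (h 3 (by omega) (by omega)).trans r3⟩
  have hne : (v : ℕ) ≠ q := fun h => hvq.ne (Fin.ext h)
  refine (reaches_adjustLoop (hR τ fun r _ => a1 r) ?_).mono le_rfl ?_
  · rw [a1 7 (by omega), a1 10 (by omega), h7, h10]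
    exact hne
  rintro ρ ⟨b1, b2, b3⟩
  rw [a1 10 (by omega), h10] at b2 b3
  rw [a1 7 (by omega), h7] at b3
  have hreg : ∀ r < 12, r ≠ 4 → ρ.reg r = σ.reg r := fun r hr hr4 =>
    (b1 r hr).trans (a1 r hr4)
  have hcard : ρ.reg 4 = σ.reg 4 - 1 := (b1 4 (by omega)).trans a2
  refine ⟨hreg, h.remove_leaf hv hq hvq huniq (hR ρ hreg) hcard ?_ ?_ ?_ ?_, by omega⟩
  · funext i j
    rw [b2 0 i j (by omega), e 0 i j (by omega)]
  · ext x
    simp only [alive, Set.mem_ofPred_eq, Set.mem_sdiff, Set.mem_singleton_iff]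
    rw [b2 1 x 0 (by omega), a3]
    by_cases hx : x = v
    · simp [hx]
    · have : (x : ℕ) ≠ v := fun h => hx (Fin.ext h)
      simp [hx, this]
  · intro k i j hk hi
    rw [b2 k i j (.inr hi), e k i j (by omega)]
  · have e2 := fun i j => e 2 i j (by omega)
    have e3 := fun i j => e 3 i j (by omega)
    have e4 := fun i j => e 4 i j (by omega)
    simpa only [Adjusted, Admits, e2, e3, e4] using b3

/-- Each outcome also records whether `x` was a leaf, so that a pass without removals certifies that
no leaf is left. -/
lemma reaches_visitVertex (h : Invariant G σ) {x : Fin n} (h7 : σ.reg 7 = x) :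
    Reaches visitVertex σ (visitCost n) fun τ =>
      (∀ r < 8, r ≠ 4 → τ.reg r = σ.reg r) ∧ Invariant G τ ∧
      (τ.reg 4 < σ.reg 4 ∧ ¬ NotLeafAt G σ.tab x ∨
        τ.reg 4 = σ.reg 4 ∧ τ.tab = σ.tab ∧ NotLeafAt G σ.tab x) := by
  have r3 := h.ready.2.2
  have hfirst : Reaches (.load 8 1 7 3) σ 1 fun τ =>
      (∀ r < 8, τ.reg r = σ.reg r) ∧ τ.tab = σ.tab ∧ τ.reg 8 = σ.tab 1 x 0 :=
    ⟨1, _, .load _ _ _ _ _, le_rfl, fun r hr => by simp [Store.setReg, hr.ne], rfl, by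
      simp [Store.setReg, h7, r3]⟩
  refine hfirst.seq ?_
  clear hfirst
  rintro τ ⟨a1, a2, a3⟩
  have keep : ∀ τ : Store, (∀ r < 8, τ.reg r = σ.reg r) → τ.tab = σ.tab → Invariant G τ :=
    fun τ h1 h2 => h.congr h2 (h1 0 (by omega)) (h1 2 (by omega)) (h1 3 (by omega))
      (h1 4 (by omega))
  refine Reaches.cond (fun h8 => ?_) fun h8 => ?_
  · refine (Program.LoopFree.reaches (P := .skip) trivial τ ?_).mono
      (show 1 ≤ _ by omega) fun _ => id
    refine ⟨fun r hr _ => a1 r hr, keep τ a1 a2, .inr ⟨a1 4 (by omega), a2, fun hx => ?_⟩⟩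
    exact absurd (a3.trans hx) h8
  have hx : x ∈ alive n σ.tab := a3.symm.trans h8
  refine (reaches_neighborLoop (keep τ a1 a2).ready).seq ?_
  rintro ρ ⟨b1, b2, b3, b4, b5⟩
  rw [a1 7 (by omega), h7, a2] at b3 b4 b5
  have hρ : ∀ r < 8, ρ.reg r = σ.reg r := fun r hr => (b1 r hr).trans (a1 r hr)
  have hρt : ρ.tab = σ.tab := b2.trans a2
  have iρ := keep ρ hρ hρt
  have hsub : Reaches (.sub 11 8 2) ρ 1 fun ω =>
      (∀ r < 11, ω.reg r = ρ.reg r) ∧ ω.tab = ρ.tab ∧ ω.reg 11 = ρ.reg 8 - 1 :=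
    ⟨1, _, .sub _ _ _ _, le_rfl, fun r hr => by simp [Store.setReg, hr.ne], rfl, by
      simp [Store.setReg, iρ.ready.2.1]⟩
  refine hsub.seq ?_
  clear hsub
  rintro ω ⟨c1, c2, c3⟩
  have hω : ∀ r < 8, ω.reg r = σ.reg r := fun r hr => (c1 r (by omega)).trans (hρ r hr)
  have hωt : ω.tab = σ.tab := c2.trans hρt
  have c8 : ω.reg 8 = ρ.reg 8 := c1 8 (by omega)
  have stay : NotLeafAt G σ.tab x → ∀ T, 1 ≤ T → Reaches .skip ω T fun τ =>
      (∀ r < 8, r ≠ 4 → τ.reg r = σ.reg r) ∧ Invariant G τ ∧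
      (τ.reg 4 < σ.reg 4 ∧ ¬ NotLeafAt G σ.tab x ∨
        τ.reg 4 = σ.reg 4 ∧ τ.tab = σ.tab ∧ NotLeafAt G σ.tab x) := fun hleaf T hT =>
    (Program.LoopFree.reaches (P := .skip) trivial ω
      ⟨fun r hr _ => hω r hr, keep ω hω hωt, .inr ⟨hω 4 (by omega), hωt, hleaf⟩⟩).mono
      (show 1 ≤ T from hT) fun _ => id
  have hp : ∀ y : Fin n, (σ.tab 1 y 0 = 0 ∧ σ.tab 0 x y ≠ 0) ↔ y ∈ alive n σ.tab ∧ G.Adj x y :=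
    fun y => and_congr Iff.rfl (h.adj x y)
  refine Reaches.cond (fun h8' => Reaches.cond (fun h11 => ?_) fun h11 => ?_) fun h8' => ?_
  · refine stay (fun _ q _ _ => ?_) _ (by omega)
    obtain ⟨y, hy, y', hy', hne, p, p'⟩ := b5 (by omega)
    obtain ⟨p1, p2⟩ := (hp ⟨y, hy⟩).1 p
    obtain ⟨p1', p2'⟩ := (hp ⟨y', hy'⟩).1 p'
    by_cases hyq : (⟨y, hy⟩ : Fin n) = q
    · refine ⟨⟨y', hy'⟩, p1', p2', fun hq => hne ?_⟩
      exact congrArg Fin.val (hyq.trans hq.symm)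
    · exact ⟨⟨y, hy⟩, p1, p2, hyq⟩
  · obtain ⟨q, hq, h10, hall⟩ := b4 (by omega)
    have huniq : ∀ y : Fin n, y ∈ alive n σ.tab ∧ G.Adj x y ↔ y = ⟨q, hq⟩ := fun y => by
      rw [← hp, hall y y.2, Fin.ext_iff]
    obtain ⟨hqa, hxq⟩ := (huniq ⟨q, hq⟩).2 rfl
    refine (reaches_removeLeaf (q := ⟨q, hq⟩) (keep ω hω hωt) ((hω 7 (by omega)).trans h7)
      ((c1 10 (by omega)).trans h10) (hωt ▸ hx) (hωt ▸ hqa) hxq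
      (hωt ▸ fun y hy hxy => (huniq y).1 ⟨hy, hxy⟩)).mono le_rfl ?_
    rintro π ⟨d1, d2, d3⟩
    refine ⟨fun r hr hr4 => (d1 r (by omega) hr4).trans (hω r hr), d2, .inl ⟨?_, fun hn => ?_⟩⟩
    · rwa [hω 4 (by omega)] at d3
    · obtain ⟨y, hy, hxy, hne⟩ := hn hx _ hqa hxq
      exact hne ((huniq y).1 ⟨hy, hxy⟩)
  · refine stay (fun _ q hqa hxq => ?_) _ (by omega)
    exact absurd ((hp q).2 ⟨hqa, hxq⟩) (b3 (by omega) q q.2)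

/-- Visit all vertices. -/
def visitAll : Program :=
  forDown 7 visitVertex

lemma reaches_visitAll (h : Invariant G σ) :
    Reaches visitAll σ (n * (visitCost n + 2) + 2) fun τ =>
      (∀ r < 7, r ≠ 4 → τ.reg r = σ.reg r) ∧ Invariant G τ ∧
      (τ.reg 4 < σ.reg 4 ∧ ¬ (∀ x, NotLeafAt G σ.tab x) ∨
        τ.reg 4 = σ.reg 4 ∧ τ.tab = σ.tab ∧ ∀ x, NotLeafAt G σ.tab x) := by
  refine (reaches_forDown h.ready (fun k τ => τ.reg 7 = k ∧
      (∀ r < 7, r ≠ 4 → τ.reg r = σ.reg r) ∧ Invariant G τ ∧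
      (τ.reg 4 < σ.reg 4 ∧ ¬ (∀ x, NotLeafAt G σ.tab x) ∨
        τ.reg 4 = σ.reg 4 ∧ τ.tab = σ.tab ∧ ∀ x : Fin n, k ≤ x → NotLeafAt G σ.tab x))
    (fun k τ h => ⟨h.2.2.1.ready, h.1⟩) ?_ ?_).mono le_rfl ?_
  · refine ⟨by simp [Store.setReg], fun r hr _ => ?_, h.congr rfl ?_ ?_ ?_ ?_,
      .inr ⟨?_, rfl, fun x hx => absurd x.2 (by omega)⟩⟩
    · simp [Store.setReg, hr.ne]
    all_goals simp [Store.setReg]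
  · rintro k hk τ ⟨-, a1, a2, a3⟩
    have hs : ∀ r, r ≠ 7 → (τ.setReg 7 k).reg r = τ.reg r := fun r hr => by
      simp [Store.setReg, hr]
    have inv : Invariant G (τ.setReg 7 k) :=
      a2.congr rfl (hs _ (by omega)) (hs _ (by omega)) (hs _ (by omega)) (hs _ (by omega))
    have h7 : (τ.setReg 7 k).reg 7 = (⟨k, hk⟩ : Fin n) := by simp [Store.setReg]
    refine (reaches_visitVertex inv h7).mono le_rfl ?_
    rintro ρ ⟨b1, b2, b3⟩
    rw [hs 4 (by omega)] at b3
    change ρ.reg 4 < τ.reg 4 ∧ ¬ NotLeafAt G τ.tab _ ∨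
      ρ.reg 4 = τ.reg 4 ∧ ρ.tab = τ.tab ∧ NotLeafAt G τ.tab _ at b3
    refine ⟨(b1 7 (by omega) (by omega)).trans h7, fun r hr hr4 => ?_, b2, ?_⟩
    · rw [b1 r (by omega) hr4, hs r (by omega), a1 r hr hr4]
    -- The tables are unchanged until the first removal, so the first removed vertex was already a
    -- leaf before the pass.
    · obtain ⟨c1, c2⟩ | ⟨c1, c2, c3⟩ := a3
      · refine .inl ⟨?_, c2⟩
        obtain ⟨d, -⟩ | ⟨d, -⟩ := b3 <;> omega
      · rw [c2] at b3
        obtain ⟨d1, d2⟩ | ⟨d1, d2, d3⟩ := b3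
        · exact .inl ⟨by omega, fun hall => d2 (hall _)⟩
        · refine .inr ⟨d1.trans c1, d2, fun x hx => ?_⟩
          obtain hx | hx := hx.eq_or_lt
          · rwa [show x = ⟨k, hk⟩ from Fin.ext hx.symm]
          · exact c3 x hx
  · rintro ρ ⟨-, b1, b2, b3⟩
    simp only [zero_le, forall_const] at b3
    exact ⟨b1, b2, b3⟩

/-- Remove leaves as long as possible. -/
def removeLeaves : Program :=
  forDown 6 visitAll

/-- Each pass that starts with a leaf lowers the number of remaining vertices. After `n` passes
without reaching a leafless state that number would be 0, but the neighbour of a removed leaf always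
remains. -/
lemma reaches_removeLeaves (h : Invariant G σ) (h4 : σ.reg 4 = n) :
    Reaches removeLeaves σ (n * (n * (visitCost n + 2) + 2 + 2) + 2) fun τ =>
      (∀ r < 4, τ.reg r = σ.reg r) ∧ Invariant G τ ∧ ∀ x, NotLeafAt G τ.tab x := by
  refine (reaches_forDown h.ready (fun k τ => τ.reg 6 = k ∧
      (∀ r < 4, τ.reg r = σ.reg r) ∧ Invariant G τ ∧
      (τ.reg 4 ≤ k ∨ ∀ x, NotLeafAt G τ.tab x))
    (fun k τ h => ⟨h.2.2.1.ready, h.1⟩) ?_ ?_).mono le_rfl ?_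
  · refine ⟨by simp [Store.setReg], fun r hr => ?_, h.congr rfl ?_ ?_ ?_ ?_, .inl ?_⟩
    · have : r ≠ 6 := by omega
      simp [Store.setReg, this]
    all_goals simp [Store.setReg, h4]
  · rintro k hk τ ⟨-, a1, a2, a3⟩
    have hs : ∀ r, r ≠ 6 → (τ.setReg 6 k).reg r = τ.reg r := fun r hr => by
      simp [Store.setReg, hr]
    have inv : Invariant G (τ.setReg 6 k) :=
      a2.congr rfl (hs _ (by omega)) (hs _ (by omega)) (hs _ (by omega)) (hs _ (by omega))
    have h6 : (τ.setReg 6 k).reg 6 = k := by simp [Store.setReg]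
    refine (reaches_visitAll inv).mono le_rfl ?_
    rintro ρ ⟨b1, b2, b3⟩
    rw [hs 4 (by omega)] at b3
    change ρ.reg 4 < τ.reg 4 ∧ ¬ (∀ x, NotLeafAt G τ.tab x) ∨
      ρ.reg 4 = τ.reg 4 ∧ ρ.tab = τ.tab ∧ ∀ x, NotLeafAt G τ.tab x at b3
    refine ⟨(b1 6 (by omega) (by omega)).trans h6, fun r hr => ?_, b2, ?_⟩
    · rw [b1 r (by omega) (by omega), hs r (by omega), a1 r hr]
    · obtain ⟨c1, c2⟩ | ⟨-, c2, c3⟩ := b3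
      · obtain d | d := a3
        · exact .inl (by omega)
        · exact absurd d c2
      · exact .inr (c2 ▸ c3)
  · rintro ρ ⟨-, b1, b2, b3⟩
    refine ⟨b1, b2, ?_⟩
    obtain b3 | b3 := b3
    · intro x
      have := (Set.ncard_pos).2 (b2.nonempty (Nat.zero_lt_of_lt x.2))
      have := b2.card
      omega
    · exact b3

end Program

/-! ### The recognizer -/

section Recognizer

/-- Set register 5 to 1 if the vertex in register 7 may have the degree in register 12 without
further contributions. -/
def testDegree : Program :=
  .seq (.load 16 4 7 12) (.cond 16 .skip (.seq (.load 18 2 7 12) (.seq (.load 19 3 7 12)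
    (.seq (.sub 20 18 12) (.seq (.sub 21 12 19) (.seq (.add 20 20 21)
      (.cond 20 .skip (.const 5 1))))))))

/-- Run `testDegree` for all degrees if the vertex in register 7 remains. -/
def testVertex : Program :=
  .seq (.load 8 1 7 3) (.cond 8 .skip (forDown 12 testDegree))

/-- Run `testVertex` for all vertices. -/
def testAll : Program :=
  .seq (.const 5 0) (forDown 7 testVertex)

/-- Give the answer 1 if register 4 is 1 and register 5 is 0. -/
def answer : Program :=
  .seq (.sub 11 4 2) (.cond 4 (.cond 11 .skip (.cond 5 .skip (.const 1 1))) .skip)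

/-- The program that recognises the members of `InB`. -/
def recognizer : Program :=
  .seq (.seq (.const 2 1) (.add 4 0 3)) (.seq removeLeaves (.seq testAll answer))

variable {n : ℕ} {G : SimpleGraph (Fin n)} {σ τ : Store}

lemma reaches_testDegree (σ : Store) :
    Reaches testDegree σ testDegree.size fun τ =>
      (∀ r < 16, r ≠ 5 → τ.reg r = σ.reg r) ∧ τ.tab = σ.tab ∧
      (τ.reg 5 ≠ 0 ↔ σ.reg 5 ≠ 0 ∨ (σ.tab 4 (σ.reg 7) (σ.reg 12) = 0 ∧
        σ.tab 2 (σ.reg 7) (σ.reg 12) ≤ σ.reg 12 ∧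
        σ.reg 12 ≤ σ.tab 3 (σ.reg 7) (σ.reg 12))) := by
  refine Program.LoopFree.reaches (by simp [testDegree, Program.LoopFree]) σ ?_
  simp only [testDegree, Program.exec, Store.setReg, apply_ite Store.reg, ite_apply,
    apply_ite Store.tab, ite_self, Function.update_apply, Nat.reduceEqDiff, if_true, if_false]
  refine ⟨fun r hr h5 => ?_, trivial, ?_⟩
  · have hne : ∀ s, 16 ≤ s → r ≠ s := fun s hs => by omega
    simp [h5, hne]
  · split_ifs <;> omega

/-- The running time of `testVertex`. -/
def testCost (n : ℕ) : ℕ :=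
  1 + ((n * (testDegree.size + 2) + 2) + 1)

lemma reaches_testVertex (hσ : σ.Ready n) {x : Fin n} (h7 : σ.reg 7 = x) :
    Reaches testVertex σ (testCost n) fun τ =>
      (∀ r < 8, r ≠ 5 → τ.reg r = σ.reg r) ∧ τ.tab = σ.tab ∧
      (τ.reg 5 ≠ 0 ↔ σ.reg 5 ≠ 0 ∨ (x ∈ alive n σ.tab ∧ ∃ t, allowed n σ.tab x t t)) := by
  have hfirst : Reaches (.load 8 1 7 3) σ 1 fun τ =>
      (∀ r < 8, τ.reg r = σ.reg r) ∧ τ.tab = σ.tab ∧ τ.reg 8 = σ.tab 1 x 0 :=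
    ⟨1, _, .load _ _ _ _ _, le_rfl, fun r hr => by simp [Store.setReg, hr.ne], rfl, by
      simp [Store.setReg, h7, hσ.2.2]⟩
  refine hfirst.seq ?_
  clear hfirst
  rintro τ ⟨a1, a2, a3⟩
  have hR : ∀ τ : Store, (∀ r < 8, r ≠ 5 → τ.reg r = σ.reg r) → τ.Ready n := fun τ h =>
    ⟨(h 0 (by omega) (by omega)).trans hσ.1, (h 2 (by omega) (by omega)).trans hσ.2.1,
      (h 3 (by omega) (by omega)).trans hσ.2.2⟩
  refine Reaches.cond (fun h8 => ?_) fun h8 => ?_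
  · refine (Program.LoopFree.reaches (P := .skip) trivial τ ?_).mono
      (show 1 ≤ _ by omega) fun _ => id
    refine ⟨fun r hr _ => a1 r hr, a2, ?_⟩
    rw [Program.exec, a1 5 (by omega)]
    exact ⟨.inl, fun h => h.resolve_right fun hx => h8 (a3.trans hx.1)⟩
  have hx : x ∈ alive n σ.tab := a3.symm.trans h8
  refine (reaches_forDown (hR τ fun r hr _ => a1 r hr) (fun k τ => τ.reg 12 = k ∧
      (∀ r < 8, r ≠ 5 → τ.reg r = σ.reg r) ∧ τ.tab = σ.tab ∧
      (τ.reg 5 ≠ 0 ↔ σ.reg 5 ≠ 0 ∨ ∃ t, k ≤ t ∧ allowed n σ.tab x t t))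
    (fun k τ h => ⟨hR τ h.2.1, h.1⟩) ?_ ?_).mono le_rfl ?_
  · have hs : ∀ r < 8, (τ.setReg 12 n).reg r = σ.reg r := fun r hr => by
      have : r ≠ 12 := by omega
      simp [Store.setReg, this, a1 r hr]
    refine ⟨by simp [Store.setReg], fun r hr _ => hs r hr, a2, ?_⟩
    rw [hs 5 (by omega)]
    refine ⟨.inl, fun h => h.resolve_right ?_⟩
    rintro ⟨t, h, h', -⟩
    omega
  · rintro k hk τ ⟨-, h1, h2, h3⟩
    have hs : ∀ r, r ≠ 12 → (τ.setReg 12 k).reg r = τ.reg r := fun r hr => by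
      simp [Store.setReg, hr]
    have h12 : (τ.setReg 12 k).reg 12 = k := by simp [Store.setReg]
    refine (reaches_testDegree _).mono le_rfl ?_
    rintro ρ ⟨b1, b2, b3⟩
    have ht : (τ.setReg 12 k).tab = σ.tab := h2
    rw [hs 5 (by omega), hs 7 (by omega), h12, ht, h1 7 (by omega) (by omega), h7] at b3
    refine ⟨(b1 12 (by omega) (by omega)).trans h12, fun r hr hr5 => ?_, b2.trans ht, ?_⟩
    · rw [b1 r (by omega) hr5, hs r (by omega), h1 r hr hr5]
    · rw [b3, h3, or_assoc]
      refine or_congr_right ⟨?_, ?_⟩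
      · rintro (⟨t, hkt, h⟩ | h)
        · exact ⟨t, by omega, h⟩
        · exact ⟨k, le_rfl, hk, h⟩
      · rintro ⟨t, hkt, h⟩
        obtain rfl | hlt := hkt.eq_or_lt
        · exact .inr h.2
        · exact .inl ⟨t, hlt, h⟩
  · rintro ρ ⟨-, b1, b2, b3⟩
    simp only [zero_le, true_and] at b3
    exact ⟨b1, b2, by rw [b3, and_iff_right hx]⟩

lemma reaches_testAll (hσ : σ.Ready n) :
    Reaches testAll σ (1 + (n * (testCost n + 2) + 2)) fun τ =>
      (∀ r < 5, τ.reg r = σ.reg r) ∧ τ.tab = σ.tab ∧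
      (τ.reg 5 ≠ 0 ↔ ∃ x ∈ alive n σ.tab, ∃ t, allowed n σ.tab x t t) := by
  have hfirst : Reaches (.const 5 0) σ 1 fun τ =>
      (∀ r < 5, τ.reg r = σ.reg r) ∧ τ.tab = σ.tab ∧ τ.reg 5 = 0 :=
    ⟨1, _, .const _ _ _, le_rfl, fun r hr => by simp [Store.setReg, hr.ne], rfl, rfl⟩
  refine hfirst.seq ?_
  clear hfirst
  rintro τ ⟨a1, a2, a3⟩
  have hR : ∀ τ : Store, (∀ r < 5, τ.reg r = σ.reg r) → τ.Ready n := fun τ h =>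
    ⟨(h 0 (by omega)).trans hσ.1, (h 2 (by omega)).trans hσ.2.1, (h 3 (by omega)).trans hσ.2.2⟩
  refine (reaches_forDown (hR τ a1) (fun k τ => τ.reg 7 = k ∧
      (∀ r < 5, τ.reg r = σ.reg r) ∧ τ.tab = σ.tab ∧
      (τ.reg 5 ≠ 0 ↔ ∃ x : Fin n, k ≤ x ∧ x ∈ alive n σ.tab ∧ ∃ t, allowed n σ.tab x t t))
    (fun k τ h => ⟨hR τ h.2.1, h.1⟩) ?_ ?_).mono le_rfl ?_
  · refine ⟨by simp [Store.setReg], fun r hr => ?_, a2, ?_⟩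
    · have : r ≠ 7 := by omega
      simp [Store.setReg, this, a1 r hr]
    · have h5 : (τ.setReg 7 n).reg 5 = 0 := by simpa [Store.setReg] using a3
      refine ⟨fun h => absurd h5 h, ?_⟩
      rintro ⟨x, hx, -⟩
      have := x.2
      omega
  · rintro k hk τ ⟨-, h1, h2, h3⟩
    have hs : ∀ r, r ≠ 7 → (τ.setReg 7 k).reg r = τ.reg r := fun r hr => by
      simp [Store.setReg, hr]
    have h7 : (τ.setReg 7 k).reg 7 = (⟨k, hk⟩ : Fin n) := by simp [Store.setReg]
    have h5 : ∀ r < 5, (τ.setReg 7 k).reg r = σ.reg r := fun r hr =>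
      (hs r (by omega)).trans (h1 r hr)
    refine (reaches_testVertex (hR _ h5) h7).mono le_rfl ?_
    rintro ρ ⟨b1, b2, b3⟩
    have ht : (τ.setReg 7 k).tab = σ.tab := h2
    rw [hs 5 (by omega), ht] at b3
    refine ⟨(b1 7 (by omega) (by omega)).trans h7,
      fun r hr => (b1 r (by omega) (by omega)).trans (h5 r hr), b2.trans ht, ?_⟩
    rw [b3, h3]
    constructor
    · rintro (⟨x, hkx, h⟩ | h)
      · exact ⟨x, by omega, h⟩
      · exact ⟨⟨k, hk⟩, le_rfl, h⟩
    · rintro ⟨x, hkx, h⟩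
      obtain hkx | hlt := hkx.eq_or_lt
      · rw [show x = ⟨k, hk⟩ from Fin.ext hkx.symm] at h
        exact .inr h
      · exact .inl ⟨x, hlt, h⟩
  · rintro ρ ⟨-, b1, b2, b3⟩
    simp only [zero_le, true_and] at b3
    exact ⟨b1, b2, b3⟩

/-- Without leaves, being a tree means that one vertex remains. Its degree must then consist of
contributions alone, so a proper weighting exists exactly when some `t` is a permitted contribution
for the degree `t`. -/
lemma Invariant.inB_iff (h : Invariant G σ) (hleaf : ∀ x, NotLeafAt G σ.tab x) :
    InB G ↔ σ.reg 4 = 1 ∧ ¬ ∃ x ∈ alive n σ.tab, ∃ t, allowed n σ.tab x t t := by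
  rw [inB_iff_isBadTree, IsBadTree, ← h.tree, not_induce_isTree_of_no_leaf hleaf, ← h.card]
  refine and_congr_right fun h1 => not_congr ?_
  obtain ⟨z, hz⟩ := Set.ncard_eq_one.1 (h.card.symm.trans h1)
  rw [← h.solvable, hz, solvable_singleton_iff]
  simp

/-- The zero entries need no initialisation: nothing is removed or excluded, and every degree below
`n` has the interval consisting of 0, as in `solvable_univ_iff`. -/
lemma invariant_of_init (h0 : σ.reg 0 = n) (h2 : σ.reg 2 = 1) (h3 : σ.reg 3 = 0)
    (h4 : σ.reg 4 = n) (ht : σ.tab = (inputStore G).tab) : Invariant G σ := by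
  have hzero : ∀ k i j, k ≠ 0 → σ.tab k i j = 0 := fun k i j hk => by
    simp [ht, inputStore, hk]
  have ha : alive n σ.tab = Set.univ := Set.eq_univ_of_forall fun x => hzero 1 x 0 one_ne_zero
  refine ⟨⟨h0, h2, h3⟩, fun x y => ?_, ?_, fun hn => ?_, ?_, ?_, fun x t _ _ => ?_⟩
  · simp [ht, inputStore]
  · rw [ha, h4, Set.ncard_univ, Nat.card_fin]
  · rw [ha]
    exact ⟨⟨0, hn⟩, trivial⟩
  · rw [ha]
    exact (SimpleGraph.induceUnivIso G).isTree_iff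
  · rw [ha, ← solvable_univ_iff]
    have : allowed n σ.tab = fun _ t c => t < Fintype.card (Fin n) ∧ c = 0 := by
      funext x t c
      simp [allowed, hzero]
    rw [this]
  · rw [hzero 2 _ _ (by omega)]
    exact Nat.zero_le _

/-- Correctness rests on badness rather than on the recursive rules. The polynomials copy the cost
functions, with the sizes of the loop-free pieces as constants. -/
theorem decidableInPolyTime_inB : DecidableInPolyTime (fun G => InB G) := by
  open Polynomial in
  let admitsPoly : ℕ[X] := 2 + (X * (C admitsBody.size + 2) + 2)
  let adjustPoly : ℕ[X] := X * (admitsPoly + C adjustBody.size + 2) + 2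
  let visitPoly : ℕ[X] :=
    1 + (1 + (X * (C neighborBody.size + 2) + 2) + (1 + ((2 + adjustPoly) + 1 + 1)) + 1)
  let removePoly : ℕ[X] := X * (X * (visitPoly + 2) + 2 + 2) + 2
  let testPoly : ℕ[X] := 1 + (X * (1 + ((X * (C testDegree.size + 2) + 2) + 1) + 2) + 2)
  refine ⟨recognizer, 2 + (removePoly + (testPoly + C answer.size)), fun n G => ?_⟩
  suffices h : Reaches recognizer (inputStore G)
      (2 + ((n * (n * (visitCost n + 2) + 2 + 2) + 2) +
        ((1 + (n * (testCost n + 2) + 2)) + answer.size)))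
      (fun τ => (InB G → τ.reg 1 = 1) ∧ (¬ InB G → τ.reg 1 = 0)) by
    obtain ⟨m, τ, hr, hm, hQ⟩ := h
    refine ⟨m, τ, hr, hm.trans (le_of_eq ?_), hQ⟩
    simp [admitsPoly, adjustPoly, visitPoly, removePoly, testPoly, visitCost, testCost, adjustCost]
  have hfirst : Reaches (.seq (.const 2 1) (.add 4 0 3)) (inputStore G) 2 fun τ =>
      τ.reg 0 = n ∧ τ.reg 1 = 0 ∧ τ.reg 2 = 1 ∧ τ.reg 3 = 0 ∧ τ.reg 4 = n ∧
        τ.tab = (inputStore G).tab := by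
    refine Program.LoopFree.reaches (P := .seq (.const 2 1) (.add 4 0 3))
      (by simp [Program.LoopFree]) _ ?_
    simp [Program.exec, Store.setReg, inputStore]
  refine hfirst.seq ?_
  rintro σ ⟨h0, h1, h2, h3, h4, ht⟩
  refine (reaches_removeLeaves (invariant_of_init h0 h2 h3 h4 ht) h4).seq ?_
  rintro τ ⟨a1, a2, a3⟩
  refine (reaches_testAll a2.ready).seq ?_
  rintro ρ ⟨b1, b2, b3⟩
  refine Program.LoopFree.reaches (by simp [answer, Program.LoopFree]) _ ?_
  have c1 : ρ.reg 1 = 0 := (b1 1 (by omega)).trans ((a1 1 (by omega)).trans h1)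
  have c2 : ρ.reg 2 = 1 := (b1 2 (by omega)).trans a2.ready.2.1
  rw [a2.inB_iff a3, ← b3, ← b1 4 (by omega)]
  simp only [answer, Program.exec, Store.setReg, apply_ite Store.reg, ite_apply,
    Function.update_apply, Nat.reduceEqDiff, if_true, if_false, c1, c2]
  constructor <;> split_ifs <;> omega

end Recognizer

end ZeroOneTrees

/-! ### The theorem -/

theorem theorem4 :
    (∀ (V : Type u) [Fintype V] (T : SimpleGraph V), T.IsTree →
      ¬ ZeroOneTrees.InB T → ZeroOneTrees.HasZeroOneProperty T) ∧
    (∀ (V : Type u) [Fintype V] (T : SimpleGraph V), ZeroOneTrees.InB T →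
      ZeroOneTrees.IsBadTree T) ∧
    (∀ (V : Type u) [Fintype V] (T : SimpleGraph V) (v : V),
      (ZeroOneTrees.Built .minus T v ↔ ZeroOneTrees.IsMinusTree T v) ∧
      (∀ s : ℕ, ZeroOneTrees.Built (.plusOne s) T v ↔
        ZeroOneTrees.IsTwoValueTree s (s + 1) T v) ∧
      (∀ s : ℕ, ZeroOneTrees.Built (.plusThree s) T v ↔
        ZeroOneTrees.IsTwoValueTree s (s + 3) T v)) ∧
    ZeroOneTrees.DecidableInPolyTime (fun G => ZeroOneTrees.InB G) := by
  refine ⟨fun V _ T hT hB => ?_, fun V _ T h => ZeroOneTrees.inB_iff_isBadTree.1 h,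
    fun V _ T v => ⟨?_, fun s => ?_, fun s => ?_⟩, ?_⟩
  · by_contra h
    exact hB (ZeroOneTrees.inB_iff_isBadTree.2 ⟨hT, h⟩)
  · rw [ZeroOneTrees.built_iff_isKind, ZeroOneTrees.isKind_minus_iff]
  · rw [ZeroOneTrees.built_iff_isKind, ZeroOneTrees.isKind_plusOne_iff]
  · rw [ZeroOneTrees.built_iff_isKind, ZeroOneTrees.isKind_plusThree_iff]
  · exact ZeroOneTrees.decidableInPolyTime_inB
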